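/- Let $R$ be a principal ideal domain. **Hyper(di)graphs.** A hyperdigraph $\vec{\mathcal H}$ on a set $V$ is a set of nonempty finite sequences of pairwise distinct elements of $V$ (directed hyperedges). A hypergraph $\mathcal H$ on $V$ is a set of nonempty finite subsets of $V$. The underlying hypergraph of $\vec{\mathcal H}$ consists of the sets of entries of its directed hyperedges. A directed simplicial complex is a hyperdigraph closed under nonempty subsequences, and a simplicial complex is a hypergraph closed under nonempty subsets. $\delta$ denotes the largest (directed) simplicial complex contained in a hyper(di)graph, and $\Delta$ the smallest one containing it. A morphism $\vec{\mathcal H}\to\vec{\mathcal G}$ is a map of vertices carrying every directed hyperedge of $\vec{\mathcal H}$, entry by entry, to a directed hyperedge of $\vec{\mathcal G}$. It induces a morphism of the underlying hypergraphs $\mathcal H\to\mathcal G$. For disjoint $V$ and $V'$ the join $\vec{\mathcal H}*\vec{\mathcal H}'$ on $V\sqcup V'$ consists of the directed hyperedges of $\vec{\mathcal H}$, those of $\vec{\mathcal H}'$, and all concatenations $(\vec\sigma,\vec\sigma')$ with $\vec\sigma\in\vec{\mathcal H}$, $\vec\sigma'\in\vec{\mathcal H}'$. The join $\mathcal H*\mathcal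 H'$ of hypergraphs is defined in the same way, with unions in place of concatenations. All vertex sets are totally ordered (by arbitrary fixed orders), with $V\prec V'$ in $V\sqcup V'$; morphisms need not preserve the orders. **Homology.** Let $R(\vec{\mathcal H}_k)$ be the free $R$-module on the directed hyperedges with $k$ vertices for $k\ge 1$, augmented by $R(\vec{\mathcal H}_0)=R$, spanned by the empty sequence, and set $R(\vec{\mathcal H}_{-1})=0$. Let $\vec\partial(v_1,\dots,v_k)=\sum_{i=1}^k(-1)^{i-1}(v_1,\dots,\widehat{v_i},\dots,v_k)$, so that $\vec\partial(v)=()$ and $\vec\partial()=0$. The reduced embedded homology $\tilde H_{k-1}(\vec{\mathcal H};R)$, $k\ge 0$, is the homology of the augmented infimum complex $$\mathrm{Inf}_{k-1}(\vec{\mathcal H};R)=R(\vec{\mathcal H}_k)\cap\vec\partial^{\,-1}R(\vec{\mathcal H}_{k-1}).$$ For hypergraphs it is defined in the same way, writing every hyperedge as $\{v_1\prec\dots\prec v_k\}$. For (directed) simplicial complexes it is reduced simplicial homology. The projection $\pi_*$ from the homology of $\delta\vec{\mathcal H}$, $\vec{\mathcal H}$, $\Delta\vec{\mathcal H}$ to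 that of $\delta\mathcal H$, $\mathcal H$, $\Delta\mathcal H$, where $\mathcal H$ underlies $\vec{\mathcal H}$, is induced by $(v_{s(1)},\dots,v_{s(k)})\mapsto\mathrm{sgn}(s)\{v_1,\dots,v_k\}$ for $v_1\prec\dots\prec v_k$. A morphism of hypergraphs $\varphi$ acts on chains by $\{v_1\prec\dots\prec v_k\}\mapsto\mathrm{sgn}(s)\{w_1\prec\dots\prec w_k\}$ when $(\varphi(v_1),\dots,\varphi(v_k))=(w_{s(1)},\dots,w_{s(k)})$, and by $0$ when $\varphi$ is not injective on the hyperedge. **Theorem.** For all hyperdigraphs $\vec{\mathcal H}$ and $\vec{\mathcal H}'$ on disjoint vertex sets, all hypergraphs $\mathcal H$ and $\mathcal H'$ on disjoint vertex sets, and all $m\ge -1$, there are homomorphisms onto the $\mathrm{Tor}$ terms of the following sequences $\mathbf{KU}_m(\vec{\mathcal H},\vec{\mathcal H}')$ and $\mathbf{KU}_m(\mathcal H,\mathcal H')$, $$0\to\bigoplus_{\substack{p+q=m-1\\ p,q\ge -1}}\tilde H_p(\vec{\mathcal H};R)\otimes_R\tilde H_q(\vec{\mathcal H}';R)\to\tilde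 H_m(\vec{\mathcal H}*\vec{\mathcal H}';R)\to\bigoplus_{\substack{p+q=m-2\\ p,q\ge -1}}\mathrm{Tor}_1^R(\tilde H_p(\vec{\mathcal H};R),\tilde H_q(\vec{\mathcal H}';R))\to 0,$$ $$0\to\bigoplus_{\substack{p+q=m-1\\ p,q\ge -1}}\tilde H_p(\mathcal H;R)\otimes_R\tilde H_q(\mathcal H';R)\to\tilde H_m(\mathcal H*\mathcal H';R)\to\bigoplus_{\substack{p+q=m-2\\ p,q\ge -1}}\mathrm{Tor}_1^R(\tilde H_p(\mathcal H;R),\tilde H_q(\mathcal H';R))\to 0,$$ whose first maps are induced by the joins of chains $\vec\sigma\otimes\vec\sigma'\mapsto\vec\sigma*\vec\sigma'$ and $\sigma\otimes\sigma'\mapsto\sigma\sqcup\sigma'$, such that the following holds. For all hyperdigraphs $\vec{\mathcal H}$ and $\vec{\mathcal H}'$ on disjoint vertex sets, with underlying hypergraphs $\mathcal H$ and $\mathcal H'$, and all $m\ge -1$, $$\begin{array}{ccccc} \mathbf{KU}_m(\delta\vec{\mathcal H},\delta\vec{\mathcal H}')&\to&\mathbf{KU}_m(\vec{\mathcal H},\vec{\mathcal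 H}')&\to&\mathbf{KU}_m(\Delta\vec{\mathcal H},\Delta\vec{\mathcal H}')\\ \downarrow{\scriptstyle\pi_*}&&\downarrow{\scriptstyle\pi_*}&&\downarrow{\scriptstyle\pi_*}\\ \mathbf{KU}_m(\delta\mathcal H,\delta\mathcal H')&\to&\mathbf{KU}_m(\mathcal H,\mathcal H')&\to&\mathbf{KU}_m(\Delta\mathcal H,\Delta\mathcal H') \end{array}$$ is a commutative diagram in which all six sequences are short exact and all arrows, induced by the inclusions and by $\pi$, are morphisms of short exact sequences. The diagram is functorial: morphisms of hyperdigraphs $\vec{\mathcal H}\to\vec{\mathcal G}$ and $\vec{\mathcal H}'\to\vec{\mathcal G}'$ and the induced morphisms of the underlying hypergraphs induce morphisms between the six short exact sequences, these commute with all arrows of the diagrams, and they respect identities and composition. -/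

import Mathlib

open CategoryTheory TensorProduct DirectSum

universe u

/-! ### Hyperdigraphs and hypergraphs -/

/-- A hyperdigraph on `V`: a set of directed hyperedges, i.e. of nonempty finite sequences of
pairwise distinct vertices. -/
@[ext]
structure Hyperdigraph (V : Type u) where
  edges : Set (List V)
  nodup : ∀ l ∈ edges, l.Nodup
  ne_nil : ∀ l ∈ edges, l ≠ []

/-- A hypergraph on `V`: a set of nonempty finite subsets of `V`. -/
@[ext]
structure FinHypergraph (V : Type u) where
  edges : Set (Finset V)
  nonempty : ∀ s ∈ edges, s.Nonempty

/-- A morphism of hyperdigraphs: a map of vertices carrying directed hyperedges to directed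
hyperedges. -/
@[ext]
structure Hyperdigraph.Hom {V W : Type u} (H : Hyperdigraph V) (G : Hyperdigraph W) where
  toFun : V → W
  map_mem : ∀ l ∈ H.edges, l.map toFun ∈ G.edges

/-- A morphism of hypergraphs: a map of vertices such that the image of every hyperedge is a
hyperedge. -/
@[ext]
structure FinHypergraph.Hom {V W : Type u} (H : FinHypergraph V) (G : FinHypergraph W) where
  toFun : V → W
  map_mem : ∀ s ∈ H.edges, ∃ t ∈ G.edges, (t : Set W) = toFun '' (s : Set V)

namespace Hyperdigraph

variable {V V' W W' X : Type u}

/-- The underlying hypergraph: the sets of entries of the directed hyperedges. -/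
def underlying (H : Hyperdigraph V) : FinHypergraph V where
  edges := {s | ∃ l ∈ H.edges, ∀ v, v ∈ s ↔ v ∈ l}
  nonempty := by
    rintro s ⟨l, hl, h⟩
    obtain ⟨v, hv⟩ := List.exists_mem_of_ne_nil l (H.ne_nil l hl)
    exact ⟨v, (h v).2 hv⟩

/-- A directed simplicial complex: closed under nonempty subsequences. -/
def IsComplex (K : Hyperdigraph V) : Prop :=
  ∀ l ∈ K.edges, ∀ t : List V, t ≠ [] → t.Sublist l → t ∈ K.edges

/-- The lower-associated directed simplicial complex `δH`. -/
def lower (H : Hyperdigraph V) : Hyperdigraph V where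
  edges := {l | l ∈ H.edges ∧ ∀ t : List V, t ≠ [] → t.Sublist l → t ∈ H.edges}
  nodup l hl := H.nodup l hl.1
  ne_nil l hl := H.ne_nil l hl.1

/-- The associated directed simplicial complex `ΔH`. -/
def upper (H : Hyperdigraph V) : Hyperdigraph V where
  edges := {t | t ≠ [] ∧ ∃ l ∈ H.edges, t.Sublist l}
  nodup := by
    rintro t ⟨-, l, hl, h⟩
    exact (H.nodup l hl).sublist h
  ne_nil t ht := ht.1

/-- `δH` is the largest directed simplicial complex contained in `H`. -/
theorem lower_isGreatest (H : Hyperdigraph V) :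
    H.lower.IsComplex ∧ H.lower.edges ⊆ H.edges ∧
      ∀ K : Hyperdigraph V, K.IsComplex → K.edges ⊆ H.edges → K.edges ⊆ H.lower.edges :=
  ⟨fun _ hl t ht h => ⟨hl.2 t ht h, fun s hs h' => hl.2 s hs (h'.trans h)⟩, fun _ hl => hl.1,
    fun _ hK hKH l hl => ⟨hKH hl, fun t ht h => hKH (hK l hl t ht h)⟩⟩

/-- `ΔH` is the smallest directed simplicial complex containing `H`. -/
theorem upper_isLeast (H : Hyperdigraph V) :
    H.upper.IsComplex ∧ H.edges ⊆ H.upper.edges ∧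
      ∀ K : Hyperdigraph V, K.IsComplex → H.edges ⊆ K.edges → H.upper.edges ⊆ K.edges :=
  ⟨fun _ ⟨_, l, hl, h⟩ _ ht h' => ⟨ht, l, hl, h'.trans h⟩,
    fun l hl => ⟨H.ne_nil l hl, l, hl, List.Sublist.refl l⟩,
    fun _ hK hHK t ⟨ht, l, hl, h⟩ => hK l (hHK hl) t ht h⟩

/-- The join: the hyperedges of `H`, those of `H'`, and their concatenations. The disjoint union
of the vertex sets is `V ⊕ₗ V'`; if `V` and `V'` are totally ordered, it carries the order in which
every vertex of `V` precedes every vertex of `V'`. -/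
def join (H : Hyperdigraph V) (H' : Hyperdigraph V') : Hyperdigraph (V ⊕ₗ V') where
  edges := {m | (∃ l ∈ H.edges, m = l.map Sum.inlₗ) ∨ (∃ l' ∈ H'.edges, m = l'.map Sum.inrₗ) ∨
    ∃ l ∈ H.edges, ∃ l' ∈ H'.edges, m = l.map Sum.inlₗ ++ l'.map Sum.inrₗ}
  nodup := by
    have hi : Function.Injective (Sum.inlₗ : V → V ⊕ₗ V') := fun a b h => by
      simpa using h
    have hj : Function.Injective (Sum.inrₗ : V' → V ⊕ₗ V') := fun a b h => by
      simpa using h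
    rintro m (⟨l, hl, rfl⟩ | ⟨l', hl', rfl⟩ | ⟨l, hl, l', hl', rfl⟩)
    · exact (H.nodup l hl).map hi
    · exact (H'.nodup l' hl').map hj
    · refine List.Nodup.append ((H.nodup l hl).map hi) ((H'.nodup l' hl').map hj) ?_
      intro x hx hx'
      obtain ⟨a, -, rfl⟩ := List.mem_map.1 hx
      obtain ⟨b, -, hb⟩ := List.mem_map.1 hx'
      simp at hb
  ne_nil := by
    rintro m (⟨l, hl, rfl⟩ | ⟨l', hl', rfl⟩ | ⟨l, hl, l', hl', rfl⟩)
    · simpa using H.ne_nil l hl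
    · simpa using H'.ne_nil l' hl'
    · simp [H.ne_nil l hl]

/-- The three hyperdigraphs `δH`, `H`, `ΔH` of a hyperdigraph. -/
def level (H : Hyperdigraph V) : Fin 3 → Hyperdigraph V
  | 0 => H.lower
  | 1 => H
  | 2 => H.upper

theorem level_mono (H : Hyperdigraph V) {i j : Fin 3} (h : i ≤ j) :
    (H.level i).edges ⊆ (H.level j).edges := by
  have h0 : H.lower.edges ⊆ H.edges := H.lower_isGreatest.2.1
  have h1 : H.edges ⊆ H.upper.edges := H.upper_isLeast.2.1
  fin_cases i <;> fin_cases j <;>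
    first
      | exact Set.Subset.rfl
      | exact h0
      | exact h1
      | exact h0.trans h1
      | simp at h

namespace Hom

variable {H : Hyperdigraph V} {G : Hyperdigraph W} {H' : Hyperdigraph V'} {G' : Hyperdigraph W'}
  {F : Hyperdigraph X}

/-- The inclusion of a sub-hyperdigraph. -/
def incl {H G : Hyperdigraph V} (h : H.edges ⊆ G.edges) : Hom H G where
  toFun := id
  map_mem l hl := by simpa using h hl

def id (H : Hyperdigraph V) : Hom H H := incl Set.Subset.rfl

def comp (f : Hom H G) (g : Hom G F) : Hom H F where
  toFun := g.toFun ∘ f.toFun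
  map_mem l hl := by simpa using g.map_mem _ (f.map_mem l hl)

/-- The induced morphism of joins. -/
def join (f : Hom H G) (f' : Hom H' G') : Hom (H.join H') (G.join G') where
  toFun v := toLex (Sum.map f.toFun f'.toFun (ofLex v))
  map_mem := by
    rintro m (⟨l, hl, rfl⟩ | ⟨l', hl', rfl⟩ | ⟨l, hl, l', hl', rfl⟩)
    · exact Or.inl ⟨_, f.map_mem l hl, by simp⟩
    · exact Or.inr (Or.inl ⟨_, f'.map_mem l' hl', by simp⟩)
    · exact Or.inr (Or.inr ⟨_, f.map_mem l hl, _, f'.map_mem l' hl', by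
      simp [Function.comp_def]⟩)

/-- The induced morphisms `δH ⟶ δG`, `H ⟶ G`, `ΔH ⟶ ΔG`. -/
def level (f : Hom H G) (i : Fin 3) : Hom (H.level i) (G.level i) where
  toFun := f.toFun
  map_mem := by
    match i with
    | 0 =>
      intro l hl
      refine ⟨f.map_mem l hl.1, fun t ht h => ?_⟩
      obtain ⟨s, hs, rfl⟩ := List.sublist_map_iff.1 h
      exact f.map_mem s (hl.2 s (by rintro rfl; simp at ht) hs)
    | 1 => exact f.map_mem
    | 2 =>
      rintro t ⟨ht, l, hl, h⟩
      exact ⟨by simpa using ht, _, f.map_mem l hl, h.map _⟩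

/-- The induced morphism of the underlying hypergraphs. -/
def underlying (f : Hom H G) : FinHypergraph.Hom H.underlying G.underlying where
  toFun := f.toFun
  map_mem := by
    classical
    rintro s ⟨l, hl, h⟩
    refine ⟨s.image f.toFun, ⟨_, f.map_mem l hl, fun w => ?_⟩, by simp⟩
    simp [h]

end Hom

end Hyperdigraph

namespace FinHypergraph

variable {V V' W W' X : Type u}

/-- A simplicial complex: closed under nonempty subsets. -/
def IsComplex (K : FinHypergraph V) : Prop :=
  ∀ s ∈ K.edges, ∀ t : Finset V, t.Nonempty → t ⊆ s → t ∈ K.edges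

/-- The lower-associated simplicial complex `δH`. -/
def lower (H : FinHypergraph V) : FinHypergraph V where
  edges := {s | s ∈ H.edges ∧ ∀ t : Finset V, t.Nonempty → t ⊆ s → t ∈ H.edges}
  nonempty s hs := H.nonempty s hs.1

/-- The associated simplicial complex `ΔH`. -/
def upper (H : FinHypergraph V) : FinHypergraph V where
  edges := {t | t.Nonempty ∧ ∃ s ∈ H.edges, t ⊆ s}
  nonempty _ ht := ht.1

/-- `δH` is the largest simplicial complex contained in `H`. -/
theorem lower_isGreatest (H : FinHypergraph V) :
    H.lower.IsComplex ∧ H.lower.edges ⊆ H.edges ∧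
      ∀ K : FinHypergraph V, K.IsComplex → K.edges ⊆ H.edges → K.edges ⊆ H.lower.edges :=
  ⟨fun _ hl t ht h => ⟨hl.2 t ht h, fun s hs h' => hl.2 s hs (h'.trans h)⟩, fun _ hl => hl.1,
    fun _ hK hKH l hl => ⟨hKH hl, fun t ht h => hKH (hK l hl t ht h)⟩⟩

/-- `ΔH` is the smallest simplicial complex containing `H`. -/
theorem upper_isLeast (H : FinHypergraph V) :
    H.upper.IsComplex ∧ H.edges ⊆ H.upper.edges ∧
      ∀ K : FinHypergraph V, K.IsComplex → H.edges ⊆ K.edges → H.upper.edges ⊆ K.edges :=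
  ⟨fun _ ⟨_, l, hl, h⟩ _ ht h' => ⟨ht, l, hl, h'.trans h⟩,
    fun l hl => ⟨H.nonempty l hl, l, hl, Finset.Subset.refl l⟩,
    fun _ hK hHK t ⟨ht, l, hl, h⟩ => hK l (hHK hl) t ht h⟩

/-- The union of a finite set of vertices of `V` and one of `V'`, in `V ⊔ V'`. -/
def joinSet (s : Finset V) (s' : Finset V') : Finset (V ⊕ₗ V') :=
  (s.disjSum s').map toLex.toEmbedding

@[simp] theorem inl_mem_joinSet {s : Finset V} {s' : Finset V'} {v : V} :
    (Sum.inlₗ v : V ⊕ₗ V') ∈ joinSet s s' ↔ v ∈ s := by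
  simp [joinSet]

@[simp] theorem inr_mem_joinSet {s : Finset V} {s' : Finset V'} {v : V'} :
    (Sum.inrₗ v : V ⊕ₗ V') ∈ joinSet s s' ↔ v ∈ s' := by
  simp [joinSet]

@[simp] theorem card_joinSet (s : Finset V) (s' : Finset V') :
    (joinSet s s').card = s.card + s'.card := by
  simp [joinSet]

/-- The join: the hyperedges of `H`, those of `H'`, and their unions. -/
def join (H : FinHypergraph V) (H' : FinHypergraph V') : FinHypergraph (V ⊕ₗ V') where
  edges := {m | (∃ s ∈ H.edges, m = joinSet s ∅) ∨ (∃ s' ∈ H'.edges, m = joinSet ∅ s') ∨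
    ∃ s ∈ H.edges, ∃ s' ∈ H'.edges, m = joinSet s s'}
  nonempty := by
    rintro m (⟨s, hs, rfl⟩ | ⟨s', hs', rfl⟩ | ⟨s, hs, s', hs', rfl⟩)
    · obtain ⟨v, hv⟩ := H.nonempty s hs
      exact ⟨Sum.inlₗ v, by simpa using hv⟩
    · obtain ⟨v, hv⟩ := H'.nonempty s' hs'
      exact ⟨Sum.inrₗ v, by simpa using hv⟩
    · obtain ⟨v, hv⟩ := H.nonempty s hs
      exact ⟨Sum.inlₗ v, by simpa using hv⟩

theorem join_mono {H G : FinHypergraph V} {H' G' : FinHypergraph V'} (h : H.edges ⊆ G.edges)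
    (h' : H'.edges ⊆ G'.edges) : (H.join H').edges ⊆ (G.join G').edges := by
  rintro m (⟨s, hs, rfl⟩ | ⟨s', hs', rfl⟩ | ⟨s, hs, s', hs', rfl⟩)
  · exact Or.inl ⟨s, h hs, rfl⟩
  · exact Or.inr (Or.inl ⟨s', h' hs', rfl⟩)
  · exact Or.inr (Or.inr ⟨s, h hs, s', h' hs', rfl⟩)

/-- The three hypergraphs `δH`, `H`, `ΔH` of a hypergraph. -/
def level (H : FinHypergraph V) : Fin 3 → FinHypergraph V
  | 0 => H.lower
  | 1 => H
  | 2 => H.upper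

theorem level_mono (H : FinHypergraph V) {i j : Fin 3} (h : i ≤ j) :
    (H.level i).edges ⊆ (H.level j).edges := by
  have h0 : H.lower.edges ⊆ H.edges := H.lower_isGreatest.2.1
  have h1 : H.edges ⊆ H.upper.edges := H.upper_isLeast.2.1
  fin_cases i <;> fin_cases j <;>
    first
      | exact Set.Subset.rfl
      | exact h0
      | exact h1
      | exact h0.trans h1
      | simp at h

namespace Hom

variable {H : FinHypergraph V} {G : FinHypergraph W} {H' : FinHypergraph V'} {G' : FinHypergraph W'}
  {F : FinHypergraph X}

/-- The inclusion of a sub-hypergraph. -/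
def incl {H G : FinHypergraph V} (h : H.edges ⊆ G.edges) : Hom H G where
  toFun := id
  map_mem s hs := ⟨s, h hs, by simp⟩

def id (H : FinHypergraph V) : Hom H H := incl Set.Subset.rfl

def comp (f : Hom H G) (g : Hom G F) : Hom H F where
  toFun := g.toFun ∘ f.toFun
  map_mem s hs := by
    obtain ⟨t, ht, h⟩ := f.map_mem s hs
    obtain ⟨r, hr, h'⟩ := g.map_mem t ht
    exact ⟨r, hr, by rw [h', h, Set.image_image]; rfl⟩

/-- The induced morphism of joins. -/
def join (f : Hom H G) (f' : Hom H' G') : Hom (H.join H') (G.join G') where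
  toFun v := toLex (Sum.map f.toFun f'.toFun (ofLex v))
  map_mem := by
    have key : ∀ (s : Finset V) (s' : Finset V') (t : Finset W) (t' : Finset W'),
        (t : Set W) = f.toFun '' (s : Set V) → (t' : Set W') = f'.toFun '' (s' : Set V') →
        ((joinSet t t' : Finset (W ⊕ₗ W')) : Set (W ⊕ₗ W')) =
          (fun v : V ⊕ₗ V' => toLex (Sum.map f.toFun f'.toFun (ofLex v))) ''
            (joinSet s s' : Finset (V ⊕ₗ V')) := by
      intro s s' t t' h h'
      have h1 : ∀ w, w ∈ t ↔ ∃ v ∈ s, f.toFun v = w := fun w => by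
        rw [← Finset.mem_coe, h]; simp
      have h2 : ∀ w, w ∈ t' ↔ ∃ v ∈ s', f'.toFun v = w := fun w => by
        rw [← Finset.mem_coe, h']; simp
      ext w
      rcases w with w | w
      · change (Sum.inlₗ w : W ⊕ₗ W') ∈ ((joinSet t t' : Finset (W ⊕ₗ W')) : Set (W ⊕ₗ W')) ↔ _
        rw [Finset.mem_coe, inl_mem_joinSet, h1]
        constructor
        · rintro ⟨v, hv, rfl⟩
          exact ⟨Sum.inlₗ v, by simpa using hv, rfl⟩
        · rintro ⟨x, hx, hxw⟩
          rcases x with v | v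
          · exact ⟨v, inl_mem_joinSet.1 hx, Sum.inl_injective hxw⟩
          · exact absurd hxw Sum.inr_ne_inl
      · change (Sum.inrₗ w : W ⊕ₗ W') ∈ ((joinSet t t' : Finset (W ⊕ₗ W')) : Set (W ⊕ₗ W')) ↔ _
        rw [Finset.mem_coe, inr_mem_joinSet, h2]
        constructor
        · rintro ⟨v, hv, rfl⟩
          exact ⟨Sum.inrₗ v, by simpa using hv, rfl⟩
        · rintro ⟨x, hx, hxw⟩
          rcases x with v | v
          · exact absurd hxw Sum.inl_ne_inr
          · exact ⟨v, inr_mem_joinSet.1 hx, Sum.inr_injective hxw⟩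
    rintro m (⟨s, hs, rfl⟩ | ⟨s', hs', rfl⟩ | ⟨s, hs, s', hs', rfl⟩)
    · obtain ⟨t, ht, h⟩ := f.map_mem s hs
      exact ⟨_, Or.inl ⟨t, ht, rfl⟩, key _ _ _ _ h (by simp)⟩
    · obtain ⟨t', ht', h'⟩ := f'.map_mem s' hs'
      exact ⟨_, Or.inr (Or.inl ⟨t', ht', rfl⟩), key _ _ _ _ (by simp) h'⟩
    · obtain ⟨t, ht, h⟩ := f.map_mem s hs
      obtain ⟨t', ht', h'⟩ := f'.map_mem s' hs'
      exact ⟨_, Or.inr (Or.inr ⟨t, ht, t', ht', rfl⟩), key _ _ _ _ h h'⟩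

/-- The induced morphisms `δH ⟶ δG`, `H ⟶ G`, `ΔH ⟶ ΔG`. -/
def level (f : Hom H G) (i : Fin 3) : Hom (H.level i) (G.level i) where
  toFun := f.toFun
  map_mem := by
    classical
    have sub : ∀ (s : Finset V) (t r : Finset W), (t : Set W) = f.toFun '' (s : Set V) → r ⊆ t →
        r.Nonempty → (s.filter (fun v => f.toFun v ∈ r)).Nonempty ∧
          (r : Set W) = f.toFun '' (s.filter (fun v => f.toFun v ∈ r) : Finset V) := by
      intro s t r h hr hne
      have h1 : ∀ w, w ∈ t ↔ ∃ v ∈ s, f.toFun v = w := fun w => by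
        rw [← Finset.mem_coe, h]; simp
      refine ⟨?_, ?_⟩
      · obtain ⟨w, hw⟩ := hne
        obtain ⟨v, hv, rfl⟩ := (h1 w).1 (hr hw)
        exact ⟨v, by simp [hv, hw]⟩
      · ext w
        simp only [Finset.mem_coe, Set.mem_image, Finset.mem_filter]
        constructor
        · intro hw
          obtain ⟨v, hv, rfl⟩ := (h1 w).1 (hr hw)
          exact ⟨v, ⟨hv, hw⟩, rfl⟩
        · rintro ⟨v, ⟨-, hv⟩, rfl⟩
          exact hv
    match i with
    | 0 =>
      intro s hs
      obtain ⟨t, ht, h⟩ := f.map_mem s hs.1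
      refine ⟨t, ⟨ht, fun r hr hrt => ?_⟩, h⟩
      obtain ⟨h1, h2⟩ := sub s t r h hrt hr
      obtain ⟨r', hr', h3⟩ := f.map_mem _ (hs.2 _ h1 (Finset.filter_subset _ _))
      have : r = r' := Finset.coe_injective (h2.trans h3.symm)
      exact this ▸ hr'
    | 1 => exact f.map_mem
    | 2 =>
      rintro r ⟨hr, s, hs, hrs⟩
      obtain ⟨t, ht, h⟩ := f.map_mem s hs
      refine ⟨r.image f.toFun, ⟨hr.image _, t, ht, ?_⟩, by simp⟩
      rw [← Finset.coe_subset, h, Finset.coe_image]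
      exact Set.image_mono (Finset.coe_subset.2 hrs)

end Hom

end FinHypergraph

namespace Hyperdigraph

variable {V V' : Type u}

/-- The projection sends `δH`, `H`, `ΔH` to `δ`, `id`, `Δ` of the underlying hypergraph. -/
theorem underlying_level (H : Hyperdigraph V) (i : Fin 3) :
    (H.level i).underlying.edges ⊆ (H.underlying.level i).edges := by
  classical
  match i with
  | 0 =>
    rintro s ⟨l, hl, h⟩
    refine ⟨⟨l, hl.1, h⟩, fun t ht hts => ⟨l.filter (· ∈ t), hl.2 _ ?_ List.filter_sublist, ?_⟩⟩
    · obtain ⟨v, hv⟩ := ht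
      exact List.ne_nil_of_mem (a := v) (by simp [hv, ← h, hts hv])
    · intro v
      simp only [List.mem_filter, decide_eq_true_eq, ← h]
      exact ⟨fun hv => ⟨hts hv, hv⟩, fun hv => hv.2⟩
  | 1 => exact Set.Subset.rfl
  | 2 =>
    rintro t ⟨r, ⟨hr, l, hl, hrl⟩, h⟩
    refine ⟨?_, l.toFinset, ⟨l, hl, by simp⟩, fun v hv => ?_⟩
    · obtain ⟨v, hv⟩ := List.exists_mem_of_ne_nil r hr
      exact ⟨v, (h v).2 hv⟩
    · simpa using hrl.subset ((h v).1 hv)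

theorem underlying_join (H : Hyperdigraph V) (H' : Hyperdigraph V') :
    (H.join H').underlying.edges ⊆ (H.underlying.join H'.underlying).edges := by
  classical
  have key : ∀ (m : Finset (V ⊕ₗ V')) (l : List V) (l' : List V'),
      (∀ v, v ∈ m ↔ v ∈ l.map Sum.inlₗ ++ l'.map Sum.inrₗ) →
        m = FinHypergraph.joinSet l.toFinset l'.toFinset := by
    intro m l l' h
    ext v
    rw [h]
    rcases v with v | v
    · change (Sum.inlₗ v : V ⊕ₗ V') ∈ _ ↔ (Sum.inlₗ v : V ⊕ₗ V') ∈ _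
      simp
    · change (Sum.inrₗ v : V ⊕ₗ V') ∈ _ ↔ (Sum.inrₗ v : V ⊕ₗ V') ∈ _
      simp
  rintro m ⟨_, (⟨l, hl, rfl⟩ | ⟨l', hl', rfl⟩ | ⟨l, hl, l', hl', rfl⟩), h⟩
  · exact Or.inl ⟨l.toFinset, ⟨l, hl, by simp⟩, by simpa using key m l [] (by simpa using h)⟩
  · exact Or.inr (Or.inl ⟨l'.toFinset, ⟨l', hl', by simp⟩,
      by simpa using key m [] l' (by simpa using h)⟩)
  · exact Or.inr (Or.inr ⟨l.toFinset, ⟨l, hl, by simp⟩, l'.toFinset, ⟨l', hl', by simp⟩,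
      key m l l' h⟩)

end Hyperdigraph

/-! ### Embedded homology

For a module `M` with a differential `d` and submodules `D k` (`k = 0, 1, …`), the infimum complex
is `D k ∩ d⁻¹ (D (k - 1))`, with `D (-1) = 0`; its homology is cycles modulo boundaries. -/

section Infimum

variable {R : Type u} [CommRing R] {M M' M'' : Type u} [AddCommGroup M] [Module R M]
  [AddCommGroup M'] [Module R M'] [AddCommGroup M''] [Module R M'']

/-- The infimum complex. -/
def infChains (d : M →ₗ[R] M) (D : ℕ → Submodule R M) : ℕ → Submodule R M
  | 0 => D 0 ⊓ LinearMap.ker d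
  | k + 1 => D (k + 1) ⊓ (D k).comap d

def infCycles (d : M →ₗ[R] M) (D : ℕ → Submodule R M) (k : ℕ) : Submodule R M :=
  infChains d D k ⊓ LinearMap.ker d

def infBoundaries (d : M →ₗ[R] M) (D : ℕ → Submodule R M) (k : ℕ) : Submodule R M :=
  (infChains d D (k + 1)).map d

/-- The homology of the infimum complex. -/
abbrev InfHomology (d : M →ₗ[R] M) (D : ℕ → Submodule R M) (k : ℕ) : Type u :=
  infCycles d D k ⧸ (infBoundaries d D k).comap (infCycles d D k).subtype

theorem infChains_le (d : M →ₗ[R] M) (D : ℕ → Submodule R M) (k : ℕ) : infChains d D k ≤ D k := by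
  cases k <;> exact inf_le_left

/-- If `D` is already a complex, it is its own infimum complex. -/
theorem infChains_eq (d : M →ₗ[R] M) (D : ℕ → Submodule R M) (h0 : D 0 ≤ LinearMap.ker d)
    (h : ∀ k, ∀ x ∈ D (k + 1), d x ∈ D k) (k : ℕ) : infChains d D k = D k := by
  cases k with
  | zero => exact inf_eq_left.2 h0
  | succ k => exact inf_eq_left.2 (h k)

theorem infBoundaries_le (d : M →ₗ[R] M) (D : ℕ → Submodule R M) (hd : ∀ x, d (d x) = 0) (k : ℕ) :
    infBoundaries d D k ≤ infCycles d D k := by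
  rintro _ ⟨x, hx, rfl⟩
  refine ⟨?_, hd x⟩
  cases k with
  | zero => exact ⟨hx.2, hd x⟩
  | succ k =>
    refine ⟨hx.2, ?_⟩
    change d (d x) ∈ D k
    rw [hd]
    exact zero_mem _

theorem infChains_map {d : M →ₗ[R] M} {D : ℕ → Submodule R M} {d' : M' →ₗ[R] M'}
    {D' : ℕ → Submodule R M'} (f : M →ₗ[R] M') (hd : ∀ x, d' (f x) = f (d x))
    (hD : ∀ k, ∀ x ∈ D k, f x ∈ D' k) (k : ℕ) (x : M) (hx : x ∈ infChains d D k) :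
    f x ∈ infChains d' D' k := by
  cases k with
  | zero => exact ⟨hD _ _ hx.1, by
      change d' (f x) = 0
      rw [hd, LinearMap.mem_ker.1 hx.2, map_zero]⟩
  | succ k =>
    refine ⟨hD _ _ hx.1, ?_⟩
    change d' (f x) ∈ D' k
    rw [hd]
    exact hD _ _ hx.2

theorem infCycles_map {d : M →ₗ[R] M} {D : ℕ → Submodule R M} {d' : M' →ₗ[R] M'}
    {D' : ℕ → Submodule R M'} (f : M →ₗ[R] M') (hd : ∀ x, d' (f x) = f (d x))
    (hD : ∀ k, ∀ x ∈ D k, f x ∈ D' k) (k : ℕ) (x : M) (hx : x ∈ infCycles d D k) :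
    f x ∈ infCycles d' D' k :=
  ⟨infChains_map f hd hD k x hx.1, by
    change d' (f x) = 0
    rw [hd, LinearMap.mem_ker.1 hx.2, map_zero]⟩

/-- The map in homology induced by a chain map. -/
def InfHomology.map {d : M →ₗ[R] M} {D : ℕ → Submodule R M} {d' : M' →ₗ[R] M'}
    {D' : ℕ → Submodule R M'} (f : M →ₗ[R] M') (hd : ∀ x, d' (f x) = f (d x))
    (hD : ∀ k, ∀ x ∈ D k, f x ∈ D' k) (k : ℕ) : InfHomology d D k →ₗ[R] InfHomology d' D' k :=
  Submodule.mapQ _ _ (f.restrict (infCycles_map f hd hD k)) (by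
    rintro ⟨_, hx⟩ ⟨y, hy, rfl⟩
    exact ⟨f y, infChains_map f hd hD _ y hy, hd y⟩)

/-- A product `M × M' → M''` obeying the Leibniz rule on the given submodules. -/
structure IsInfProduct (d : M →ₗ[R] M) (D : ℕ → Submodule R M) (d' : M' →ₗ[R] M')
    (D' : ℕ → Submodule R M') (d'' : M'' →ₗ[R] M'') (D'' : ℕ → Submodule R M'')
    (m : M →ₗ[R] M' →ₗ[R] M'') : Prop where
  mem : ∀ p q, ∀ x ∈ D p, ∀ y ∈ D' q, m x y ∈ D'' (p + q)
  leibniz : ∀ p, ∀ x ∈ D p, ∀ y, d'' (m x y) = m (d x) y + (-1 : R) ^ p • m x (d' y)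

namespace IsInfProduct

variable {d : M →ₗ[R] M} {D : ℕ → Submodule R M} {d' : M' →ₗ[R] M'} {D' : ℕ → Submodule R M'}
  {d'' : M'' →ₗ[R] M''} {D'' : ℕ → Submodule R M''} {m : M →ₗ[R] M' →ₗ[R] M''}

theorem cycles (h : IsInfProduct d D d' D' d'' D'' m) (p q : ℕ) (x : M) (hx : x ∈ infCycles d D p)
    (y : M') (hy : y ∈ infCycles d' D' q) : m x y ∈ infCycles d'' D'' (p + q) := by
  have h0 : d'' (m x y) = 0 := by
    rw [h.leibniz p x (infChains_le d D p hx.1), LinearMap.mem_ker.1 hx.2,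
      LinearMap.mem_ker.1 hy.2]
    simp
  have h1 := h.mem p q x (infChains_le d D p hx.1) y (infChains_le d' D' q hy.1)
  refine ⟨?_, h0⟩
  revert h1
  generalize p + q = n
  intro h1
  cases n with
  | zero => exact ⟨h1, h0⟩
  | succ n =>
    refine ⟨h1, ?_⟩
    change d'' (m x y) ∈ D'' n
    rw [h0]
    exact zero_mem _

theorem left_boundary (h : IsInfProduct d D d' D' d'' D'' m) (p q : ℕ) (x : M)
    (hx : x ∈ infBoundaries d D p) (y : M') (hy : y ∈ infCycles d' D' q) :
    m x y ∈ infBoundaries d'' D'' (p + q) := by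
  obtain ⟨u, hu, rfl⟩ := hx
  have h0 : d'' (m u y) = m (d u) y := by
    rw [h.leibniz _ u hu.1, LinearMap.mem_ker.1 hy.2]
    simp
  have hy' := infChains_le d' D' q hy.1
  refine ⟨m u y, ⟨?_, ?_⟩, h0⟩
  · have := h.mem _ _ u hu.1 y hy'
    rwa [Nat.add_right_comm] at this
  · change d'' (m u y) ∈ D'' (p + q)
    rw [h0]
    exact h.mem _ _ _ hu.2 y hy'

theorem right_boundary (h : IsInfProduct d D d' D' d'' D'' m) (p q : ℕ) (x : M)
    (hx : x ∈ infCycles d D p) (y : M') (hy : y ∈ infBoundaries d' D' q) :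
    m x y ∈ infBoundaries d'' D'' (p + q) := by
  obtain ⟨u, hu, rfl⟩ := hy
  have hx' := infChains_le d D p hx.1
  have h0 : d'' (m x u) = (-1 : R) ^ p • m x (d' u) := by
    rw [h.leibniz _ x hx', LinearMap.mem_ker.1 hx.2]
    simp
  have hs : (-1 : R) ^ p * (-1) ^ p = 1 := by
    rw [← mul_pow]; simp
  refine ⟨(-1 : R) ^ p • m x u, Submodule.smul_mem _ _ ⟨?_, ?_⟩, ?_⟩
  · exact h.mem _ _ x hx' u hu.1
  · change d'' (m x u) ∈ D'' (p + q)
    rw [h0]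
    exact Submodule.smul_mem _ _ (h.mem _ _ x hx' _ hu.2)
  · rw [map_smul, h0, smul_smul, hs, one_smul]

/-- The product restricted to cycles. -/
def onCycles (h : IsInfProduct d D d' D' d'' D'' m) (p q : ℕ) :
    infCycles d D p →ₗ[R] infCycles d' D' q →ₗ[R] infCycles d'' D'' (p + q) :=
  LinearMap.mk₂ R (fun x y => ⟨m x y, h.cycles p q x x.2 y y.2⟩)
    (by intros; ext; simp) (by intros; ext; simp) (by intros; ext; simp) (by intros; ext; simp)

/-- The exterior homology product `[x] ⊗ [y] ↦ [m x y]`. -/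
def cross (h : IsInfProduct d D d' D' d'' D'' m) (p q : ℕ) :
    InfHomology d D p ⊗[R] InfHomology d' D' q →ₗ[R] InfHomology d'' D'' (p + q) :=
  TensorProduct.lift <|
    Submodule.liftQ _
      { toFun := fun x => Submodule.mapQ _ _ (h.onCycles p q x) (fun y hy =>
          h.right_boundary p q x x.2 y hy)
        map_add' := fun x x' => by
          refine Submodule.linearMap_qext _ (LinearMap.ext fun y => ?_)
          simp
          rfl
        map_smul' := fun r x => by
          refine Submodule.linearMap_qext _ (LinearMap.ext fun y => ?_)
          refine congrArg Submodule.Quotient.mk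
            (?_ : h.onCycles p q (r • x) y = r • h.onCycles p q x y)
          rw [map_smul, LinearMap.smul_apply] }
      (fun x hx => by
        refine LinearMap.mem_ker.2 (Submodule.linearMap_qext _ (LinearMap.ext fun y => ?_))
        exact (Submodule.Quotient.mk_eq_zero _).2 (h.left_boundary p q x hx y y.2))

theorem cross_mk (h : IsInfProduct d D d' D' d'' D'' m) (p q : ℕ) (x : infCycles d D p)
    (y : infCycles d' D' q) :
    h.cross p q (Submodule.Quotient.mk x ⊗ₜ Submodule.Quotient.mk y) =
      Submodule.Quotient.mk ⟨m x y, h.cycles p q x x.2 y y.2⟩ := rfl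

end IsInfProduct

end Infimum

/-! ### Chains on sequences -/

section Directed

variable (R : Type u) [CommRing R] {V V' W : Type u}

/-- The boundary `∂(v₁,…,vₖ) = ∑ᵢ (-1)ⁱ⁻¹ (v₁,…,v̂ᵢ,…,vₖ)` on the free module on all finite
sequences. It is augmented: the empty sequence spans degree `-1`, and `∂(v) = ()`. -/
noncomputable def seqBoundary : (List V →₀ R) →ₗ[R] (List V →₀ R) :=
  Finsupp.linearCombination R fun l : List V =>
    ∑ i ∈ Finset.range l.length, Finsupp.single (l.eraseIdx i) ((-1 : R) ^ i)

/-- The map induced on sequences by a map of vertices. -/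
noncomputable def seqMap (f : V → W) : (List V →₀ R) →ₗ[R] (List W →₀ R) :=
  Finsupp.lmapDomain R R (List.map f)

/-- Concatenation `(v₁,…,vₖ) * (v'₁,…,v'ₗ) = (v₁,…,vₖ,v'₁,…,v'ₗ)`. -/
noncomputable def seqJoin : (List V →₀ R) →ₗ[R] (List V' →₀ R) →ₗ[R] (List (V ⊕ₗ V') →₀ R) :=
  Finsupp.lsum R fun l => LinearMap.toSpanSingleton R _
    (Finsupp.lmapDomain R R fun l' : List V' => l.map Sum.inlₗ ++ l'.map Sum.inrₗ)

/-- Prepending a vertex. -/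
noncomputable def seqCons (a : V) : (List V →₀ R) →ₗ[R] (List V →₀ R) :=
  Finsupp.lmapDomain R R (List.cons a)

@[simp] theorem seqMap_single (f : V → W) (l : List V) (r : R) :
    seqMap R f (Finsupp.single l r) = Finsupp.single (l.map f) r := by
  simp [seqMap]

@[simp] theorem seqJoin_single (l : List V) (l' : List V') :
    seqJoin R (Finsupp.single l 1) (Finsupp.single l' 1) =
      Finsupp.single (l.map Sum.inlₗ ++ l'.map Sum.inrₗ) 1 := by
  simp [seqJoin]

@[simp] theorem seqCons_single (a : V) (l : List V) (r : R) :
    seqCons R a (Finsupp.single l r) = Finsupp.single (a :: l) r := by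
  simp [seqCons]

@[simp] theorem seqBoundary_nil : seqBoundary R (Finsupp.single ([] : List V) 1) = 0 := by
  simp [seqBoundary]

theorem seqBoundary_cons (a : V) (x : List V →₀ R) :
    seqBoundary R (seqCons R a x) = x - seqCons R a (seqBoundary R x) := by
  have : seqBoundary R ∘ₗ seqCons R a = LinearMap.id - seqCons R a ∘ₗ seqBoundary R := by
    refine Finsupp.lhom_ext' fun l => LinearMap.ext_ring ?_
    simp [seqBoundary, Finset.sum_range_succ', pow_succ, sub_eq_neg_add, map_sum]
  exact LinearMap.congr_fun this x

theorem seqBoundary_seqBoundary (x : List V →₀ R) : seqBoundary R (seqBoundary R x) = 0 := by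
  have : seqBoundary R ∘ₗ seqBoundary R = (0 : (List V →₀ R) →ₗ[R] _) := by
    refine Finsupp.lhom_ext' fun l => LinearMap.ext_ring ?_
    induction l with
    | nil => simp
    | cons a l ih =>
      have ih' : seqBoundary R (seqBoundary R (Finsupp.single l 1)) = 0 := by simpa using ih
      have := seqBoundary_cons R a (Finsupp.single l 1)
      rw [seqCons_single] at this
      simp [this, seqBoundary_cons, ih']
  exact LinearMap.congr_fun this x

theorem seqBoundary_seqMap (f : V → W) (x : List V →₀ R) :
    seqBoundary R (seqMap R f x) = seqMap R f (seqBoundary R x) := by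
  have : seqBoundary R ∘ₗ seqMap R f = seqMap R f ∘ₗ seqBoundary R := by
    refine Finsupp.lhom_ext' fun l => LinearMap.ext_ring ?_
    simp [seqBoundary, map_sum, List.eraseIdx_map]
  exact LinearMap.congr_fun this x

theorem seqJoin_cons (a : V) (x : List V →₀ R) (y : List V' →₀ R) :
    seqJoin R (seqCons R a x) y = seqCons R (Sum.inlₗ a) (seqJoin R x y) := by
  have : seqJoin R ∘ₗ seqCons R a =
      (LinearMap.compRight R (seqCons R (Sum.inlₗ a))) ∘ₗ (seqJoin R (V := V) (V' := V')) := by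
    refine Finsupp.lhom_ext' fun l => LinearMap.ext_ring ?_
    refine Finsupp.lhom_ext' fun l' => LinearMap.ext_ring ?_
    simp
  exact LinearMap.congr_fun (LinearMap.congr_fun this x) y

theorem seqJoin_nil (y : List V' →₀ R) :
    seqJoin R (Finsupp.single ([] : List V) 1) y = seqMap R Sum.inrₗ y := by
  simp [seqJoin, seqMap]

theorem seqJoin_leibniz (l : List V) (y : List V' →₀ R) :
    seqBoundary R (seqJoin R (Finsupp.single l 1) y) =
      seqJoin R (seqBoundary R (Finsupp.single l 1)) y +
        (-1 : R) ^ l.length • seqJoin R (Finsupp.single l 1) (seqBoundary R y) := by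
  induction l with
  | nil => simp [seqJoin_nil, seqBoundary_seqMap]
  | cons a l ih =>
    rw [← seqCons_single, seqJoin_cons, seqBoundary_cons, seqBoundary_cons, ih, seqJoin_cons]
    simp [seqJoin_cons, pow_succ]
    abel

end Directed

/-! ### Chains on finite sets -/

section Undirected

variable (R : Type u) [CommRing R] {V V' W X : Type u} [LinearOrder V] [LinearOrder V']
  [LinearOrder W] [LinearOrder X]

/-- The boundary `∂{v₁ < ⋯ < vₖ} = ∑ᵢ (-1)ⁱ⁻¹ {v₁,…,v̂ᵢ,…,vₖ}` on the free module on all finite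
subsets; `i - 1` is the number of elements below `vᵢ`. It is augmented: the empty set spans
degree `-1`, and `∂{v} = ∅`. -/
noncomputable def setBoundary : (Finset V →₀ R) →ₗ[R] (Finset V →₀ R) :=
  Finsupp.linearCombination R fun s : Finset V =>
    ∑ v ∈ s, Finsupp.single (s.erase v) ((-1 : R) ^ (s.filter (· < v)).card)

/-- The number of inversions of a sequence. -/
def inversions : List V → ℕ
  | [] => 0
  | a :: l => l.countP (· < a) + inversions l

/-- The projection `π_#`, from sequences of distinct vertices to sets: the sequence
`(v_{s(1)},…,v_{s(k)})` with `v₁ < ⋯ < vₖ` is sent to `sgn(s) {v₁,…,vₖ}`. A sequence with a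
repetition is sent to `0`. -/
noncomputable def seqProj : (List V →₀ R) →ₗ[R] (Finset V →₀ R) :=
  Finsupp.linearCombination R fun l : List V =>
    if l.Nodup then Finsupp.single l.toFinset ((-1 : R) ^ inversions l) else 0

/-- The map induced on finite sets by a map `f` of vertices:
`{v₁ < ⋯ < vₖ} ↦ π_# (f v₁,…,f vₖ)`, i.e. the image with the sign of the permutation which sorts
it, and `0` if `f` is not injective on the set. -/
noncomputable def setMap (f : V → W) : (Finset V →₀ R) →ₗ[R] (Finset W →₀ R) :=
  Finsupp.linearCombination R fun s : Finset V =>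
    seqProj R (Finsupp.single (s.sort.map f) 1)

/-- The join of sets: `s * s' = s ⊔ s'`. -/
noncomputable def setJoin :
    (Finset V →₀ R) →ₗ[R] (Finset V' →₀ R) →ₗ[R] (Finset (V ⊕ₗ V') →₀ R) :=
  Finsupp.lsum R fun s => LinearMap.toSpanSingleton R _
    (Finsupp.lmapDomain R R (FinHypergraph.joinSet s))

/-- Exterior multiplication by a vertex. -/
noncomputable def setInsert (a : V) : (Finset V →₀ R) →ₗ[R] (Finset V →₀ R) :=
  Finsupp.linearCombination R fun s : Finset V =>
    if a ∈ s then 0 else Finsupp.single (insert a s) ((-1 : R) ^ (s.filter (· < a)).card)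

theorem setInsert_of_mem {a : V} {s : Finset V} (h : a ∈ s) :
    setInsert R a (Finsupp.single s 1) = 0 := by
  simp [setInsert, h]

theorem setInsert_of_notMem {a : V} {s : Finset V} (h : a ∉ s) :
    setInsert R a (Finsupp.single s 1) =
      Finsupp.single (insert a s) ((-1 : R) ^ (s.filter (· < a)).card) := by
  simp [setInsert, h]

theorem setInsert_min {a : V} {s : Finset V} (h : ∀ b ∈ s, a < b) :
    setInsert R a (Finsupp.single s 1) = Finsupp.single (insert a s) 1 := by
  have h1 : a ∉ s := fun h' => lt_irrefl _ (h a h')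
  have h2 : s.filter (· < a) = ∅ := by
    rw [Finset.filter_eq_empty_iff]
    exact fun b hb => not_lt_of_gt (h b hb)
  rw [setInsert_of_notMem R h1, h2]
  simp

theorem single_smul_one {A : Type u} (a : A) (r : R) :
    Finsupp.single a r = r • Finsupp.single a (1 : R) := by simp

theorem setInsert_self (a : V) (x : Finset V →₀ R) : setInsert R a (setInsert R a x) = 0 := by
  have : setInsert R a ∘ₗ setInsert R a = (0 : (Finset V →₀ R) →ₗ[R] _) := by
    refine Finsupp.lhom_ext' fun s => LinearMap.ext_ring ?_
    by_cases h : a ∈ s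
    · simp [setInsert_of_mem R h]
    · simp only [LinearMap.comp_apply, Finsupp.lsingle_apply, setInsert_of_notMem R h]
      rw [single_smul_one, map_smul, setInsert_of_mem R (Finset.mem_insert_self a s)]
      simp
  exact LinearMap.congr_fun this x

theorem setInsert_comm_of_lt {a b : V} (hab : a < b) (x : Finset V →₀ R) :
    setInsert R b (setInsert R a x) = -setInsert R a (setInsert R b x) := by
  have : setInsert R b ∘ₗ setInsert R a = -(setInsert R a ∘ₗ setInsert R b) := by
    refine Finsupp.lhom_ext' fun s => LinearMap.ext_ring ?_
    simp only [LinearMap.comp_apply, LinearMap.neg_apply, Finsupp.lsingle_apply]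
    by_cases ha : a ∈ s
    · by_cases hb : b ∈ s
      · simp [setInsert_of_mem R ha, setInsert_of_mem R hb]
      · rw [setInsert_of_mem R ha, setInsert_of_notMem R hb, single_smul_one, map_smul,
          setInsert_of_mem R (Finset.mem_insert_of_mem ha)]
        simp
    · by_cases hb : b ∈ s
      · rw [setInsert_of_mem R hb, setInsert_of_notMem R ha, single_smul_one, map_smul,
          setInsert_of_mem R (Finset.mem_insert_of_mem hb)]
        simp
      · have h1 : b ∉ insert a s := by simp [hb, hab.ne']
        have h2 : a ∉ insert b s := by simp [ha, hab.ne]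
        rw [setInsert_of_notMem R ha, setInsert_of_notMem R hb, single_smul_one, map_smul,
          setInsert_of_notMem R h1, single_smul_one R (insert b s), map_smul,
          setInsert_of_notMem R h2, Finset.filter_insert, if_pos hab, Finset.filter_insert,
          if_neg (not_lt_of_gt hab), Finset.card_insert_of_notMem (by simp [ha]), Finset.insert_comm]
        simp [pow_succ, mul_comm]
  exact LinearMap.congr_fun this x

theorem setInsert_comm (a b : V) (x : Finset V →₀ R) :
    setInsert R b (setInsert R a x) = -setInsert R a (setInsert R b x) := by
  rcases lt_trichotomy a b with h | rfl | h
  · exact setInsert_comm_of_lt R h x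
  · simp [setInsert_self]
  · rw [setInsert_comm_of_lt R h x, neg_neg]

/-- Induction on finite sets by inserting a new least element. -/
theorem finset_induction_min {P : Finset V → Prop} (h0 : P ∅)
    (h : ∀ a s, (∀ b ∈ s, a < b) → P s → P (insert a s)) (s : Finset V) : P s :=
  Finset.induction_on_min s h0 h

theorem setBoundary_empty : setBoundary R (Finsupp.single (∅ : Finset V) 1) = 0 := by
  simp [setBoundary]

theorem setBoundary_single (s : Finset V) : setBoundary R (Finsupp.single s 1) =
    ∑ v ∈ s, Finsupp.single (s.erase v) ((-1 : R) ^ (s.filter (· < v)).card) := by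
  simp [setBoundary]

theorem setBoundary_insert (a : V) (x : Finset V →₀ R) :
    setBoundary R (setInsert R a x) = x - setInsert R a (setBoundary R x) := by
  have : setBoundary R ∘ₗ setInsert R a = LinearMap.id - setInsert R a ∘ₗ setBoundary R := by
    refine Finsupp.lhom_ext' fun s => LinearMap.ext_ring ?_
    simp only [LinearMap.comp_apply, LinearMap.sub_apply, Finsupp.lsingle_apply, LinearMap.id_apply]
    have hsq : ∀ n : ℕ, (-1 : R) ^ n * (-1) ^ n = 1 := fun n => by rw [← mul_pow]; simp
    by_cases ha : a ∈ s
    · rw [setInsert_of_mem R ha, map_zero, setBoundary_single, map_sum,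
        Finset.sum_eq_single_of_mem a ha]
      · rw [single_smul_one R (s.erase a), map_smul,
          setInsert_of_notMem R (Finset.notMem_erase a s),
          Finset.insert_erase ha, Finset.filter_erase, Finset.erase_eq_of_notMem (by simp)]
        simp [hsq]
      · intro b hb hba
        rw [single_smul_one, map_smul, setInsert_of_mem R (by simp [ha, hba.symm])]
        simp
    · rw [setInsert_of_notMem R ha, single_smul_one, map_smul, setBoundary_single,
        setBoundary_single, Finset.sum_insert ha, Finset.erase_insert ha, Finset.filter_insert,
        if_neg (lt_irrefl a), smul_add, map_sum, Finset.smul_sum, sub_eq_add_neg,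
        ← Finset.sum_neg_distrib]
      congr 1
      · simp [hsq]
      · refine Finset.sum_congr rfl fun b hb => ?_
        have hab : a ≠ b := fun h => ha (h ▸ hb)
        have h1 : a ∉ s.erase b := fun h => ha (Finset.mem_of_mem_erase h)
        rw [single_smul_one R (s.erase b), map_smul, setInsert_of_notMem R h1,
          Finset.erase_insert_of_ne hab, Finset.filter_insert, Finset.filter_erase]
        rcases lt_or_gt_of_ne hab with h | h
        · rw [if_pos h, Finset.card_insert_of_notMem (by simp [ha]),
            Finset.erase_eq_of_notMem (s := s.filter (· < a)) (by simp [h.le])]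
          simp only [Finsupp.smul_single, smul_eq_mul, pow_succ]
          rw [← Finsupp.single_neg]
          congr 1
          ring
        · rw [if_neg (not_lt_of_gt h)]
          have h3 : b ∈ s.filter (· < a) := by simp [hb, h]
          rw [← Finset.card_erase_add_one h3]
          simp only [Finsupp.smul_single, smul_eq_mul, pow_succ]
          rw [← Finsupp.single_neg]
          congr 1
          ring
  exact LinearMap.congr_fun this x

theorem setBoundary_setBoundary (x : Finset V →₀ R) : setBoundary R (setBoundary R x) = 0 := by
  have : setBoundary R ∘ₗ setBoundary R = (0 : (Finset V →₀ R) →ₗ[R] _) := by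
    refine Finsupp.lhom_ext' fun s => LinearMap.ext_ring ?_
    induction s using finset_induction_min with
    | h0 => simp [setBoundary_empty]
    | h a s h ih =>
      have ih' : setBoundary R (setBoundary R (Finsupp.single s 1)) = 0 := by simpa using ih
      have := setBoundary_insert R a (Finsupp.single s 1)
      rw [setInsert_min R h] at this
      simp [this, setBoundary_insert, ih']
  exact LinearMap.congr_fun this x

theorem seqProj_nil : seqProj R (Finsupp.single ([] : List V) 1) = Finsupp.single ∅ 1 := by
  simp [seqProj, inversions]

theorem seqProj_single (l : List V) : seqProj R (Finsupp.single l 1) =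
    if l.Nodup then Finsupp.single l.toFinset ((-1 : R) ^ inversions l) else 0 := by
  simp [seqProj]

theorem seqProj_cons (a : V) (x : List V →₀ R) :
    seqProj R (seqCons R a x) = setInsert R a (seqProj R x) := by
  have : seqProj R ∘ₗ seqCons R a = setInsert R a ∘ₗ seqProj R := by
    refine Finsupp.lhom_ext' fun l => LinearMap.ext_ring ?_
    simp only [LinearMap.comp_apply, Finsupp.lsingle_apply, seqCons_single, seqProj_single]
    by_cases hl : l.Nodup
    · rw [if_pos hl, single_smul_one R l.toFinset, map_smul]
      by_cases ha : a ∈ l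
      · rw [setInsert_of_mem R (by simpa using ha), if_neg (by simp [ha])]
        simp
      · rw [setInsert_of_notMem R (by simpa using ha), if_pos (by simp [ha, hl])]
        have : (l.toFinset.filter (· < a)).card = l.countP (· < a) := by
          rw [List.countP_eq_length_filter, ← List.toFinset_card_of_nodup (hl.filter _)]
          congr 1
          ext v
          simp
        simp [inversions, this, pow_add, mul_comm]
    · rw [if_neg hl, if_neg (by simp [hl]), map_zero]
  exact LinearMap.congr_fun this x

/-- `π_#` is a chain map. -/
theorem setBoundary_seqProj (x : List V →₀ R) :
    setBoundary R (seqProj R x) = seqProj R (seqBoundary R x) := by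
  have : setBoundary R ∘ₗ seqProj R = seqProj R ∘ₗ seqBoundary R (V := V) := by
    refine Finsupp.lhom_ext' fun l => LinearMap.ext_ring ?_
    simp only [LinearMap.comp_apply, Finsupp.lsingle_apply]
    induction l with
    | nil => rw [seqProj_nil, setBoundary_empty, seqBoundary_nil, map_zero]
    | cons a l ih =>
      rw [← seqCons_single, seqProj_cons, setBoundary_insert, ih, seqBoundary_cons, map_sub,
        seqProj_cons]
  exact LinearMap.congr_fun this x

theorem setMap_single (f : V → W) (s : Finset V) :
    setMap R f (Finsupp.single s 1) = seqProj R (Finsupp.single (s.sort.map f) 1) := by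
  simp [setMap]

theorem setMap_empty (f : V → W) :
    setMap R f (Finsupp.single ∅ 1) = Finsupp.single ∅ 1 := by
  simp [setMap_single, seqProj_nil]

theorem setMap_insert_min (f : V → W) {a : V} {s : Finset V} (h : ∀ b ∈ s, a < b) :
    setMap R f (Finsupp.single (insert a s) 1) =
      setInsert R (f a) (setMap R f (Finsupp.single s 1)) := by
  have h1 : a ∉ s := fun h' => lt_irrefl _ (h a h')
  rw [setMap_single, setMap_single, Finset.sort_insert _ (fun b hb => (h b hb).le) h1,
    List.map_cons, ← seqCons_single, seqProj_cons]

theorem setMap_insert (f : V → W) (a : V) (x : Finset V →₀ R) :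
    setMap R f (setInsert R a x) = setInsert R (f a) (setMap R f x) := by
  have : ∀ s : Finset V, ∀ a : V, setMap R f (setInsert R a (Finsupp.single s 1)) =
      setInsert R (f a) (setMap R f (Finsupp.single s 1)) := by
    intro s
    induction s using finset_induction_min with
    | h0 =>
      intro a
      rw [setInsert_min R (by simp), setMap_insert_min R f (by simp)]
    | h m s hm ih =>
      intro a
      rcases lt_trichotomy a m with h | rfl | h
      · have h' : ∀ b ∈ insert m s, a < b := by
          intro b hb
          rcases Finset.mem_insert.1 hb with rfl | hb
          · exact h
          · exact h.trans (hm b hb)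
        rw [setInsert_min R h', setMap_insert_min R f h']
      · rw [setInsert_of_mem R (Finset.mem_insert_self a s), setMap_insert_min R f hm,
          setInsert_self, map_zero]
      · rw [setMap_insert_min R f hm, setInsert_comm, ← ih, ← setInsert_min R hm,
          setInsert_comm, map_neg]
        congr 1
        by_cases ha : a ∈ s
        · rw [setInsert_of_mem R ha]
          simp
        · have h' : ∀ b ∈ insert a s, m < b := by
            intro b hb
            rcases Finset.mem_insert.1 hb with rfl | hb
            · exact h
            · exact hm b hb
          rw [setInsert_of_notMem R ha, single_smul_one, map_smul, map_smul, map_smul, map_smul,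
            setInsert_min R h', setMap_insert_min R f h']
  have : setMap R f ∘ₗ setInsert R a = setInsert R (f a) ∘ₗ setMap R f :=
    Finsupp.lhom_ext' fun s => LinearMap.ext_ring (by simpa using this s a)
  exact LinearMap.congr_fun this x

theorem setBoundary_setMap (f : V → W) (x : Finset V →₀ R) :
    setBoundary R (setMap R f x) = setMap R f (setBoundary R x) := by
  have : setBoundary R ∘ₗ setMap R f = setMap R f ∘ₗ setBoundary R := by
    refine Finsupp.lhom_ext' fun s => LinearMap.ext_ring ?_
    simp only [LinearMap.comp_apply, Finsupp.lsingle_apply]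
    induction s using finset_induction_min with
    | h0 => simp [setMap_empty, setBoundary_empty]
    | h a s h ih =>
      rw [← setInsert_min R h, setMap_insert, setBoundary_insert, setBoundary_insert, map_sub,
        setMap_insert, ih]
  exact LinearMap.congr_fun this x

theorem setJoin_single (s : Finset V) (s' : Finset V') :
    setJoin R (Finsupp.single s 1) (Finsupp.single s' 1) =
      Finsupp.single (FinHypergraph.joinSet s s') 1 := by
  simp [setJoin]

theorem setJoin_insert_left (a : V) (x : Finset V →₀ R) (y : Finset V' →₀ R) :
    setJoin R (setInsert R a x) y = setInsert R (Sum.inlₗ a) (setJoin R x y) := by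
  have : setJoin R ∘ₗ setInsert R a =
      (LinearMap.compRight R (setInsert R (Sum.inlₗ a))) ∘ₗ (setJoin R (V := V) (V' := V')) := by
    refine Finsupp.lhom_ext' fun s => LinearMap.ext_ring ?_
    refine Finsupp.lhom_ext' fun s' => LinearMap.ext_ring ?_
    simp only [LinearMap.comp_apply, Finsupp.lsingle_apply, LinearMap.compRight_apply,
      setJoin_single]
    by_cases ha : a ∈ s
    · rw [setInsert_of_mem R ha, setInsert_of_mem R (by simpa using ha)]
      simp
    · rw [setInsert_of_notMem R ha, setInsert_of_notMem R (by simpa using ha), single_smul_one,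
        map_smul, LinearMap.smul_apply, setJoin_single, single_smul_one R (insert _ _)]
      have h1 : (FinHypergraph.joinSet s s').filter (· < Sum.inlₗ a) =
          FinHypergraph.joinSet (s.filter (· < a)) ∅ := by
        ext v
        rcases v with v | v
        · change (Sum.inlₗ v : V ⊕ₗ V') ∈ _ ↔ (Sum.inlₗ v : V ⊕ₗ V') ∈ _
          simp
        · change (Sum.inrₗ v : V ⊕ₗ V') ∈ _ ↔ (Sum.inrₗ v : V ⊕ₗ V') ∈ _
          simp
      rw [h1, FinHypergraph.card_joinSet, Finset.card_empty, add_zero]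
      refine congrArg (_ • ·) (congrArg (Finsupp.single · 1) ?_)
      ext v
      rcases v with v | v
      · change (Sum.inlₗ v : V ⊕ₗ V') ∈ _ ↔ (Sum.inlₗ v : V ⊕ₗ V') ∈ _
        simp
      · change (Sum.inrₗ v : V ⊕ₗ V') ∈ _ ↔ (Sum.inrₗ v : V ⊕ₗ V') ∈ _
        simp
  exact LinearMap.congr_fun (LinearMap.congr_fun this x) y

theorem setJoin_insert_right (b : V') (y : Finset V' →₀ R) :
    setJoin R (Finsupp.single (∅ : Finset V) 1) (setInsert R b y) =
      setInsert R (Sum.inrₗ b) (setJoin R (Finsupp.single (∅ : Finset V) 1) y) := by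
  have : setJoin R (Finsupp.single (∅ : Finset V) 1) ∘ₗ setInsert R b =
      setInsert R (Sum.inrₗ b) ∘ₗ setJoin R (Finsupp.single (∅ : Finset V) (1 : R)) := by
    refine Finsupp.lhom_ext' fun s => LinearMap.ext_ring ?_
    simp only [LinearMap.comp_apply, Finsupp.lsingle_apply, setJoin_single]
    by_cases hb : b ∈ s
    · rw [setInsert_of_mem R hb, setInsert_of_mem R (by simpa using hb)]
      simp
    · rw [setInsert_of_notMem R hb, setInsert_of_notMem R (by simpa using hb),
        single_smul_one R (insert b s), map_smul, setJoin_single, single_smul_one R (insert _ _)]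
      have h1 : (FinHypergraph.joinSet (∅ : Finset V) s).filter (· < Sum.inrₗ b) =
          FinHypergraph.joinSet ∅ (s.filter (· < b)) := by
        ext v
        rcases v with v | v
        · change (Sum.inlₗ v : V ⊕ₗ V') ∈ _ ↔ (Sum.inlₗ v : V ⊕ₗ V') ∈ _
          simp
        · change (Sum.inrₗ v : V ⊕ₗ V') ∈ _ ↔ (Sum.inrₗ v : V ⊕ₗ V') ∈ _
          simp
      rw [h1, FinHypergraph.card_joinSet, Finset.card_empty, zero_add]
      refine congrArg (_ • ·) (congrArg (Finsupp.single · 1) ?_)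
      ext v
      rcases v with v | v
      · change (Sum.inlₗ v : V ⊕ₗ V') ∈ _ ↔ (Sum.inlₗ v : V ⊕ₗ V') ∈ _
        simp
      · change (Sum.inrₗ v : V ⊕ₗ V') ∈ _ ↔ (Sum.inrₗ v : V ⊕ₗ V') ∈ _
        simp
  exact LinearMap.congr_fun this y

theorem setJoin_leibniz (s : Finset V) (y : Finset V' →₀ R) :
    setBoundary R (setJoin R (Finsupp.single s 1) y) =
      setJoin R (setBoundary R (Finsupp.single s 1)) y +
        (-1 : R) ^ s.card • setJoin R (Finsupp.single s 1) (setBoundary R y) := by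
  induction s using finset_induction_min with
  | h0 =>
    rw [setBoundary_empty]
    simp only [map_zero, LinearMap.zero_apply, Finset.card_empty, pow_zero, one_smul, zero_add]
    have : setBoundary R ∘ₗ setJoin R (Finsupp.single (∅ : Finset V) 1) =
        setJoin R (Finsupp.single (∅ : Finset V) (1 : R)) ∘ₗ setBoundary R (V := V') := by
      refine Finsupp.lhom_ext' fun s => LinearMap.ext_ring ?_
      simp only [LinearMap.comp_apply, Finsupp.lsingle_apply]
      induction s using finset_induction_min with
      | h0 =>
        have : FinHypergraph.joinSet (∅ : Finset V) (∅ : Finset V') = ∅ := by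
          simp [FinHypergraph.joinSet]
        rw [setJoin_single, this, setBoundary_empty, setBoundary_empty, map_zero]
      | h b s h ih =>
        rw [← setInsert_min R h, setJoin_insert_right, setBoundary_insert, ih, setBoundary_insert,
          map_sub, setJoin_insert_right]
    exact LinearMap.congr_fun this y
  | h a s h ih =>
    have ha : a ∉ s := fun h' => lt_irrefl _ (h a h')
    rw [Finset.card_insert_of_notMem ha, ← setInsert_min R h, setJoin_insert_left,
      setBoundary_insert, setBoundary_insert, ih]
    simp [setJoin_insert_left, pow_succ]
    abel

end Undirected

/-! ### Embedded homology of hyperdigraphs and hypergraphs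

All chain modules are graded by the number `k` of vertices, so that index `k` is homological degree
`k - 1`. They are augmented: the empty sequence (the empty set) spans index `0`. -/

theorem supported_map_mem {R : Type u} [CommRing R] {A : Type u} {M : Type u}
    [AddCommGroup M] [Module R M] (f : (A →₀ R) →ₗ[R] M) (s : Set A) (N : Submodule R M)
    (h : ∀ a ∈ s, f (Finsupp.single a 1) ∈ N) (x : A →₀ R) (hx : x ∈ Finsupp.supported R R s) :
    f x ∈ N := by
  rw [Finsupp.supported_eq_span_single] at hx
  have : Submodule.span R ((fun i => Finsupp.single i (1 : R)) '' s) ≤ N.comap f := by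
    rw [Submodule.span_le]
    rintro _ ⟨a, ha, rfl⟩
    exact h a ha
  exact this hx

namespace Hyperdigraph

variable (R : Type u) [CommRing R] {V V' W W' : Type u}

/-- The free module on the directed hyperedges of `H` with `k` vertices, augmented by the empty
sequence. -/
noncomputable def chains (H : Hyperdigraph V) (k : ℕ) : Submodule R (List V →₀ R) :=
  Finsupp.supported R R {l | l.length = k ∧ (l = [] ∨ l ∈ H.edges)}

/-- The reduced embedded homology of `H`, in degree `k - 1`: the homology of the augmented infimum
complex. For a directed simplicial complex it is the reduced simplicial homology, by
`infChains_eq_chains`. -/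
noncomputable abbrev homology (H : Hyperdigraph V) (k : ℕ) : ModuleCat.{u} R :=
  ModuleCat.of R (InfHomology (seqBoundary R) (H.chains R) k)

/-- For a directed simplicial complex the infimum complex is the whole chain complex. -/
theorem infChains_eq_chains {K : Hyperdigraph V} (hK : K.IsComplex) (k : ℕ) :
    infChains (seqBoundary R) (K.chains R) k = K.chains R k := by
  refine infChains_eq _ _ (fun x hx => ?_) (fun k => ?_) k
  · refine (Submodule.mem_bot R).1 (supported_map_mem _ _ ⊥ (fun l hl => ?_) x hx)
    rw [List.length_eq_zero_iff.1 hl.1]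
    exact seqBoundary_nil R
  · refine supported_map_mem _ _ _ (fun l hl => ?_)
    have hl' : l ∈ K.edges := by
      rcases hl.2 with rfl | h
      · simp at hl
      · exact h
    simp only [seqBoundary, Finsupp.linearCombination_single, one_smul]
    refine Submodule.sum_mem _ fun i hi => Finsupp.single_mem_supported R _ ⟨?_, ?_⟩
    · rw [List.length_eraseIdx_of_lt (Finset.mem_range.1 hi), hl.1]
      rfl
    · by_cases h : l.eraseIdx i = []
      · exact Or.inl h
      · exact Or.inr (hK l hl' _ h (List.eraseIdx_sublist l i))

theorem seqMap_mem {H : Hyperdigraph V} {G : Hyperdigraph W} (f : Hom H G) (k : ℕ) :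
    ∀ x ∈ H.chains R k, seqMap R f.toFun x ∈ G.chains R k := by
  refine supported_map_mem _ _ _ (fun l hl => ?_)
  rw [seqMap_single]
  refine Finsupp.single_mem_supported R _ ⟨by simpa using hl.1, ?_⟩
  rcases hl.2 with rfl | h
  · exact Or.inl rfl
  · exact Or.inr (f.map_mem l h)

/-- The map induced by a morphism in reduced embedded homology. -/
noncomputable def Hom.homologyMap {H : Hyperdigraph V} {G : Hyperdigraph W} (f : Hom H G) (k : ℕ) :
    H.homology R k ⟶ G.homology R k :=
  ModuleCat.ofHom (InfHomology.map (seqMap R f.toFun) (seqBoundary_seqMap R f.toFun)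
    (seqMap_mem R f) k)

theorem isInfProduct_join (H : Hyperdigraph V) (H' : Hyperdigraph V') :
    IsInfProduct (seqBoundary R) (H.chains R) (seqBoundary R) (H'.chains R) (seqBoundary R)
      ((H.join H').chains R) (seqJoin R) where
  mem p q x hx y hy := by
    refine supported_map_mem ((seqJoin R).flip y) _ _ (fun l hl => ?_) x hx
    refine supported_map_mem (seqJoin R (Finsupp.single l 1)) _ _ (fun l' hl' => ?_) y hy
    rw [seqJoin_single]
    refine Finsupp.single_mem_supported R _ ⟨by simp [hl.1, hl'.1], ?_⟩
    rcases hl.2 with rfl | h <;> rcases hl'.2 with rfl | h'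
    · exact Or.inl rfl
    · exact Or.inr (Or.inr (Or.inl ⟨l', h', rfl⟩))
    · exact Or.inr (Or.inl ⟨l, h, by simp⟩)
    · exact Or.inr (Or.inr (Or.inr ⟨l, h, l', h', rfl⟩))
  leibniz p x hx y := by
    let F : (List V →₀ R) →ₗ[R] (List (V ⊕ₗ V') →₀ R) :=
      seqBoundary R ∘ₗ (seqJoin R).flip y - (seqJoin R).flip y ∘ₗ seqBoundary R -
        (-1 : R) ^ p • (seqJoin R).flip (seqBoundary R y)
    have : F x ∈ (⊥ : Submodule R (List (V ⊕ₗ V') →₀ R)) := by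
      refine supported_map_mem F _ _ (fun l hl => ?_) x hx
      have := seqJoin_leibniz R l y
      rw [hl.1] at this
      simp [F, this]
    have h2 : F x = 0 := this
    rw [← sub_eq_zero, ← h2]
    simp [F, sub_sub]

end Hyperdigraph

namespace FinHypergraph

variable (R : Type u) [CommRing R] {V V' W W' : Type u} [LinearOrder V] [LinearOrder V']
  [LinearOrder W] [LinearOrder W']

/-- The free module on the hyperedges of `H` with `k` vertices, augmented by the empty set. -/
noncomputable def chains {V : Type u} (H : FinHypergraph V) (k : ℕ) : Submodule R (Finset V →₀ R) :=
  Finsupp.supported R R {s | s.card = k ∧ (s = ∅ ∨ s ∈ H.edges)}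

/-- The reduced embedded homology of `H`, in degree `k - 1`: the homology of the augmented infimum
complex. For a simplicial complex it is the reduced simplicial homology, by
`infChains_eq_chains`. -/
noncomputable abbrev homology (H : FinHypergraph V) (k : ℕ) : ModuleCat.{u} R :=
  ModuleCat.of R (InfHomology (setBoundary R) (H.chains R) k)

/-- For a simplicial complex the infimum complex is the whole chain complex. -/
theorem infChains_eq_chains {K : FinHypergraph V} (hK : K.IsComplex) (k : ℕ) :
    infChains (setBoundary R) (K.chains R) k = K.chains R k := by
  refine infChains_eq _ _ (fun x hx => ?_) (fun k => ?_) k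
  · refine (Submodule.mem_bot R).1 (supported_map_mem _ _ ⊥ (fun s hs => ?_) x hx)
    rw [Finset.card_eq_zero.1 hs.1]
    exact setBoundary_empty R
  · refine supported_map_mem _ _ _ (fun s hs => ?_)
    have hs' : s ∈ K.edges := by
      rcases hs.2 with rfl | h
      · simp at hs
      · exact h
    rw [setBoundary_single]
    refine Submodule.sum_mem _ fun v hv => Finsupp.single_mem_supported R _ ⟨?_, ?_⟩
    · rw [Finset.card_erase_of_mem hv, hs.1]
      rfl
    · rcases (s.erase v).eq_empty_or_nonempty with h | h
      · exact Or.inl h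
      · exact Or.inr (hK s hs' _ h (Finset.erase_subset v s))

theorem setMap_mem {H : FinHypergraph V} {G : FinHypergraph W} (f : Hom H G) (k : ℕ) :
    ∀ x ∈ H.chains R k, setMap R f.toFun x ∈ G.chains R k := by
  refine supported_map_mem _ _ _ (fun s hs => ?_)
  rw [setMap_single, seqProj_single]
  split_ifs with hn
  · refine Finsupp.single_mem_supported R _ ⟨?_, ?_⟩
    · rw [List.toFinset_card_of_nodup hn]
      simpa using hs.1
    · rcases hs.2 with rfl | h
      · exact Or.inl (by simp)
      · obtain ⟨t, ht, h'⟩ := f.map_mem s h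
        refine Or.inr ?_
        have : (s.sort.map f.toFun).toFinset = t := by
          apply Finset.coe_injective
          rw [h']
          ext w
          simp
        rwa [this]
  · exact zero_mem _

/-- The map induced by a morphism in reduced embedded homology. -/
noncomputable def Hom.homologyMap {H : FinHypergraph V} {G : FinHypergraph W} (f : Hom H G)
    (k : ℕ) : H.homology R k ⟶ G.homology R k :=
  ModuleCat.ofHom (InfHomology.map (setMap R f.toFun) (setBoundary_setMap R f.toFun)
    (setMap_mem R f) k)

theorem isInfProduct_join (H : FinHypergraph V) (H' : FinHypergraph V') :
    IsInfProduct (setBoundary R) (H.chains R) (setBoundary R) (H'.chains R) (setBoundary R)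
      ((H.join H').chains R) (setJoin R) where
  mem p q x hx y hy := by
    refine supported_map_mem ((setJoin R).flip y) _ _ (fun s hs => ?_) x hx
    refine supported_map_mem (setJoin R (Finsupp.single s 1)) _ _ (fun s' hs' => ?_) y hy
    rw [setJoin_single]
    refine Finsupp.single_mem_supported R _ ⟨by simp [hs.1, hs'.1], ?_⟩
    rcases hs.2 with rfl | h <;> rcases hs'.2 with rfl | h'
    · exact Or.inl (by simp [joinSet])
    · exact Or.inr (Or.inr (Or.inl ⟨s', h', rfl⟩))
    · exact Or.inr (Or.inl ⟨s, h, rfl⟩)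
    · exact Or.inr (Or.inr (Or.inr ⟨s, h, s', h', rfl⟩))
  leibniz p x hx y := by
    let F : (Finset V →₀ R) →ₗ[R] (Finset (V ⊕ₗ V') →₀ R) :=
      setBoundary R ∘ₗ (setJoin R).flip y - (setJoin R).flip y ∘ₗ setBoundary R -
        (-1 : R) ^ p • (setJoin R).flip (setBoundary R y)
    have : F x ∈ (⊥ : Submodule R (Finset (V ⊕ₗ V') →₀ R)) := by
      refine supported_map_mem F _ _ (fun s hs => ?_) x hx
      have := setJoin_leibniz R s y
      rw [hs.1] at this
      simp [F, this]
    have h2 : F x = 0 := this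
    rw [← sub_eq_zero, ← h2]
    simp [F, sub_sub]

end FinHypergraph

section Projection

variable (R : Type u) [CommRing R] {V : Type u} [LinearOrder V]

theorem seqProj_mem {H : Hyperdigraph V} {G : FinHypergraph V}
    (h : H.underlying.edges ⊆ G.edges) (k : ℕ) :
    ∀ x ∈ H.chains R k, seqProj R x ∈ G.chains R k := by
  refine supported_map_mem _ _ _ (fun l hl => ?_)
  rw [seqProj_single]
  split_ifs with hn
  · refine Finsupp.single_mem_supported R _ ⟨?_, ?_⟩
    · rw [List.toFinset_card_of_nodup hn, hl.1]
    · rcases hl.2 with rfl | h'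
      · exact Or.inl (by simp)
      · exact Or.inr (h ⟨l, h', by simp⟩)
  · exact zero_mem _

/-- The map `π_*` from the reduced embedded homology of a hyperdigraph `H` to that of a hypergraph
which contains the underlying hypergraph of `H`. -/
noncomputable def homologyProj {H : Hyperdigraph V} {G : FinHypergraph V}
    (h : H.underlying.edges ⊆ G.edges) (k : ℕ) : H.homology R k ⟶ G.homology R k :=
  ModuleCat.ofHom (InfHomology.map (seqProj R) (setBoundary_seqProj R) (seqProj_mem R h) k)

end Projection

/-! ### Künneth sequences -/

section Kunneth

variable {R : Type u} [CommRing R]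

/-- `⨁_{p+q=n} A p ⊗ B q`. -/
noncomputable abbrev tensorSum (A B : ℕ → ModuleCat.{u} R) (n : ℕ) : ModuleCat.{u} R :=
  ModuleCat.of R (⨁ pq : {pq : ℕ × ℕ // pq.1 + pq.2 = n}, A pq.1.1 ⊗[R] B pq.1.2)

/-- `⨁_{p+q+1=n} Tor₁(A p, B q)`. -/
noncomputable abbrev torSum (A B : ℕ → ModuleCat.{u} R) (n : ℕ) : ModuleCat.{u} R :=
  ModuleCat.of R (⨁ pq : {pq : ℕ × ℕ // pq.1 + pq.2 + 1 = n},
    ((Tor (ModuleCat.{u} R) 1).obj (A pq.1.1)).obj (B pq.1.2))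

noncomputable def tensorSumMap {A B A' B' : ℕ → ModuleCat.{u} R} (f : ∀ k, A k ⟶ A' k)
    (g : ∀ k, B k ⟶ B' k) (n : ℕ) : tensorSum A B n ⟶ tensorSum A' B' n :=
  ModuleCat.ofHom (DirectSum.lmap fun pq => TensorProduct.map (f pq.1.1).hom (g pq.1.2).hom)

noncomputable def torSumMap {A B A' B' : ℕ → ModuleCat.{u} R} (f : ∀ k, A k ⟶ A' k)
    (g : ∀ k, B k ⟶ B' k) (n : ℕ) : torSum A B n ⟶ torSum A' B' n :=
  ModuleCat.ofHom (DirectSum.lmap fun pq =>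
    (((Tor (ModuleCat.{u} R) 1).map (f pq.1.1)).app (B pq.1.2) ≫
      ((Tor (ModuleCat.{u} R) 1).obj (A' pq.1.1)).map (g pq.1.2)).hom)

/-- Assembles products `A p ⊗ B q → J (p + q)` to a map on `⨁_{p+q=n} A p ⊗ B q`. -/
noncomputable def tensorSumLift {A B J : ℕ → ModuleCat.{u} R}
    (c : ∀ p q, A p ⊗[R] B q →ₗ[R] J (p + q)) (n : ℕ) : tensorSum A B n ⟶ J n :=
  ModuleCat.ofHom (DirectSum.toModule R _ _ fun pq =>
    (eqToHom (congrArg J pq.2)).hom ∘ₗ c pq.1.1 pq.1.2)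

/-- A sequence of two maps `0 → X₁ → X₂ → X₃ → 0`. -/
structure Row (R : Type u) [CommRing R] where
  {X₁ X₂ X₃ : ModuleCat.{u} R}
  f : X₁ ⟶ X₂
  g : X₂ ⟶ X₃

/-- The row is a short exact sequence. -/
def Row.IsShortExact (r : Row R) : Prop :=
  ∃ w : r.f ≫ r.g = 0, (ShortComplex.mk r.f r.g w).ShortExact

/-- Three maps between the terms of two rows. -/
@[ext]
structure RowMaps (r s : Row R) where
  τ₁ : r.X₁ ⟶ s.X₁
  τ₂ : r.X₂ ⟶ s.X₂
  τ₃ : r.X₃ ⟶ s.X₃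

/-- The three maps form a morphism of sequences. -/
def RowMaps.IsMorphism {r s : Row R} (t : RowMaps r s) : Prop :=
  r.f ≫ t.τ₂ = t.τ₁ ≫ s.f ∧ r.g ≫ t.τ₃ = t.τ₂ ≫ s.g

def RowMaps.id (r : Row R) : RowMaps r r := ⟨𝟙 _, 𝟙 _, 𝟙 _⟩

def RowMaps.comp {r s t : Row R} (a : RowMaps r s) (b : RowMaps s t) : RowMaps r t :=
  ⟨a.τ₁ ≫ b.τ₁, a.τ₂ ≫ b.τ₂, a.τ₃ ≫ b.τ₃⟩

end Kunneth

section KU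

variable (R : Type u) [CommRing R]

/-- A choice, for any two hyperdigraphs, of maps from the homology of the join to the `Tor` terms. -/
abbrev DirectedTorMaps : Type (u + 1) :=
  ∀ (V V' : Type u) (H : Hyperdigraph V) (H' : Hyperdigraph V') (n : ℕ),
    (H.join H').homology R n ⟶ torSum (H.homology R) (H'.homology R) n

/-- A choice, for any two hypergraphs on totally ordered vertex sets, of maps from the homology of
the join to the `Tor` terms. -/
abbrev UndirectedTorMaps : Type (u + 1) :=
  ∀ (V V' : Type u) [LinearOrder V] [LinearOrder V'] (H : FinHypergraph V) (H' : FinHypergraph V')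
    (n : ℕ), (H.join H').homology R n ⟶ torSum (H.homology R) (H'.homology R) n

variable {R} {V V' W W' : Type u}

/-- The sequence `⨁ H_p(H) ⊗ H_q(H') → H_n(H * H') → ⨁ Tor(H_p(H), H_q(H'))`. Its first map is
induced by the join of chains. -/
noncomputable def Hyperdigraph.KU (τ : DirectedTorMaps R) (H : Hyperdigraph V)
    (H' : Hyperdigraph V') (n : ℕ) : Row R where
  X₁ := tensorSum (H.homology R) (H'.homology R) n
  X₂ := (H.join H').homology R n
  X₃ := torSum (H.homology R) (H'.homology R) n
  f := tensorSumLift (fun p q => (Hyperdigraph.isInfProduct_join R H H').cross p q) n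
  g := τ V V' H H' n

/-- The sequence `⨁ H_p(H) ⊗ H_q(H') → H_n(H * H') → ⨁ Tor(H_p(H), H_q(H'))`. Its first map is
induced by the join of chains. -/
noncomputable def FinHypergraph.KU [LinearOrder V] [LinearOrder V'] (τ : UndirectedTorMaps R)
    (H : FinHypergraph V) (H' : FinHypergraph V') (n : ℕ) : Row R where
  X₁ := tensorSum (H.homology R) (H'.homology R) n
  X₂ := (H.join H').homology R n
  X₃ := torSum (H.homology R) (H'.homology R) n
  f := tensorSumLift (fun p q => (FinHypergraph.isInfProduct_join R H H').cross p q) n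
  g := τ V V' H H' n

/-- The maps between sequences which are induced by morphisms of hyperdigraphs. -/
noncomputable def Hyperdigraph.KUMap (τ : DirectedTorMaps R) {H : Hyperdigraph V}
    {H' : Hyperdigraph V'} {G : Hyperdigraph W} {G' : Hyperdigraph W'} (φ : H.Hom G)
    (φ' : H'.Hom G') (n : ℕ) : RowMaps (H.KU τ H' n) (G.KU τ G' n) where
  τ₁ := tensorSumMap (φ.homologyMap R) (φ'.homologyMap R) n
  τ₂ := (φ.join φ').homologyMap R n
  τ₃ := torSumMap (φ.homologyMap R) (φ'.homologyMap R) n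

/-- The maps between sequences which are induced by morphisms of hypergraphs. -/
noncomputable def FinHypergraph.KUMap [LinearOrder V] [LinearOrder V'] [LinearOrder W]
    [LinearOrder W'] (τ : UndirectedTorMaps R) {H : FinHypergraph V} {H' : FinHypergraph V'}
    {G : FinHypergraph W} {G' : FinHypergraph W'} (φ : H.Hom G) (φ' : H'.Hom G') (n : ℕ) :
    RowMaps (H.KU τ H' n) (G.KU τ G' n) where
  τ₁ := tensorSumMap (φ.homologyMap R) (φ'.homologyMap R) n
  τ₂ := (φ.join φ').homologyMap R n
  τ₃ := torSumMap (φ.homologyMap R) (φ'.homologyMap R) n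

/-- The maps `π_*` between sequences, for hypergraphs `G`, `G'` which contain the underlying
hypergraphs of `H`, `H'`. -/
noncomputable def Hyperdigraph.KUProj [LinearOrder V] [LinearOrder V'] (τ : DirectedTorMaps R)
    (τ' : UndirectedTorMaps R) {H : Hyperdigraph V} {H' : Hyperdigraph V'} {G : FinHypergraph V}
    {G' : FinHypergraph V'} (h : H.underlying.edges ⊆ G.edges)
    (h' : H'.underlying.edges ⊆ G'.edges) (n : ℕ) : RowMaps (H.KU τ H' n) (G.KU τ' G' n) where
  τ₁ := tensorSumMap (homologyProj R h) (homologyProj R h') n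
  τ₂ := homologyProj R ((H.underlying_join H').trans (FinHypergraph.join_mono h h')) n
  τ₃ := torSumMap (homologyProj R h) (homologyProj R h') n

/-- The horizontal arrows: the maps induced by the inclusions `δH ⊆ H ⊆ ΔH`, `δH' ⊆ H' ⊆ ΔH'`. -/
noncomputable def Hyperdigraph.KUIncl (τ : DirectedTorMaps R) (H : Hyperdigraph V)
    (H' : Hyperdigraph V') {i j : Fin 3} (hij : i ≤ j) (n : ℕ) :
    RowMaps ((H.level i).KU τ (H'.level i) n) ((H.level j).KU τ (H'.level j) n) :=
  KUMap τ (Hom.incl (H.level_mono hij)) (Hom.incl (H'.level_mono hij)) n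

/-- The horizontal arrows: the maps induced by the inclusions `δH ⊆ H ⊆ ΔH`, `δH' ⊆ H' ⊆ ΔH'`. -/
noncomputable def FinHypergraph.KUIncl [LinearOrder V] [LinearOrder V'] (τ : UndirectedTorMaps R)
    (H : FinHypergraph V) (H' : FinHypergraph V') {i j : Fin 3} (hij : i ≤ j) (n : ℕ) :
    RowMaps ((H.level i).KU τ (H'.level i) n) ((H.level j).KU τ (H'.level j) n) :=
  KUMap τ (Hom.incl (H.level_mono hij)) (Hom.incl (H'.level_mono hij)) n

/-- The vertical arrows `π_*`: from `δH`, `H`, `ΔH` to `δ`, `id`, `Δ` of the underlying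
hypergraph. -/
noncomputable def Hyperdigraph.KUProjLevel [LinearOrder V] [LinearOrder V']
    (τ : DirectedTorMaps R) (τ' : UndirectedTorMaps R) (H : Hyperdigraph V) (H' : Hyperdigraph V')
    (i : Fin 3) (n : ℕ) :
    RowMaps ((H.level i).KU τ (H'.level i) n)
      ((H.underlying.level i).KU τ' (H'.underlying.level i) n) :=
  KUProj τ τ' (H.underlying_level i) (H'.underlying_level i) n

end KU

/-! Chains are indexed by the number of vertices, with the empty edge in index 0. Every basis
element of the join is then the join of a unique pair of basis elements of the factors, the empty
edge accounting for hyperedges that come from one factor alone. Indices add and the boundary obeys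
the Leibniz rule, so the graded module `D''` of the join is the tensor product of the modules `D`,
`D'` of the factors, without shift. With `n = m + 1`, the condition `p + q = m - 1` on homological
degrees becomes `p + q = n` on indices, and the Tor terms have `p + q + 1 = n`.

Embedded homology is computed by the infimum complex, and the point specific to hypergraphs is that
the infimum complex of the tensor product is the tensor product of the infimum complexes
(`IsInfTensor.comp_mem_infChains`, `IsInfTensor.lift_mem_infChains`). Let `x` belong to the former,
with components `x_{p,q}`. The sum `(∂⊗1)x_{p+1,q} ± (1⊗∂')x_{p,q+1}` is the `(p,q)`-component of
`∂x`, so it lies in `D_p ⊗ D'_q`; hence `(∂⊗1)x_{p+1,q}` lies in `D_p ⊗ M'`. The quotient `M/D_p` is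
free on the remaining basis elements, and flatness gives `x_{p+1,q} ∈ (D_{p+1} ∩ ∂⁻¹D_p) ⊗ D'_q`.
The second factor is treated in the same way.

What remains is the algebraic Künneth theorem for free complexes, in a form without choices. Let
`C`, `Z`, `B`, `H` be the chains, cycles, boundaries and homology of the infimum complex, with a
prime for the second factor. Over a principal ideal domain all submodules involved are free
(`Finsupp.free_submodule`), so `0 → B'_q → Z'_q` resolves `H'_q`, and `Tor₁(H_p, H'_q)` is the
kernel of `H_p ⊗ B'_q → H_p ⊗ Z'_q` (`torι_injective`, `range_torι`). For a cycle `x` of the join,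
`(1⊗∂')x_{p,q+1} = ∓(∂⊗1)x_{p+1,q}` lies both in `Z_p ⊗ B'_q` and in `B_p ⊗ Z'_q`, so its class in
`H_p ⊗ B'_q` lies in this kernel. That class is the map to Tor. Kernel, image and surjectivity are
found by lifting tensors of boundaries to tensors of chains.

Since no splitting is chosen, every chain map compatible with joins commutes with the map to Tor
(`torPart_map`). This applies alike to vertex maps, inclusions and `π`, so the commutativity of the
diagrams reduces to identities between chain maps. For sets these follow by peeling off one vertex
at a time: `π` turns prepending a vertex into exterior multiplication, which takes care of all
signs. -/

set_option linter.unusedSectionVars false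

/-! ### Submodules of free modules over a principal ideal domain -/

/-- Vectors with pairwise different leading terms are linearly independent. -/
theorem Finsupp.linearIndependent_of_leading {R A : Type*} [CommRing R] [IsDomain R]
    [LinearOrder A] (b : A → A →₀ R) (hb : ∀ a c, a < c → b a c = 0) :
    LinearIndependent R fun a : {a : A // b a a ≠ 0} => b a := by
  classical
  rw [linearIndependent_iff']
  intro s l hl i hi
  by_contra hne
  -- At the largest index `m` with nonzero coefficient, every other vector of the combination
  -- vanishes in coordinate `m`, so `l m * b m m = 0`.
  obtain ⟨m, hm, hmax⟩ := (s.filter fun a => l a ≠ 0).exists_max_image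
    (fun a : {a : A // b a a ≠ 0} => (a : A)) ⟨i, by simp [hi, hne]⟩
  rw [Finset.mem_filter] at hm
  have h0 : (∑ a ∈ s, l a • b a) (m : A) = 0 := by rw [hl]; rfl
  rw [Finsupp.finsetSum_apply, Finset.sum_eq_single_of_mem m hm.1] at h0
  · rcases mul_eq_zero.1 (show l m * b m m = 0 from h0) with h | h
    · exact hm.2 h
    · exact m.2 h
  · intro c hc hcm
    rw [Finsupp.smul_apply, smul_eq_mul]
    by_cases hlc : l c = 0
    · rw [hlc, zero_mul]
    · rw [hb _ _ (lt_of_le_of_ne (hmax c (Finset.mem_filter.2 ⟨hc, hlc⟩))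
        fun h => hcm (Subtype.ext h)), mul_zero]

/-- Over a principal ideal domain, a submodule of the free module on `A` is free: for a well-order
on `A`, choose an element of `N` for each leading term that occurs, with a leading coefficient
which generates the ideal of leading coefficients. -/
theorem Finsupp.free_submodule {R A : Type*} [CommRing R] [IsDomain R] [IsPrincipalIdealRing R]
    (N : Submodule R (A →₀ R)) : Module.Free R N := by
  classical
  let _ : LinearOrder A := linearOrderOfSTO WellOrderingRel
  have wf : WellFounded ((· < ·) : A → A → Prop) :=
    (inferInstance : IsWellFounded A WellOrderingRel).wf
  -- `L a` collects the elements of `N` supported in `c ≤ a`, and `I a` is the ideal of their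
  -- coefficients at `a`. When `I a = 0` the chosen `b a` has `b a a = 0`; such `a` are discarded in
  -- `S`.
  let L : A → Submodule R (A →₀ R) := fun a => N ⊓ Finsupp.supported R R (Set.Iic a)
  let I : A → Submodule R R := fun a => (L a).map (Finsupp.lapply a)
  have hI : ∀ a, ∃ b ∈ L a, I a = R ∙ (b a) := by
    intro a
    obtain ⟨g, hg⟩ := (IsPrincipalIdealRing.principal (I a)).principal
    obtain ⟨b, hb, hbg⟩ : g ∈ I a := by rw [hg]; exact Submodule.mem_span_singleton_self g
    refine ⟨b, hb, ?_⟩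
    rw [hg, ← hbg]
    rfl
  choose b hb hIb using hI
  have hba : ∀ {a c : A}, a < c → b a c = 0 := fun {a c} h => by
    by_contra h'
    exact not_le_of_gt h ((Finsupp.mem_supported R _).1 (hb a).2 (Finsupp.mem_support_iff.2 h'))
  let S : Type _ := {a : A // b a a ≠ 0}
  let v : S → N := fun a => ⟨b a, (hb a).1⟩
  have hli : LinearIndependent R v :=
    LinearIndependent.of_comp N.subtype (linearIndependent_of_leading b fun a c h => hba h)
  have hspan : ∀ a, ∀ x, (hx : x ∈ N) → x ∈ Finsupp.supported R R (Set.Iic a) →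
      (⟨x, hx⟩ : N) ∈ Submodule.span R (Set.range v) := by
    intro a
    induction a using wf.induction with
    | _ a ih =>
    -- Once the coefficient at `a` vanishes, the largest element of the support is below `a`, and
    -- the induction hypothesis applies there.
    have hlt : ∀ y, (hy : y ∈ N) → y ∈ Finsupp.supported R R (Set.Iic a) → y a = 0 →
        (⟨y, hy⟩ : N) ∈ Submodule.span R (Set.range v) := by
      intro y hy hya hy0
      rcases y.support.eq_empty_or_nonempty with h | h
      · have : (⟨y, hy⟩ : N) = 0 := Subtype.ext (Finsupp.support_eq_empty.1 h)
        rw [this]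
        exact zero_mem _
      · refine ih (y.support.max' h) ?_ y hy ?_
        · have hm := y.support.max'_mem h
          refine lt_of_le_of_ne ((Finsupp.mem_supported R _).1 hya hm) fun he => ?_
          rw [he] at hm
          exact (Finsupp.mem_support_iff.1 hm) hy0
        · exact (Finsupp.mem_supported R _).2 fun c hc => y.support.le_max' c hc
    intro x hx hxa
    have : x a ∈ R ∙ (b a a) := by
      rw [← hIb]
      exact ⟨x, ⟨hx, hxa⟩, rfl⟩
    obtain ⟨r, hr⟩ := Submodule.mem_span_singleton.1 this
    by_cases h0 : b a a = 0
    · exact hlt x hx hxa (by rw [← hr, h0, smul_zero])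
    -- The coefficient of `x` at `a` is `r` times the generator `b a a`, so subtracting `r • b a`
    -- cancels it.
    · have hy : x - r • b a ∈ N := sub_mem hx (Submodule.smul_mem _ _ (hb a).1)
      have key := hlt _ hy (sub_mem hxa (Submodule.smul_mem _ _ (hb a).2))
        (by rw [Finsupp.sub_apply, Finsupp.smul_apply, hr, sub_self])
      have hx' : (⟨x, hx⟩ : N) = ⟨x - r • b a, hy⟩ + r • v ⟨a, h0⟩ := Subtype.ext (by simp [v])
      rw [hx']
      exact add_mem key (Submodule.smul_mem _ _ (Submodule.subset_span ⟨_, rfl⟩))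
  refine Module.Free.of_basis (Module.Basis.mk hli ?_)
  rintro ⟨x, hx⟩ -
  rcases x.support.eq_empty_or_nonempty with h | h
  · have : (⟨x, hx⟩ : N) = 0 := Subtype.ext (Finsupp.support_eq_empty.1 h)
    rw [this]
    exact zero_mem _
  · exact hspan (x.support.max' h) x hx
      ((Finsupp.mem_supported R _).2 fun c hc => x.support.le_max' c hc)

/-! ### Tor of a quotient from a two-term resolution -/

noncomputable section
namespace CategoryTheory
variable {R : Type u} [CommRing R]

/-- The two-term complex `K → P` in degrees `1`, `0`. -/
def twoTermComplex {K P : ModuleCat.{u} R} (f : K ⟶ P) : ChainComplex (ModuleCat.{u} R) ℕ where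
  -- Cases on the degree make the terms and the differential in degrees `0` and `1` unfold
  -- definitionally; the `rfl` proofs below depend on this.
  X
    | 0 => P
    | 1 => K
    | _ + 2 => ModuleCat.of R PUnit
  d
    | 1, 0 => f
    | _, _ => 0
  shape
    | 1, 0, h => absurd rfl h
    | _ + 2, _, _ => rfl
    | 0, _, _ => rfl
    | 1, _ + 1, _ => rfl
  d_comp_d'
    | _, _, 0, rfl, rfl => Limits.zero_comp
    | _, _, _ + 1, rfl, rfl => Limits.zero_comp

theorem isZero_twoTermComplex_X {K P : ModuleCat.{u} R} (f : K ⟶ P) (n : ℕ) :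
    Limits.IsZero ((twoTermComplex f).X (n + 2)) :=
  ModuleCat.isZero_of_subsingleton (ModuleCat.of R PUnit)

/-- A chain map between two-term complexes. -/
def twoTermComplexMap {K P K' P' : ModuleCat.{u} R} {f : K ⟶ P} {f' : K' ⟶ P'} (a : K ⟶ K')
    (b : P ⟶ P') (h : a ≫ f' = f ≫ b) : twoTermComplex f ⟶ twoTermComplex f' where
  f
    | 0 => b
    | 1 => a
    | _ + 2 => 0
  comm'
    | _, 0, rfl => h
    | _, _ + 1, rfl => (isZero_twoTermComplex_X f _).eq_of_src _ _

/-- The augmentation of a two-term complex. -/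
def twoTermπ {K P B : ModuleCat.{u} R} (f : K ⟶ P) (g : P ⟶ B) (w : f ≫ g = 0) :
    twoTermComplex f ⟶ (ChainComplex.single₀ _).obj B :=
  (ChainComplex.toSingle₀Equiv (twoTermComplex f) B).symm ⟨(g : (twoTermComplex f).X 0 ⟶ B), w⟩

/-- In degree `0` the condition is exactness at `P` together with surjectivity of `g`. In degree `1`
it is injectivity of `f`, and from degree `2` on both complexes vanish. -/
theorem quasiIso_twoTermπ {K P B : ModuleCat.{u} R} (f : K ⟶ P) (g : P ⟶ B) (w : f ≫ g = 0)
    (h : (ShortComplex.mk f g w).ShortExact) : QuasiIso (twoTermπ f g w) where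
  quasiIsoAt n := by
    cases n with
    | zero =>
      rw [ChainComplex.quasiIsoAt₀_iff, ShortComplex.quasiIso_iff_of_zeros' _ rfl rfl rfl]
      refine (ShortComplex.exact_and_epi_g_iff_of_iso ?_).2 ⟨h.exact, h.epi_g⟩
      have : (twoTermπ f g w).f 0 = g := ChainComplex.toSingle₀Equiv_symm_apply_f_zero _ _
      exact ShortComplex.isoMk (Iso.refl _) (Iso.refl _) (Iso.refl _)
          (by simp; rfl) (by simp; exact this.symm)
    | succ n =>
      rw [quasiIsoAt_iff_exactAt' _ _ (ChainComplex.exactAt_succ_single_obj _ _)]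
      cases n with
      | zero =>
        rw [HomologicalComplex.exactAt_iff' _ 2 1 0 (by simp) (by simp)]
        exact (ShortComplex.exact_iff_mono _ rfl).2 h.mono_f
      | succ n =>
        rw [HomologicalComplex.exactAt_iff]
        exact ShortComplex.exact_of_isZero_X₂ _ (isZero_twoTermComplex_X f n)

/-- A short exact sequence `0 → K → P → B → 0` with `K`, `P` projective is a projective resolution
of `B`. -/
def twoTermResolution {K P B : ModuleCat.{u} R} (f : K ⟶ P) (g : P ⟶ B) (w : f ≫ g = 0)
    (h : (ShortComplex.mk f g w).ShortExact) [Projective K] [Projective P] :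
    ProjectiveResolution B where
  complex := twoTermComplex f
  projective
    | 0 => ‹Projective P›
    | 1 => ‹Projective K›
    | n + 2 => (isZero_twoTermComplex_X f n).projective
  π := twoTermπ f g w
  quasiIso := quasiIso_twoTermπ f g w h

section

variable {C D : ChainComplex (ModuleCat.{u} R) ℕ}

theorem isIso_homologyπ_one (h : C.d 2 1 = 0) : IsIso (C.homologyπ 1) :=
  C.isIso_homologyπ 2 1 (by simp) h

/-- If there are no boundaries in degree `1`, the homology consists of elements of the complex. -/
def homologyOneι (h : C.d 2 1 = 0) : C.homology 1 ⟶ C.X 1 :=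
  have := isIso_homologyπ_one h
  inv (C.homologyπ 1) ≫ C.iCycles 1

instance (h : C.d 2 1 = 0) : Mono (homologyOneι h) := by
  have := isIso_homologyπ_one h
  exact mono_comp _ _

theorem homologyOneι_naturality (h : C.d 2 1 = 0) (h' : D.d 2 1 = 0) (φ : C ⟶ D) :
    HomologicalComplex.homologyMap φ 1 ≫ homologyOneι h' = homologyOneι h ≫ φ.f 1 := by
  have := isIso_homologyπ_one h
  have := isIso_homologyπ_one h'
  rw [← cancel_epi (C.homologyπ 1)]
  simp [homologyOneι]

/-- Without boundaries in degree `1`, a homology class is a cycle; conversely the inclusion of the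
kernel lifts to the cycles and thence to homology. -/
theorem range_homologyOneι (h : C.d 2 1 = 0) :
    LinearMap.range (homologyOneι h).hom = LinearMap.ker (C.d 1 0).hom := by
  have := isIso_homologyπ_one h
  refine le_antisymm ?_ fun x hx => ?_
  · rintro _ ⟨x, rfl⟩
    have : homologyOneι h ≫ C.d 1 0 = 0 := by simp [homologyOneι]
    exact LinearMap.congr_fun (congrArg ModuleCat.Hom.hom this) x
  · let k : ModuleCat.of R (LinearMap.ker (C.d 1 0).hom) ⟶ C.X 1 :=
      ModuleCat.ofHom (Submodule.subtype _)
    have hk : k ≫ C.d 1 0 = 0 := by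
      ext y
      exact y.2
    have : (C.liftCycles k 0 (by simp) hk ≫ C.homologyπ 1) ≫ homologyOneι h = k := by
      simp [homologyOneι]
    exact ⟨_, LinearMap.congr_fun (congrArg ModuleCat.Hom.hom this) ⟨x, hx⟩⟩

end

section Tor

open MonoidalCategory

variable {P : Type u} [AddCommGroup P] [Module R P] (N : Submodule R P)
  [Module.Projective R P] [Module.Projective R N]

/-- The projective resolution `0 → N → P` of `P ⧸ N`. -/
def quotientResolution : ProjectiveResolution (ModuleCat.of R (P ⧸ N)) :=
  have : Projective (ModuleCat.of R N) := (IsProjective.iff_projective _).1 inferInstance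
  have : Projective (ModuleCat.of R P) := (IsProjective.iff_projective _).1 inferInstance
  twoTermResolution (ModuleCat.ofHom N.subtype) (ModuleCat.ofHom N.mkQ)
    (ModuleCat.hom_ext (LinearMap.ext fun x => (Submodule.Quotient.mk_eq_zero N).2 x.2))
    { exact := (ShortComplex.moduleCat_exact_iff _).2 fun x hx =>
        ⟨⟨x, (Submodule.Quotient.mk_eq_zero N).1 hx⟩, rfl⟩
      mono_f := (ModuleCat.mono_iff_injective _).2 N.subtype_injective
      epi_g := (ModuleCat.epi_iff_surjective _).2 N.mkQ_surjective }

variable (A : ModuleCat.{u} R)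

/-- The resolution `A ⊗ N → A ⊗ P`. -/
def tensorQuotientResolution : ChainComplex (ModuleCat.{u} R) ℕ :=
  (((tensoringLeft (ModuleCat.{u} R)).obj A).mapHomologicalComplex _).obj
    (quotientResolution N).complex

theorem tensorQuotientResolution_d : (tensorQuotientResolution N A).d 2 1 = 0 :=
  ((tensoringLeft (ModuleCat.{u} R)).obj A).map_zero _ _

/-- `Tor` is derived from `A ⊗ -`, so the second variable is the one to resolve. This is the source
of the asymmetry below, where boundaries of the second factor play a special role. -/
def torIsoHomology : ((Tor (ModuleCat.{u} R) 1).obj A).obj (ModuleCat.of R (P ⧸ N)) ≅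
    (tensorQuotientResolution N A).homology 1 :=
  (quotientResolution N).isoLeftDerivedObj ((tensoringLeft (ModuleCat.{u} R)).obj A) 1

/-- The embedding of `Tor₁(A, P ⧸ N)` in `A ⊗ N`. -/
def torι : ((Tor (ModuleCat.{u} R) 1).obj A).obj (ModuleCat.of R (P ⧸ N)) ⟶
    ModuleCat.of R (A ⊗[R] N) :=
  (torIsoHomology N A).hom ≫ homologyOneι (tensorQuotientResolution_d N A)

theorem torι_injective : Function.Injective (torι N A).hom :=
  (ModuleCat.mono_iff_injective (torι N A)).1
    (mono_comp (torIsoHomology N A).hom (homologyOneι (tensorQuotientResolution_d N A)))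

/-- With `torι_injective`, this identifies `Tor₁(A, P ⧸ N)` with the kernel of `A ⊗ N → A ⊗ P`, the
form in which elements of Tor are constructed and compared. -/
theorem range_torι : LinearMap.range (torι N A).hom = LinearMap.ker (N.subtype.lTensor A) := by
  refine Eq.trans ?_ (range_homologyOneι (tensorQuotientResolution_d N A))
  change LinearMap.range ((homologyOneι (tensorQuotientResolution_d N A)).hom ∘ₗ
    (torIsoHomology N A).hom.hom) = _
  refine LinearMap.range_comp_of_range_eq_top _ ?_
  exact LinearMap.range_eq_top.2
    ((ModuleCat.epi_iff_surjective (torIsoHomology N A).hom).1 inferInstance)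

variable {P' : Type u} [AddCommGroup P'] [Module R P'] {N} (N' : Submodule R P')
  [Module.Projective R P'] [Module.Projective R N'] {A} {A' : ModuleCat.{u} R}

/-- A map of pairs `(P, N) → (P', N')` is itself a chain map of two-term resolutions covering the
map of quotients, so it computes the action of Tor on the second variable. The first variable acts
through the tensor factor. -/
theorem torι_naturality (a : A ⟶ A') (b : P →ₗ[R] P') (hb : N ≤ N'.comap b) :
    (((Tor (ModuleCat.{u} R) 1).map a).app (ModuleCat.of R (P ⧸ N)) ≫
      ((Tor (ModuleCat.{u} R) 1).obj A').map (ModuleCat.ofHom (N.mapQ N' b hb))) ≫ torι N' A' =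
    torι N A ≫ ModuleCat.ofHom (TensorProduct.map a.hom (b.restrict hb)) := by
  let φ : (quotientResolution N).complex ⟶ (quotientResolution N').complex :=
    twoTermComplexMap (ModuleCat.ofHom (b.restrict hb)) (ModuleCat.ofHom b) rfl
  have hφ : φ.f 0 ≫ (quotientResolution N').π.f 0 =
      (quotientResolution N).π.f 0 ≫ ModuleCat.ofHom (N.mapQ N' b hb) := by
    rfl
  -- `α` changes the tensor factor and `β` the resolution; each computes one of the two Tor maps.
  let α : tensorQuotientResolution N A ⟶ tensorQuotientResolution N A' :=
    (NatTrans.mapHomologicalComplex ((tensoringLeft (ModuleCat.{u} R)).map a) _).app _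
  let β : tensorQuotientResolution N A' ⟶ tensorQuotientResolution N' A' :=
    (((tensoringLeft (ModuleCat.{u} R)).obj A').mapHomologicalComplex _).map φ
  have h1 : ((Tor (ModuleCat.{u} R) 1).map a).app (ModuleCat.of R (P ⧸ N)) =
      (torIsoHomology N A).hom ≫ HomologicalComplex.homologyMap α 1 ≫ (torIsoHomology N A').inv :=
    (quotientResolution N).leftDerived_app_eq ((tensoringLeft (ModuleCat.{u} R)).map a) 1
  have h2 : ((Tor (ModuleCat.{u} R) 1).obj A').map (ModuleCat.ofHom (N.mapQ N' b hb)) ≫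
      (torIsoHomology N' A').hom =
        (torIsoHomology N A').hom ≫ HomologicalComplex.homologyMap β 1 :=
    ProjectiveResolution.isoLeftDerivedObj_hom_naturality _ _ _ φ hφ
      ((tensoringLeft (ModuleCat.{u} R)).obj A') 1
  have h3 : α.f 1 ≫ β.f 1 = ModuleCat.ofHom (TensorProduct.map a.hom (b.restrict hb)) := by
    refine ModuleCat.hom_ext (TensorProduct.ext' fun x y => ?_)
    rfl
  have h4 : (((Tor (ModuleCat.{u} R) 1).map a).app (ModuleCat.of R (P ⧸ N)) ≫
      ((Tor (ModuleCat.{u} R) 1).obj A').map (ModuleCat.ofHom (N.mapQ N' b hb))) ≫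
        (torIsoHomology N' A').hom ≫ homologyOneι (tensorQuotientResolution_d N' A') =
      ((torIsoHomology N A).hom ≫ homologyOneι (tensorQuotientResolution_d N A)) ≫
        α.f 1 ≫ β.f 1 := by
    rw [Category.assoc, reassoc_of% h2, h1, Category.assoc, Category.assoc,
      Iso.inv_hom_id_assoc, homologyOneι_naturality (tensorQuotientResolution_d N A'),
      reassoc_of% (homologyOneι_naturality (tensorQuotientResolution_d N A)
        (tensorQuotientResolution_d N A') α), Category.assoc]
  exact h4.trans (congrArg (fun k => torι N A ≫ k) h3)

end Tor

end CategoryTheory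

end

/-! ### Tensor products of submodules and their intersections -/

section TensorSub

variable {R : Type*} [CommRing R] {M M' N N' : Type*} [AddCommGroup M] [AddCommGroup M']
  [AddCommGroup N] [AddCommGroup N'] [Module R M] [Module R M'] [Module R N] [Module R N']

/-- The image of `A ⊗ B` in `M ⊗ M'`. -/
def tensorSub (A : Submodule R M) (B : Submodule R M') : Submodule R (M ⊗[R] M') :=
  LinearMap.range (TensorProduct.mapIncl A B)

variable {A A₁ : Submodule R M} {B B₁ : Submodule R M'}

theorem tmul_mem_tensorSub {x : M} {y : M'} (hx : x ∈ A) (hy : y ∈ B) :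
    x ⊗ₜ[R] y ∈ tensorSub A B :=
  ⟨(⟨x, hx⟩ : A) ⊗ₜ (⟨y, hy⟩ : B), rfl⟩

/-- Linear conditions need checking on pure tensors only. Below, `S` is usually a kernel, an
equalizer or a preimage, which turns this into an induction principle for identities. -/
theorem tensorSub_le {S : Submodule R (M ⊗[R] M')} (h : ∀ x ∈ A, ∀ y ∈ B, x ⊗ₜ[R] y ∈ S) :
    tensorSub A B ≤ S := by
  rintro _ ⟨t, rfl⟩
  induction t using TensorProduct.induction_on with
  | zero => rw [map_zero]; exact zero_mem _
  | tmul x y => exact h x x.2 y y.2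
  | add s t hs ht => rw [map_add]; exact add_mem hs ht

theorem tensorSub_mono (h : A ≤ A₁) (h' : B ≤ B₁) : tensorSub A B ≤ tensorSub A₁ B₁ :=
  tensorSub_le fun _ hx _ hy => tmul_mem_tensorSub (h hx) (h' hy)

theorem map_mem_tensorSub {f : M →ₗ[R] N} {g : M' →ₗ[R] N'} {E : Submodule R N}
    {F : Submodule R N'} (hf : ∀ x ∈ A, f x ∈ E) (hg : ∀ y ∈ B, g y ∈ F) {t : M ⊗[R] M'}
    (ht : t ∈ tensorSub A B) : TensorProduct.map f g t ∈ tensorSub E F :=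
  (tensorSub_le (S := (tensorSub E F).comap (TensorProduct.map f g))
    fun x hx y hy => tmul_mem_tensorSub (hf x hx) (hg y hy)) ht

theorem lTensor_mem_tensorSub {g : M' →ₗ[R] N'} {F : Submodule R N'} (hg : ∀ y ∈ B, g y ∈ F)
    {t : M ⊗[R] M'} (ht : t ∈ tensorSub A B) : g.lTensor M t ∈ tensorSub A F :=
  map_mem_tensorSub (f := LinearMap.id) (fun _ hx => hx) hg ht

theorem rTensor_mem_tensorSub {f : M →ₗ[R] N} {E : Submodule R N} (hf : ∀ x ∈ A, f x ∈ E)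
    {t : M ⊗[R] M'} (ht : t ∈ tensorSub A B) : f.rTensor M' t ∈ tensorSub E B :=
  map_mem_tensorSub (g := LinearMap.id) hf (fun _ hx => hx) ht

/-- Pure tensors are lifted factor by factor, without flatness. This is how tensors of boundaries
are written as images of tensors of chains. -/
theorem exists_map_eq (f : M →ₗ[R] N) (g : M' →ₗ[R] N') {t : N ⊗[R] N'}
    (ht : t ∈ tensorSub (A.map f) (B.map g)) :
    ∃ s ∈ tensorSub A B, TensorProduct.map f g s = t := by
  have : tensorSub (A.map f) (B.map g) ≤ (tensorSub A B).map (TensorProduct.map f g) := by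
    refine tensorSub_le ?_
    rintro _ ⟨x, hx, rfl⟩ _ ⟨y, hy, rfl⟩
    exact ⟨x ⊗ₜ y, tmul_mem_tensorSub hx hy, rfl⟩
  exact this ht

theorem exists_lTensor_eq (g : M' →ₗ[R] N') {t : M ⊗[R] N'} (ht : t ∈ tensorSub A (B.map g)) :
    ∃ s ∈ tensorSub A B, g.lTensor M s = t :=
  exists_map_eq LinearMap.id g (by rwa [Submodule.map_id])

theorem exists_rTensor_eq (f : M →ₗ[R] N) {t : N ⊗[R] M'} (ht : t ∈ tensorSub (A.map f) B) :
    ∃ s ∈ tensorSub A B, f.rTensor M' s = t :=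
  exists_map_eq f LinearMap.id (by rwa [Submodule.map_id])

theorem comm_mem_tensorSub {t : M ⊗[R] M'} (ht : t ∈ tensorSub A B) :
    TensorProduct.comm R M M' t ∈ tensorSub B A :=
  (tensorSub_le (S := (tensorSub B A).comap (TensorProduct.comm R M M').toLinearMap)
    fun _ hx _ hy => tmul_mem_tensorSub hy hx) ht

/-- For flat modules, `A ⊗ B ∩ (id ⊗ g)⁻¹ (N ⊗ F) = A ⊗ (B ∩ g⁻¹ F)`, if `N' ⧸ F` is flat. -/
theorem mem_tensorSub_inf_comap (g : M' →ₗ[R] N') {F : Submodule R N'} [Module.Flat R A]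
    [Module.Flat R (N' ⧸ F)] {t : M ⊗[R] M'} (ht : t ∈ tensorSub A B)
    (hgt : g.lTensor M t ∈ tensorSub ⊤ F) : t ∈ tensorSub A (B ⊓ F.comap g) := by
  obtain ⟨s, rfl⟩ := ht
  -- The kernel of `q` is `B ∩ g⁻¹F`, and flatness of `A` identifies the kernel of `1 ⊗ q` with the
  -- image of `A ⊗ ker q`. That `s` is killed by `1 ⊗ q` can be tested in `M ⊗ (N' ⧸ F)`, because
  -- `N' ⧸ F` is flat.
  let q : B →ₗ[R] N' ⧸ F := F.mkQ ∘ₗ g ∘ₗ B.subtype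
  have h1 : A.subtype.rTensor (N' ⧸ F) (q.lTensor A s) = 0 := by
    have h2 : tensorSub ⊤ F ≤ LinearMap.ker (F.mkQ.lTensor M) := by
      refine tensorSub_le fun x _ y hy => ?_
      rw [LinearMap.mem_ker, LinearMap.lTensor_tmul, Submodule.mkQ_apply,
        (Submodule.Quotient.mk_eq_zero F).2 hy, tmul_zero]
    rw [← LinearMap.mem_ker.1 (h2 hgt)]
    have : A.subtype.rTensor (N' ⧸ F) ∘ₗ q.lTensor A =
        F.mkQ.lTensor M ∘ₗ g.lTensor M ∘ₗ TensorProduct.mapIncl A B :=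
      TensorProduct.ext' fun x y => rfl
    exact LinearMap.congr_fun this s
  have h3 : q.lTensor A s = 0 :=
    Module.Flat.rTensor_preserves_injective_linearMap _ A.subtype_injective (by rw [h1, map_zero])
  obtain ⟨r, rfl⟩ := (Module.Flat.lTensor_exact A q.exact_subtype_ker_map s).1 h3
  have h4 : ∀ r : A ⊗[R] LinearMap.ker q,
      TensorProduct.mapIncl A B ((LinearMap.ker q).subtype.lTensor A r) ∈
        tensorSub A (B ⊓ F.comap g) := by
    intro r
    induction r using TensorProduct.induction_on with
    | zero => rw [map_zero, map_zero]; exact zero_mem _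
    | tmul x y =>
      refine tmul_mem_tensorSub x.2 ⟨y.1.2, ?_⟩
      exact (Submodule.Quotient.mk_eq_zero F).1 (LinearMap.mem_ker.1 y.2)
    | add s t hs ht => rw [map_add, map_add]; exact add_mem hs ht
  exact h4 r

/-- The case `F = ⊥` of the previous lemma, where flatness of `N' ⧸ F` is flatness of `N'`. -/
theorem mem_tensorSub_inf_ker (g : M' →ₗ[R] N') [Module.Flat R A] [Module.Flat R N']
    {t : M ⊗[R] M'} (ht : t ∈ tensorSub A B) (hgt : g.lTensor M t = 0) :
    t ∈ tensorSub A (B ⊓ LinearMap.ker g) := by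
  have : Module.Flat R (N' ⧸ (⊥ : Submodule R N')) :=
    Module.Flat.of_linearEquiv (Submodule.quotEquivOfEqBot ⊥ rfl)
  exact mem_tensorSub_inf_comap g ht (by rw [hgt]; exact zero_mem _)

theorem mem_tensorSub_comap_inf (f : M →ₗ[R] N) {E : Submodule R N} [Module.Flat R B]
    [Module.Flat R (N ⧸ E)] {t : M ⊗[R] M'} (ht : t ∈ tensorSub A B)
    (hft : f.rTensor M' t ∈ tensorSub E ⊤) : t ∈ tensorSub (A ⊓ E.comap f) B := by
  have h := mem_tensorSub_inf_comap f (comm_mem_tensorSub ht) (F := E) (by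
    rw [← LinearMap.comm_comp_rTensor_comp_comm_eq]
    simpa using comm_mem_tensorSub hft)
  simpa using comm_mem_tensorSub h

theorem mem_tensorSub_ker_inf (f : M →ₗ[R] N) [Module.Flat R B] [Module.Flat R N]
    {t : M ⊗[R] M'} (ht : t ∈ tensorSub A B) (hft : f.rTensor M' t = 0) :
    t ∈ tensorSub (A ⊓ LinearMap.ker f) B := by
  have : Module.Flat R (N ⧸ (⊥ : Submodule R N)) :=
    Module.Flat.of_linearEquiv (Submodule.quotEquivOfEqBot ⊥ rfl)
  exact mem_tensorSub_comap_inf f ht (by rw [hft]; exact zero_mem _)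

/-- The map factors as `A ⊗ B → M ⊗ B → M ⊗ M'`; the first step uses flatness of `B`, the second
that of `M`. -/
theorem mapIncl_injective [Module.Flat R M] [Module.Flat R B] :
    Function.Injective (TensorProduct.mapIncl A B) := by
  have : TensorProduct.mapIncl A B = B.subtype.lTensor M ∘ₗ A.subtype.rTensor B :=
    TensorProduct.ext' fun _ _ => rfl
  rw [this]
  exact (Module.Flat.lTensor_preserves_injective_linearMap _ B.subtype_injective).comp
    (Module.Flat.rTensor_preserves_injective_linearMap _ A.subtype_injective)

/-- Translates membership in the ambient `M ⊗ M'` into vanishing in a quotient: by injectivity `t`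
comes from `K ⊗ Q`, which dies in `(P ⧸ K) ⊗ Q`. -/
theorem tensorSub_map_range {P Q : Type*} [AddCommGroup P] [AddCommGroup Q] [Module R P]
    [Module R Q] (f : P →ₗ[R] M) (g : Q →ₗ[R] M') (K : Submodule R P) {t : P ⊗[R] Q}
    (hfg : Function.Injective (TensorProduct.map f g))
    (ht : TensorProduct.map f g t ∈ tensorSub (K.map f) (LinearMap.range g)) :
    K.mkQ.rTensor Q t = 0 := by
  rw [← Submodule.map_top] at ht
  obtain ⟨s, hs, hst⟩ := exists_map_eq f g ht
  rw [← hfg hst]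
  have : tensorSub K ⊤ ≤ LinearMap.ker (K.mkQ.rTensor Q) := by
    refine tensorSub_le fun x hx y _ => ?_
    rw [LinearMap.mem_ker, LinearMap.rTensor_tmul, Submodule.mkQ_apply,
      (Submodule.Quotient.mk_eq_zero K).2 hx, zero_tmul]
  exact this hs

theorem tensorSub_range_map {P Q : Type*} [AddCommGroup P] [AddCommGroup Q] [Module R P]
    [Module R Q] (f : P →ₗ[R] M) (g : Q →ₗ[R] M') (K : Submodule R Q) {t : P ⊗[R] Q}
    (hfg : Function.Injective (TensorProduct.map f g))
    (ht : TensorProduct.map f g t ∈ tensorSub (LinearMap.range f) (K.map g)) :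
    K.mkQ.lTensor P t = 0 := by
  rw [← Submodule.map_top] at ht
  obtain ⟨s, hs, hst⟩ := exists_map_eq f g ht
  rw [← hfg hst]
  have : tensorSub ⊤ K ≤ LinearMap.ker (K.mkQ.lTensor P) := by
    refine tensorSub_le fun x _ y hy => ?_
    rw [LinearMap.mem_ker, LinearMap.lTensor_tmul, Submodule.mkQ_apply,
      (Submodule.Quotient.mk_eq_zero K).2 hy, tmul_zero]
  exact this hs

end TensorSub

/-! ### The infimum complex of a tensor product -/

section Infimum

variable {R : Type u} [CommRing R] {M M' M'' : Type u} [AddCommGroup M] [Module R M]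
  [AddCommGroup M'] [Module R M'] [AddCommGroup M''] [Module R M'']

/-- A differential and submodules `D k` with flat quotients, with `d (D 0) = 0`. -/
structure IsFlatGraded (d : M →ₗ[R] M) (D : ℕ → Submodule R M) : Prop where
  sq : ∀ x, d (d x) = 0
  zero : D 0 ≤ LinearMap.ker d
  flat : ∀ k, Module.Flat R (M ⧸ D k)

/-- The submodules `D'' n` are the direct sums of the products of `D p` and `D' q`, `p + q = n`,
where `c p q` is the projection to the `(p, q)`-component. -/
structure IsInfTensor (d : M →ₗ[R] M) (D : ℕ → Submodule R M) (d' : M' →ₗ[R] M')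
    (D' : ℕ → Submodule R M') (d'' : M'' →ₗ[R] M'') (D'' : ℕ → Submodule R M'')
    (m : M →ₗ[R] M' →ₗ[R] M'') (c : ℕ → ℕ → M'' →ₗ[R] M ⊗[R] M') : Prop
    extends IsInfProduct d D d' D' d'' D'' m where
  left : IsFlatGraded d D
  right : IsFlatGraded d' D'
  sq : ∀ x, d'' (d'' x) = 0
  -- Generation of `D'' n` by products, phrased so that linear statements about `D'' n` can be
  -- checked on products.
  le_of : ∀ (n : ℕ) (S : Submodule R M''),
    (∀ p q, p + q = n → ∀ x ∈ D p, ∀ y ∈ D' q, m x y ∈ S) → D'' n ≤ S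
  comp_mul : ∀ p q, ∀ x ∈ D p, ∀ y ∈ D' q, c p q (m x y) = x ⊗ₜ y
  comp_mul_of_ne : ∀ p q p' q', (p, q) ≠ (p', q') → ∀ x ∈ D p, ∀ y ∈ D' q, c p' q' (m x y) = 0
  comp_d : ∀ n, ∀ x ∈ D'' n, ∀ p q, c p q (d'' x) =
    d.rTensor M' (c (p + 1) q x) + (-1 : R) ^ p • d'.lTensor M (c p (q + 1) x)

theorem neg_one_pow_smul_smul {N : Type*} [AddCommGroup N] [Module R N] (p : ℕ) (x : N) :
    (-1 : R) ^ p • (-1 : R) ^ p • x = x := by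
  rw [smul_smul, ← mul_pow, neg_mul_neg, one_mul, one_pow, one_smul]

theorem mem_of_neg_one_pow_smul_mem {N : Type*} [AddCommGroup N] [Module R N] {S : Submodule R N}
    (p : ℕ) {x : N} (h : (-1 : R) ^ p • x ∈ S) : x ∈ S := by
  rw [← neg_one_pow_smul_smul (R := R) p x]
  exact S.smul_mem _ h

theorem rTensor_lTensor_comm {N N' : Type*} [AddCommGroup N] [Module R N] [AddCommGroup N']
    [Module R N'] (f : M →ₗ[R] N) (g : M' →ₗ[R] N') (t : M ⊗[R] M') :
    f.rTensor N' (g.lTensor M t) = g.lTensor N (f.rTensor M' t) := by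
  rw [← LinearMap.comp_apply, LinearMap.rTensor_comp_lTensor, ← LinearMap.lTensor_comp_rTensor]
  rfl

namespace IsInfTensor

variable {d : M →ₗ[R] M} {D : ℕ → Submodule R M} {d' : M' →ₗ[R] M'} {D' : ℕ → Submodule R M'}
  {d'' : M'' →ₗ[R] M''} {D'' : ℕ → Submodule R M''} {m : M →ₗ[R] M' →ₗ[R] M''}
  {c : ℕ → ℕ → M'' →ₗ[R] M ⊗[R] M'} (h : IsInfTensor d D d' D' d'' D'' m c)

include h

/-- On a product only one term of the antidiagonal survives. Together with `comp_mem` and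
`comp_lift` this realizes `D'' n` as the direct sum of the `D p ⊗ D' q`. -/
theorem sum_lift_comp {n : ℕ} {x : M''} (hx : x ∈ D'' n) :
    ∑ pq ∈ Finset.HasAntidiagonal.antidiagonal n, TensorProduct.lift m (c pq.1 pq.2 x) = x := by
  refine h.le_of n (LinearMap.eqLocus
    (∑ pq ∈ Finset.HasAntidiagonal.antidiagonal n, TensorProduct.lift m ∘ₗ c pq.1 pq.2)
    LinearMap.id)
    (fun p q hpq x hx y hy => ?_) hx |> fun h => by simpa [LinearMap.sum_apply] using h
  rw [LinearMap.mem_eqLocus, LinearMap.sum_apply,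
    Finset.sum_eq_single_of_mem (p, q) (Finset.HasAntidiagonal.mem_antidiagonal.2 hpq)]
  · simp [h.comp_mul p q x hx y hy]
  · rintro ⟨p', q'⟩ - hne
    simp [h.comp_mul_of_ne p q p' q' hne.symm x hx y hy]

theorem comp_mem {n p q : ℕ} {x : M''} (hx : x ∈ D'' n) :
    c p q x ∈ tensorSub (D p) (D' q) := by
  refine h.le_of n ((tensorSub (D p) (D' q)).comap (c p q)) (fun p' q' _ x hx y hy => ?_) hx
  rw [Submodule.mem_comap]
  by_cases he : (p', q') = (p, q)
  · cases he
    rw [h.comp_mul p q x hx y hy]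
    exact tmul_mem_tensorSub hx hy
  · rw [h.comp_mul_of_ne p' q' p q he x hx y hy]
    exact zero_mem _

theorem comp_lift {p q : ℕ} {t : M ⊗[R] M'} (ht : t ∈ tensorSub (D p) (D' q)) :
    c p q (TensorProduct.lift m t) = t :=
  tensorSub_le (S := LinearMap.eqLocus (c p q ∘ₗ TensorProduct.lift m) LinearMap.id)
    (fun x hx y hy => by simpa using h.comp_mul p q x hx y hy) ht

theorem comp_lift_of_ne {p q p' q' : ℕ} (hne : (p, q) ≠ (p', q')) {t : M ⊗[R] M'}
    (ht : t ∈ tensorSub (D p) (D' q)) : c p' q' (TensorProduct.lift m t) = 0 :=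
  tensorSub_le (S := LinearMap.ker (c p' q' ∘ₗ TensorProduct.lift m))
    (fun x hx y hy => by simpa using h.comp_mul_of_ne p q p' q' hne x hx y hy) ht

/-- Only the first factor has to be homogeneous, since the Leibniz sign depends on its index alone.
-/
theorem d_lift {p : ℕ} {t : M ⊗[R] M'} (ht : t ∈ tensorSub (D p) ⊤) :
    d'' (TensorProduct.lift m t) = TensorProduct.lift m (d.rTensor M' t) +
      (-1 : R) ^ p • TensorProduct.lift m (d'.lTensor M t) :=
  tensorSub_le (S := LinearMap.eqLocus (d'' ∘ₗ TensorProduct.lift m)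
    (TensorProduct.lift m ∘ₗ d.rTensor M' + (-1 : R) ^ p • TensorProduct.lift m ∘ₗ d'.lTensor M))
    (fun x hx y _ => by simpa using h.leibniz p x hx y) ht

theorem rTensor_rTensor (t : M ⊗[R] M') : d.rTensor M' (d.rTensor M' t) = 0 := by
  rw [← LinearMap.rTensor_comp_apply, show d ∘ₗ d = 0 from LinearMap.ext h.left.sq]
  simp

theorem lTensor_lTensor (t : M ⊗[R] M') : d'.lTensor M (d'.lTensor M t) = 0 := by
  rw [← LinearMap.lTensor_comp_apply, show d' ∘ₗ d' = 0 from LinearMap.ext h.right.sq]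
  simp

variable [∀ N : Submodule R M, Module.Free R N] [∀ N : Submodule R M', Module.Free R N]

/-- The infimum complex of the tensor product is the tensor product of the infimum complexes. -/
theorem comp_mem_infChains {n p q : ℕ} (hpq : p + q = n) {x : M''} (hx : x ∈ infChains d'' D'' n) :
    c p q x ∈ tensorSub (infChains d D p) (infChains d' D' q) := by
  have hD : x ∈ D'' n := infChains_le d'' D'' n hx
  have h1 : c p q x ∈ tensorSub (infChains d D p) (D' q) := by
    cases p with
    -- In index `0` the infimum complex is all of `D 0`, because `d` kills `D 0`.
    | zero => exact tensorSub_mono (le_inf le_rfl h.left.zero) le_rfl (h.comp_mem hD)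
    | succ p =>
      obtain rfl : n = (p + q) + 1 := by omega
      have := h.left.flat p
      refine mem_tensorSub_comap_inf d (h.comp_mem hD) ?_
      -- Up to a term in `D p ⊗ M'`, the element `(d ⊗ 1) x_{p+1,q}` is the `(p,q)`-component of
      -- `d'' x`, and this lies in `D p ⊗ D' q` because `x` is in the infimum complex.
      have e := h.comp_d _ x hD p q
      rw [← sub_eq_iff_eq_add] at e
      rw [← e]
      refine sub_mem (tensorSub_mono le_rfl le_top (h.comp_mem hx.2))
        (Submodule.smul_mem _ _ (lTensor_mem_tensorSub (fun _ _ => Submodule.mem_top)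
          (h.comp_mem hD)))
  cases q with
  | zero => exact tensorSub_mono le_rfl (le_inf le_rfl h.right.zero) h1
  | succ q =>
    obtain rfl : n = (p + q) + 1 := by omega
    have := h.right.flat q
    -- The same argument in the second factor, starting from `h1`, where the first factor is already
    -- cut down; its flatness comes from freeness of all submodules of `M`.
    refine mem_tensorSub_inf_comap d' h1 (mem_of_neg_one_pow_smul_mem p ?_)
    have e := h.comp_d _ x hD p q
    rw [← sub_eq_iff_eq_add'] at e
    rw [← e]
    refine sub_mem (tensorSub_mono le_top le_rfl (h.comp_mem hx.2))
      (rTensor_mem_tensorSub (fun _ _ => Submodule.mem_top) (h.comp_mem hD))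

-- The cycle condition read in bidegree `(p, q)`: the two partial differentials landing there
-- cancel.
omit [∀ N : Submodule R M, Module.Free R N] [∀ N : Submodule R M', Module.Free R N] in
theorem rTensor_comp_add {n : ℕ} {x : M''} (hx : x ∈ infCycles d'' D'' n) (p q : ℕ) :
    d.rTensor M' (c (p + 1) q x) + (-1 : R) ^ p • d'.lTensor M (c p (q + 1) x) = 0 := by
  rw [← h.comp_d n x (infChains_le d'' D'' n hx.1), LinearMap.mem_ker.1 hx.2, map_zero]

end IsInfTensor

end Infimum

/-! ### The components of a cycle as tensors of cycles and boundaries -/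

section Infimum

variable {R : Type u} [CommRing R] {M M' M'' : Type u} [AddCommGroup M] [Module R M]
  [AddCommGroup M'] [Module R M'] [AddCommGroup M''] [Module R M'']

/-- A submodule of `Z` is also a submodule of `M`. Applied to boundaries inside cycles, it makes
boundaries → cycles a projective resolution of the homology. -/
instance free_submodule_submodule [∀ N : Submodule R M, Module.Free R N] (Z : Submodule R M)
    (N : Submodule R Z) : Module.Free R N :=
  Module.Free.of_equiv (Submodule.equivSubtypeMap Z N).symm

/-- The boundaries, as a submodule of the cycles. -/
abbrev infCycleBoundaries (d : M →ₗ[R] M) (D : ℕ → Submodule R M) (k : ℕ) :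
    Submodule R (infCycles d D k) :=
  (infBoundaries d D k).comap (infCycles d D k).subtype

/-- The boundaries included in the whole module. -/
abbrev infBoundaryι (d : M →ₗ[R] M) (D : ℕ → Submodule R M) (k : ℕ) :
    infCycleBoundaries d D k →ₗ[R] M :=
  (infCycles d D k).subtype ∘ₗ (infCycleBoundaries d D k).subtype

theorem infBoundaryι_injective (d : M →ₗ[R] M) (D : ℕ → Submodule R M) (k : ℕ) :
    Function.Injective (infBoundaryι d D k) :=
  (Submodule.subtype_injective _).comp (Submodule.subtype_injective _)

namespace IsFlatGraded

variable {d : M →ₗ[R] M} {D : ℕ → Submodule R M} (h : IsFlatGraded d D)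

include h

theorem map_subtype (k : ℕ) :
    (infCycleBoundaries d D k).map (infCycles d D k).subtype = infBoundaries d D k := by
  rw [Submodule.map_comap_subtype, inf_eq_right]
  exact infBoundaries_le d D h.sq k

theorem range_boundaryι (k : ℕ) :
    LinearMap.range (infBoundaryι d D k) = infBoundaries d D k := by
  rw [LinearMap.range_comp, Submodule.range_subtype, h.map_subtype]

theorem d_mem_infBoundaries (k : ℕ) {x : M} (hx : x ∈ infChains d D (k + 1)) :
    d x ∈ infBoundaries d D k :=
  ⟨x, hx, rfl⟩

end IsFlatGraded

namespace IsInfTensor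

variable {d : M →ₗ[R] M} {D : ℕ → Submodule R M} {d' : M' →ₗ[R] M'} {D' : ℕ → Submodule R M'}
  {d'' : M'' →ₗ[R] M''} {D'' : ℕ → Submodule R M''} {m : M →ₗ[R] M' →ₗ[R] M''}
  {c : ℕ → ℕ → M'' →ₗ[R] M ⊗[R] M'} (h : IsInfTensor d D d' D' d'' D'' m c)

variable [Module.Free R M] [Module.Free R M']
  [∀ N : Submodule R M, Module.Free R N] [∀ N : Submodule R M', Module.Free R N]

/-- By flatness of the boundaries and of `M`. It allows elements of `Z_p ⊗ B'_q` to be constructed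
and compared inside `M ⊗ M'`. -/
theorem map_boundaryι_injective (p q : ℕ) :
    Function.Injective (TensorProduct.map (infCycles d D p).subtype (infBoundaryι d' D' q)) := by
  have : TensorProduct.map (infCycles d D p).subtype (infBoundaryι d' D' q) =
      (infBoundaryι d' D' q).lTensor M ∘ₗ
        (infCycles d D p).subtype.rTensor (infCycleBoundaries d' D' q) :=
    TensorProduct.ext' fun _ _ => rfl
  rw [this]
  exact (Module.Flat.lTensor_preserves_injective_linearMap _ (infBoundaryι_injective d' D' q)).comp
    (Module.Flat.rTensor_preserves_injective_linearMap _ (Submodule.subtype_injective _))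

include h

theorem range_map_boundaryι (p q : ℕ) :
    LinearMap.range (TensorProduct.map (infCycles d D p).subtype (infBoundaryι d' D' q)) =
      tensorSub (infCycles d D p) (infBoundaries d' D' q) := by
  rw [TensorProduct.range_map, h.right.range_boundaryι, Submodule.range_subtype, tensorSub,
    TensorProduct.range_mapIncl]

/-- The second factor consists of boundaries because `x_{p,q+1}` is a tensor of infimum chains. The
first consists of cycles because the cycle condition turns the element into `∓(d ⊗ 1) x_{p+1,q}`,
which `d ⊗ 1` kills. -/
theorem lTensor_comp_mem {n p q : ℕ} (hpq : p + q + 1 = n) {x : M''}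
    (hx : x ∈ infCycles d'' D'' n) :
    d'.lTensor M (c p (q + 1) x) ∈ tensorSub (infCycles d D p) (infBoundaries d' D' q) := by
  refine mem_tensorSub_ker_inf d (lTensor_mem_tensorSub
    (fun _ hy => h.right.d_mem_infBoundaries q hy)
    (h.comp_mem_infChains (p := p) (q := q + 1) (by omega) hx.1)) ?_
  have e := eq_neg_of_add_eq_zero_right (h.rTensor_comp_add hx p q)
  have e' := congrArg (d.rTensor M') e
  rw [map_neg, h.rTensor_rTensor, neg_zero, map_smul] at e'
  rw [← neg_one_pow_smul_smul (R := R) p (d.rTensor M' _), e', smul_zero]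

theorem rTensor_comp_mem {n p q : ℕ} (hpq : p + q + 1 = n) {x : M''}
    (hx : x ∈ infCycles d'' D'' n) :
    d.rTensor M' (c (p + 1) q x) ∈ tensorSub (infBoundaries d D p) (infCycles d' D' q) := by
  refine mem_tensorSub_inf_ker d' (rTensor_mem_tensorSub
    (fun _ hy => h.left.d_mem_infBoundaries p hy)
      (h.comp_mem_infChains (by omega) hx.1)) ?_
  have e' := congrArg (d'.lTensor M) (eq_neg_of_add_eq_zero_left (h.rTensor_comp_add hx p q))
  rw [e', map_neg, map_smul, h.lTensor_lTensor, smul_zero, neg_zero]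

/-- The component `(1 ⊗ d') x_{p,q+1}` of a cycle `x`, in `Z_p ⊗ B'_q`. -/
noncomputable def boundaryComp {n p q : ℕ} (hpq : p + q + 1 = n) :
    infCycles d'' D'' n →ₗ[R] infCycles d D p ⊗[R] infCycleBoundaries d' D' q :=
  (LinearEquiv.ofInjective (TensorProduct.map (infCycles d D p).subtype (infBoundaryι d' D' q))
      (map_boundaryι_injective p q)).symm.toLinearMap ∘ₗ
    LinearMap.codRestrict _ (d'.lTensor M ∘ₗ c p (q + 1) ∘ₗ (infCycles d'' D'' n).subtype)
      fun x => by
        rw [h.range_map_boundaryι]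
        exact h.lTensor_comp_mem hpq x.2

theorem map_boundaryComp {n p q : ℕ} (hpq : p + q + 1 = n) (x : infCycles d'' D'' n) :
    TensorProduct.map (infCycles d D p).subtype (infBoundaryι d' D' q) (h.boundaryComp hpq x) =
      d'.lTensor M (c p (q + 1) x) :=
  congrArg Subtype.val (LinearEquiv.apply_symm_apply
    (LinearEquiv.ofInjective _ (map_boundaryι_injective (d := d) (D := D) p q)) _)

/-- The class of `boundaryComp` in `H_p ⊗ B'_q`. -/
noncomputable def torComp {n p q : ℕ} (hpq : p + q + 1 = n) :
    infCycles d'' D'' n →ₗ[R] InfHomology d D p ⊗[R] infCycleBoundaries d' D' q :=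
  (infCycleBoundaries d D p).mkQ.rTensor _ ∘ₗ h.boundaryComp hpq

theorem mapIncl_lTensor_boundaryComp {n p q : ℕ} (hpq : p + q + 1 = n) (x : infCycles d'' D'' n) :
    TensorProduct.mapIncl (infCycles d D p) (infCycles d' D' q)
      ((infCycleBoundaries d' D' q).subtype.lTensor _ (h.boundaryComp hpq x)) =
        d'.lTensor M (c p (q + 1) x) := by
  rw [← h.map_boundaryComp hpq]
  generalize h.boundaryComp hpq x = t
  have : TensorProduct.mapIncl (infCycles d D p) (infCycles d' D' q) ∘ₗ
      (infCycleBoundaries d' D' q).subtype.lTensor _ =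
        TensorProduct.map (infCycles d D p).subtype (infBoundaryι d' D' q) :=
    TensorProduct.ext' fun _ _ => rfl
  exact LinearMap.congr_fun this t

/-- A cycle of `Z_p ⊗ Z'_q` which lies in `B_p ⊗ Z'_q` vanishes in `H_p ⊗ Z'_q`. -/
theorem rTensor_mkQ_eq_zero {p q : ℕ} {t : infCycles d D p ⊗[R] infCycles d' D' q}
    (ht : TensorProduct.mapIncl _ _ t ∈ tensorSub (infBoundaries d D p) (infCycles d' D' q)) :
    (infCycleBoundaries d D p).mkQ.rTensor _ t = 0 :=
  tensorSub_map_range _ _ _ mapIncl_injective (by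
    rw [h.left.map_subtype, Submodule.range_subtype]
    exact ht)

theorem lTensor_mkQ_eq_zero {p q : ℕ} {t : infCycles d D p ⊗[R] infCycles d' D' q}
    (ht : TensorProduct.mapIncl _ _ t ∈ tensorSub (infCycles d D p) (infBoundaries d' D' q)) :
    (infCycleBoundaries d' D' q).mkQ.lTensor _ t = 0 :=
  tensorSub_range_map _ _ _ mapIncl_injective (by
    rw [h.right.map_subtype, Submodule.range_subtype]
    exact ht)

/-- The component equals `∓(d ⊗ 1) x_{p+1,q}`, which lies in `B_p ⊗ Z'_q` and so dies in `H_p ⊗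
Z'_q`. This kernel is the Tor term. -/
theorem torComp_mem_ker {n p q : ℕ} (hpq : p + q + 1 = n) (x : infCycles d'' D'' n) :
    h.torComp hpq x ∈ LinearMap.ker
      ((infCycleBoundaries d' D' q).subtype.lTensor (InfHomology d D p)) := by
  rw [LinearMap.mem_ker]
  have h1 : (infCycleBoundaries d D p).mkQ.rTensor _
      ((infCycleBoundaries d' D' q).subtype.lTensor _ (h.boundaryComp hpq x)) = 0 := by
    refine h.rTensor_mkQ_eq_zero (mem_of_neg_one_pow_smul_mem p ?_)
    rw [h.mapIncl_lTensor_boundaryComp hpq,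
      eq_neg_of_add_eq_zero_right (h.rTensor_comp_add x.2 p q)]
    exact neg_mem (h.rTensor_comp_mem hpq x.2)
  rw [rTensor_lTensor_comm] at h1
  exact h1

theorem comp_boundary {n p q : ℕ} {y : M''} (hy : y ∈ infChains d'' D'' (n + 1)) :
    d'.lTensor M (c p (q + 1) (d'' y)) = d'.lTensor M (d.rTensor M' (c (p + 1) (q + 1) y)) := by
  rw [h.comp_d _ y (infChains_le d'' D'' _ hy), map_add, map_smul, h.lTensor_lTensor, smul_zero,
    add_zero]

/-- If `x = d'' y`, the component is `(d ⊗ d') y_{p+1,q+1}`, which lies in `B_p ⊗ B'_q` and vanishes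
in `H_p ⊗ B'_q`. -/
theorem torComp_boundary {n p q : ℕ} (hpq : p + q + 1 = n) (x : infCycles d'' D'' n)
    (hx : (x : M'') ∈ infBoundaries d'' D'' n) : h.torComp hpq x = 0 := by
  obtain ⟨y, hy, hyx⟩ := hx
  refine tensorSub_map_range _ _ _ (map_boundaryι_injective p q) ?_
  rw [h.map_boundaryComp hpq, ← hyx, h.comp_boundary hy, h.left.map_subtype,
    h.right.range_boundaryι]
  exact lTensor_mem_tensorSub (fun _ hy => h.right.d_mem_infBoundaries q hy)
    (rTensor_mem_tensorSub (fun _ hy => h.left.d_mem_infBoundaries p hy)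
      (h.comp_mem_infChains (by omega) hy))

/-- By right exactness, vanishing in `H_p ⊗ B'_q` means coming from `B_p ⊗ B'_q`, and both factors
lift to chains. The resulting `y` is the correction term in the proof of exactness. -/
theorem comp_eq_of_torComp_eq_zero {n p q : ℕ} (hpq : p + q + 1 = n) (x : infCycles d'' D'' n)
    (hx : h.torComp hpq x = 0) :
    ∃ y ∈ tensorSub (infChains d D (p + 1)) (infChains d' D' (q + 1)),
      d'.lTensor M (c p (q + 1) x) = d'.lTensor M (d.rTensor M' y) := by
  obtain ⟨s, hs⟩ := (rTensor_exact (infCycleBoundaries d' D' q)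
    (LinearMap.exact_subtype_mkQ (infCycleBoundaries d D p))
    (infCycleBoundaries d D p).mkQ_surjective _).1 hx
  have h1 : d'.lTensor M (c p (q + 1) x) ∈
      tensorSub ((infChains d D (p + 1)).map d) ((infChains d' D' (q + 1)).map d') := by
    rw [← h.map_boundaryComp hpq, ← hs]
    rw [← LinearMap.comp_apply, LinearMap.map_comp_rTensor]
    have : LinearMap.range (TensorProduct.map (infBoundaryι d D p) (infBoundaryι d' D' q)) ≤
        tensorSub (infBoundaries d D p) (infBoundaries d' D' q) := by
      rw [TensorProduct.range_map, h.left.range_boundaryι, h.right.range_boundaryι, tensorSub,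
        TensorProduct.range_mapIncl]
    exact this ⟨s, rfl⟩
  obtain ⟨y, hy, e⟩ := exists_map_eq d d' h1
  refine ⟨y, hy, ?_⟩
  rw [← e, ← LinearMap.comp_apply, LinearMap.lTensor_comp_rTensor]

end IsInfTensor

end Infimum

/-! ### The map to the Tor terms -/

section Infimum

variable {R : Type u} [CommRing R] {M M' M'' : Type u} [AddCommGroup M] [Module R M]
  [AddCommGroup M'] [Module R M'] [AddCommGroup M''] [Module R M'']

/-- Only finitely many bidegrees occur, so maps and elements of the direct sums can be given by
their components. -/
instance finite_add_eq (n : ℕ) : Finite {pq : ℕ × ℕ // pq.1 + pq.2 = n} :=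
  Finite.of_injective (β := Fin (n + 1)) (fun pq => ⟨pq.1.1, by have := pq.2; omega⟩) (by
    rintro ⟨⟨p, q⟩, h⟩ ⟨⟨p', q'⟩, h'⟩ e
    simp only [Fin.mk.injEq] at e h h'
    simp only [Subtype.mk.injEq, Prod.mk.injEq]
    omega)

instance finite_add_add_one_eq (n : ℕ) : Finite {pq : ℕ × ℕ // pq.1 + pq.2 + 1 = n} :=
  Finite.of_injective (β := Fin (n + 1)) (fun pq => ⟨pq.1.1, by have := pq.2; omega⟩) (by
    rintro ⟨⟨p, q⟩, h⟩ ⟨⟨p', q'⟩, h'⟩ e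
    simp only [Fin.mk.injEq] at e h h'
    simp only [Subtype.mk.injEq, Prod.mk.injEq]
    omega)

/-- The homology of the infimum complex, as a sequence of objects of the category of modules. -/
abbrev infHomologyModule (d : M →ₗ[R] M) (D : ℕ → Submodule R M) (k : ℕ) : ModuleCat.{u} R :=
  ModuleCat.of R (InfHomology d D k)

/-- The `Tor` terms in degree `n`. -/
noncomputable abbrev torTerm (d : M →ₗ[R] M) (D : ℕ → Submodule R M) (d' : M' →ₗ[R] M')
    (D' : ℕ → Submodule R M') (n : ℕ) (pq : {pq : ℕ × ℕ // pq.1 + pq.2 + 1 = n}) :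
    ModuleCat.{u} R :=
  ((Tor (ModuleCat.{u} R) 1).obj (infHomologyModule d D pq.1.1)).obj
    (infHomologyModule d' D' pq.1.2)

namespace IsInfTensor

variable {d : M →ₗ[R] M} {D : ℕ → Submodule R M} {d' : M' →ₗ[R] M'} {D' : ℕ → Submodule R M'}
  {d'' : M'' →ₗ[R] M''} {D'' : ℕ → Submodule R M''} {m : M →ₗ[R] M' →ₗ[R] M''}
  {c : ℕ → ℕ → M'' →ₗ[R] M ⊗[R] M'} (h : IsInfTensor d D d' D' d'' D'' m c)

variable [Module.Free R M] [Module.Free R M']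
  [∀ N : Submodule R M, Module.Free R N] [∀ N : Submodule R M', Module.Free R N]

include h

theorem torComp_mem_range {n p q : ℕ} (hpq : p + q + 1 = n) (x : infCycles d'' D'' n) :
    h.torComp hpq x ∈
      LinearMap.range (torι (infCycleBoundaries d' D' q) (infHomologyModule d D p)).hom := by
  rw [range_torι]
  exact h.torComp_mem_ker hpq x

/-- The `(p, q)`-component of the map to the `Tor` terms, on cycles. -/
noncomputable def torPart {n p q : ℕ} (hpq : p + q + 1 = n) : infCycles d'' D'' n →ₗ[R]
    ((Tor (ModuleCat.{u} R) 1).obj (infHomologyModule d D p)).obj (infHomologyModule d' D' q) :=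
  (LinearEquiv.ofInjective _
      (torι_injective (infCycleBoundaries d' D' q) (infHomologyModule d D p))).symm.toLinearMap ∘ₗ
    LinearMap.codRestrict _ (h.torComp hpq) (h.torComp_mem_range hpq)

theorem torι_torPart {n p q : ℕ} (hpq : p + q + 1 = n) (x : infCycles d'' D'' n) :
    (torι (infCycleBoundaries d' D' q) (infHomologyModule d D p)).hom (h.torPart hpq x) =
      h.torComp hpq x :=
  congrArg Subtype.val (LinearEquiv.apply_symm_apply (LinearEquiv.ofInjective _
    (torι_injective (infCycleBoundaries d' D' q) (infHomologyModule d D p))) _)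

/-- Since both embeddings involved are injective, a Tor component can be recognized from any tensor
`w` that represents it. Surjectivity and naturality are proved through this criterion. -/
theorem torPart_eq {n p q : ℕ} (hpq : p + q + 1 = n) (x : infCycles d'' D'' n)
    {w : infCycles d D p ⊗[R] infCycleBoundaries d' D' q}
    {t : ((Tor (ModuleCat.{u} R) 1).obj (infHomologyModule d D p)).obj (infHomologyModule d' D' q)}
    (hw : TensorProduct.map (infCycles d D p).subtype (infBoundaryι d' D' q) w =
      d'.lTensor M (c p (q + 1) x))
    (ht : (torι (infCycleBoundaries d' D' q) (infHomologyModule d D p)).hom t =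
      (infCycleBoundaries d D p).mkQ.rTensor _ w) : h.torPart hpq x = t := by
  refine torι_injective _ _ ?_
  rw [h.torι_torPart, ht]
  refine congrArg _ (map_boundaryι_injective p q ?_)
  rw [hw, h.map_boundaryComp hpq]

theorem torPart_eq_zero {n p q : ℕ} (hpq : p + q + 1 = n) (x : infCycles d'' D'' n)
    (hx : d'.lTensor M (c p (q + 1) x) = 0) : h.torPart hpq x = 0 :=
  h.torPart_eq hpq x (w := 0) (by rw [hx, map_zero]) (by rw [map_zero, map_zero])

theorem torPart_boundary {n p q : ℕ} (hpq : p + q + 1 = n) (x : infCycles d'' D'' n)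
    (hx : (x : M'') ∈ infBoundaries d'' D'' n) : h.torPart hpq x = 0 := by
  refine torι_injective _ _ ?_
  rw [h.torι_torPart, map_zero, h.torComp_boundary hpq x hx]

open Classical in
/-- The map from the homology of the product to the `Tor` terms, on cycles. -/
noncomputable def torCycleMap (n : ℕ) :
    infCycles d'' D'' n →ₗ[R] ⨁ pq, torTerm d D d' D' n pq :=
  let _ := Fintype.ofFinite {pq : ℕ × ℕ // pq.1 + pq.2 + 1 = n}
  (DirectSum.linearEquivFunOnFintype R _ (fun pq => torTerm d D d' D' n pq)).symm.toLinearMap ∘ₗ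
    LinearMap.pi fun pq => h.torPart pq.2

theorem torCycleMap_apply (n : ℕ) (x : infCycles d'' D'' n)
    (pq : {pq : ℕ × ℕ // pq.1 + pq.2 + 1 = n}) : h.torCycleMap n x pq = h.torPart pq.2 x := by
  rfl

theorem torCycleMap_eq (n : ℕ) (x : infCycles d'' D'' n) (t : ⨁ pq, torTerm d D d' D' n pq)
    (ht : ∀ pq, h.torPart pq.2 x = t pq) : h.torCycleMap n x = t :=
  DFinsupp.ext fun pq => (h.torCycleMap_apply n x pq).trans (ht pq)

/-- The map from the homology of the product to the `Tor` terms. -/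
noncomputable def torMap (n : ℕ) : infHomologyModule d'' D'' n ⟶
    torSum (infHomologyModule d D) (infHomologyModule d' D') n :=
  ModuleCat.ofHom (Submodule.liftQ _ (h.torCycleMap n) fun x hx =>
    h.torCycleMap_eq n x 0 fun pq => h.torPart_boundary pq.2 x hx)

theorem torMap_mk (n : ℕ) (x : infCycles d'' D'' n) :
    (h.torMap n).hom (Submodule.Quotient.mk x) = h.torCycleMap n x :=
  rfl

end IsInfTensor

end Infimum

/-! ### The map from the tensor terms -/

section Infimum

variable {R : Type u} [CommRing R] {M M' M'' : Type u} [AddCommGroup M] [Module R M]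
  [AddCommGroup M'] [Module R M'] [AddCommGroup M''] [Module R M'']

/-- The class of a tensor of cycles. -/
noncomputable abbrev tensorClass (d : M →ₗ[R] M) (D : ℕ → Submodule R M) (d' : M' →ₗ[R] M')
    (D' : ℕ → Submodule R M') (p q : ℕ) : infCycles d D p ⊗[R] infCycles d' D' q →ₗ[R]
      InfHomology d D p ⊗[R] InfHomology d' D' q :=
  TensorProduct.map (infCycleBoundaries d D p).mkQ (infCycleBoundaries d' D' q).mkQ

/-- The tensor products of cycles in degree `n`. -/
abbrev tensorCycles (d : M →ₗ[R] M) (D : ℕ → Submodule R M) (d' : M' →ₗ[R] M')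
    (D' : ℕ → Submodule R M') (n : ℕ) (pq : {pq : ℕ × ℕ // pq.1 + pq.2 = n}) : Type u :=
  infCycles d D pq.1.1 ⊗[R] infCycles d' D' pq.1.2

/-- The classes of sums of tensors of cycles. -/
noncomputable def tensorClassSum (d : M →ₗ[R] M) (D : ℕ → Submodule R M) (d' : M' →ₗ[R] M')
    (D' : ℕ → Submodule R M') (n : ℕ) : (⨁ pq, tensorCycles d D d' D' n pq) →ₗ[R]
      ⨁ pq : {pq : ℕ × ℕ // pq.1 + pq.2 = n},
        InfHomology d D pq.1.1 ⊗[R] InfHomology d' D' pq.1.2 :=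
  DirectSum.lmap fun pq => tensorClass d D d' D' pq.1.1 pq.1.2

theorem tensorClassSum_surjective (d : M →ₗ[R] M) (D : ℕ → Submodule R M) (d' : M' →ₗ[R] M')
    (D' : ℕ → Submodule R M') (n : ℕ) : Function.Surjective (tensorClassSum d D d' D' n) :=
  (DirectSum.lmap_surjective _).2 fun _ =>
    TensorProduct.map_surjective (Submodule.mkQ_surjective _) (Submodule.mkQ_surjective _)

namespace IsInfTensor

variable {d : M →ₗ[R] M} {D : ℕ → Submodule R M} {d' : M' →ₗ[R] M'} {D' : ℕ → Submodule R M'}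
  {d'' : M'' →ₗ[R] M''} {D'' : ℕ → Submodule R M''} {m : M →ₗ[R] M' →ₗ[R] M''}
  {c : ℕ → ℕ → M'' →ₗ[R] M ⊗[R] M'} (h : IsInfTensor d D d' D' d'' D'' m c)

variable [Module.Free R M] [Module.Free R M']
  [∀ N : Submodule R M, Module.Free R N] [∀ N : Submodule R M', Module.Free R N]

include h

/-- Converse of `comp_mem_infChains`, from the Leibniz rule. The case distinctions arise because
index `0` has no predecessor, and there the differential vanishes instead. -/
theorem lift_mem_infChains {p q n : ℕ} (hpq : p + q = n) {t : M ⊗[R] M'}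
    (ht : t ∈ tensorSub (infChains d D p) (infChains d' D' q)) :
    TensorProduct.lift m t ∈ infChains d'' D'' n := by
  refine tensorSub_le (S := (infChains d'' D'' n).comap (TensorProduct.lift m))
    (fun x hx y hy => ?_) ht
  have hxD := infChains_le d D p hx
  have hyD := infChains_le d' D' q hy
  rw [Submodule.mem_comap, TensorProduct.lift.tmul]
  have h1 := h.mem p q x hxD y hyD
  rw [hpq] at h1
  have h2 := h.leibniz p x hxD y
  cases n with
  | zero =>
    obtain ⟨rfl, rfl⟩ : p = 0 ∧ q = 0 := by omega
    refine ⟨h1, ?_⟩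
    change d'' (m x y) = 0
    rw [h2, LinearMap.mem_ker.1 hx.2, LinearMap.mem_ker.1 hy.2]
    simp
  | succ n =>
    refine ⟨h1, ?_⟩
    change d'' (m x y) ∈ D'' n
    rw [h2]
    refine add_mem ?_ (Submodule.smul_mem _ _ ?_)
    · cases p with
      | zero =>
        rw [LinearMap.mem_ker.1 hx.2, map_zero, LinearMap.zero_apply]
        exact zero_mem _
      | succ p =>
        obtain rfl : p + q = n := by omega
        exact h.mem p q _ hx.2 y hyD
    · cases q with
      | zero =>
        rw [LinearMap.mem_ker.1 hy.2, map_zero]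
        exact zero_mem _
      | succ q =>
        obtain rfl : p + q = n := by omega
        exact h.mem p q x hxD _ hy.2

/-- A tensor of cycles, as a cycle of the product. -/
noncomputable def prodCycles {n p q : ℕ} (hpq : p + q = n) :
    infCycles d D p ⊗[R] infCycles d' D' q →ₗ[R] infCycles d'' D'' n :=
  LinearMap.codRestrict _ (TensorProduct.lift m ∘ₗ TensorProduct.mapIncl _ _) fun t => by
    subst hpq
    exact tensorSub_le (S := (infCycles d'' D'' (p + q)).comap (TensorProduct.lift m))
      (fun x hx y hy => h.toIsInfProduct.cycles p q x hx y hy) ⟨t, rfl⟩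

/-- The map from the tensor terms to the homology of the product. -/
noncomputable abbrev crossSum (n : ℕ) :
    tensorSum (infHomologyModule d D) (infHomologyModule d' D') n ⟶ infHomologyModule d'' D'' n :=
  tensorSumLift (fun p q => h.toIsInfProduct.cross p q) n

theorem crossSum_lof {n : ℕ} (pq : {pq : ℕ × ℕ // pq.1 + pq.2 = n})
    (t : infCycles d D pq.1.1 ⊗[R] infCycles d' D' pq.1.2) :
    (h.crossSum n).hom (DirectSum.lof R _ (fun pq : {pq : ℕ × ℕ // pq.1 + pq.2 = n} =>
      InfHomology d D pq.1.1 ⊗[R] InfHomology d' D' pq.1.2) pq (tensorClass d D d' D' _ _ t)) =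
    Submodule.Quotient.mk (h.prodCycles pq.2 t) := by
  -- Replacing `n` by `p + q` makes the transport `eqToHom` in `tensorSumLift` an identity.
  obtain ⟨⟨p, q⟩, rfl⟩ := pq
  simp only [tensorSumLift]
  rw [ModuleCat.hom_ofHom]
  refine (DirectSum.toModule_lof R _ _).trans ?_
  change h.toIsInfProduct.cross p q _ = _
  induction t using TensorProduct.induction_on with
  | zero => simp
  | tmul x y => rfl
  | add s t hs ht => rw [map_add, map_add, map_add, hs, ht]; rfl

theorem crossSum_tensorClassSum {n : ℕ} (w : ⨁ pq, tensorCycles d D d' D' n pq) :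
    (h.crossSum n).hom (tensorClassSum d D d' D' n w) =
    Submodule.Quotient.mk (DirectSum.toModule R _ _ (fun pq => h.prodCycles pq.2) w) := by
  have : (h.crossSum n).hom ∘ₗ tensorClassSum d D d' D' n =
      Submodule.mkQ _ ∘ₗ DirectSum.toModule R _ _ (fun pq => h.prodCycles pq.2) := by
    refine DirectSum.linearMap_ext R fun pq => LinearMap.ext fun t => ?_
    simp only [LinearMap.comp_apply, DirectSum.toModule_lof]
    refine Eq.trans ?_ (h.crossSum_lof pq t)
    exact congrArg _ (DirectSum.lmap_lof _ _ _)
  exact LinearMap.congr_fun this w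

end IsInfTensor

end Infimum

/-! ### Injectivity on the tensor terms and vanishing of the composite -/

section Infimum

variable {R : Type u} [CommRing R] {M M' M'' : Type u} [AddCommGroup M] [Module R M]
  [AddCommGroup M'] [Module R M'] [AddCommGroup M''] [Module R M'']

namespace IsInfTensor

variable {d : M →ₗ[R] M} {D : ℕ → Submodule R M} {d' : M' →ₗ[R] M'} {D' : ℕ → Submodule R M'}
  {d'' : M'' →ₗ[R] M''} {D'' : ℕ → Submodule R M''} {m : M →ₗ[R] M' →ₗ[R] M''}
  {c : ℕ → ℕ → M'' →ₗ[R] M ⊗[R] M'} (h : IsInfTensor d D d' D' d'' D'' m c)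

variable [Module.Free R M] [Module.Free R M']
  [∀ N : Submodule R M, Module.Free R N] [∀ N : Submodule R M', Module.Free R N]

include h

theorem ext_comp {n : ℕ} {x y : M''} (hx : x ∈ D'' n) (hy : y ∈ D'' n)
    (hxy : ∀ p q, p + q = n → c p q x = c p q y) : x = y := by
  rw [← h.sum_lift_comp hx, ← h.sum_lift_comp hy]
  refine Finset.sum_congr rfl fun pq hpq => ?_
  rw [hxy _ _ (Finset.HasAntidiagonal.mem_antidiagonal.1 hpq)]

theorem comp_sumCycles {n : ℕ} (w : ⨁ pq, tensorCycles d D d' D' n pq)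
    (pq : {pq : ℕ × ℕ // pq.1 + pq.2 = n}) :
    c pq.1.1 pq.1.2 (DirectSum.toModule R _ _ (fun pq => h.prodCycles pq.2) w) =
      TensorProduct.mapIncl _ _ (w pq) := by
  have : c pq.1.1 pq.1.2 ∘ₗ (infCycles d'' D'' n).subtype ∘ₗ
      DirectSum.toModule R _ _ (fun pq => h.prodCycles pq.2) =
      TensorProduct.mapIncl _ _ ∘ₗ DirectSum.component R _ (tensorCycles d D d' D' n) pq := by
    refine DirectSum.linearMap_ext R fun pq' => LinearMap.ext fun t => ?_
    simp only [LinearMap.comp_apply, DirectSum.toModule_lof]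
    have ht : TensorProduct.mapIncl _ _ t ∈ tensorSub (D pq'.1.1) (D' pq'.1.2) :=
      tensorSub_mono (inf_le_left.trans (infChains_le _ _ _))
        (inf_le_left.trans (infChains_le _ _ _)) ⟨t, rfl⟩
    by_cases he : pq' = pq
    · subst he
      rw [DirectSum.component.lof_self]
      exact h.comp_lift ht
    · rw [DirectSum.component.of, dif_neg he, map_zero]
      exact h.comp_lift_of_ne (fun e => he (Subtype.ext e)) ht
  exact LinearMap.congr_fun this w

/-- The element is `(d ⊗ 1) y_{p+1,q} ± (1 ⊗ d') y_{p,q+1}`. As `t` is a tensor of cycles, `1 ⊗ d'`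
kills the first summand and `d ⊗ 1` the second, so they lie in `B_p ⊗ Z'_q` and `Z_p ⊗ B'_q`, and
both have class zero. -/
theorem tensorClass_eq_zero {n p q : ℕ} (hpq : p + q = n) {y : M''}
    (hy : y ∈ infChains d'' D'' (n + 1)) {t : infCycles d D p ⊗[R] infCycles d' D' q}
    (ht : TensorProduct.mapIncl _ _ t = c p q (d'' y)) : tensorClass d D d' D' p q t = 0 := by
  rw [h.comp_d _ y (infChains_le _ _ _ hy)] at ht
  have ht0 : d.rTensor M' (TensorProduct.mapIncl _ _ t) = 0 := by
    refine tensorSub_le (S := LinearMap.ker (d.rTensor M')) (fun x hx y _ => ?_)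
      (⟨t, rfl⟩ : TensorProduct.mapIncl _ _ t ∈ tensorSub _ _)
    rw [LinearMap.mem_ker, LinearMap.rTensor_tmul, LinearMap.mem_ker.1 hx.2, zero_tmul]
  have ht0' : d'.lTensor M (TensorProduct.mapIncl _ _ t) = 0 := by
    refine tensorSub_le (S := LinearMap.ker (d'.lTensor M)) (fun x _ y hy => ?_)
      (⟨t, rfl⟩ : TensorProduct.mapIncl _ _ t ∈ tensorSub _ _)
    rw [LinearMap.mem_ker, LinearMap.lTensor_tmul, LinearMap.mem_ker.1 hy.2, tmul_zero]
  have ha : d.rTensor M' (c (p + 1) q y) ∈ tensorSub (infBoundaries d D p) (infCycles d' D' q) := by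
    refine mem_tensorSub_inf_ker d' (rTensor_mem_tensorSub
      (fun _ hy => h.left.d_mem_infBoundaries p hy) (h.comp_mem_infChains (by omega) hy)) ?_
    rw [ht, map_add, map_smul, h.lTensor_lTensor, smul_zero, add_zero] at ht0'
    exact ht0'
  have hb : d'.lTensor M (c p (q + 1) y) ∈
      tensorSub (infCycles d D p) (infBoundaries d' D' q) := by
    refine mem_tensorSub_ker_inf d (lTensor_mem_tensorSub
      (fun _ hy => h.right.d_mem_infBoundaries q hy)
      (h.comp_mem_infChains (p := p) (q := q + 1) (by omega) hy)) ?_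
    rw [ht, map_add, map_smul, h.rTensor_rTensor, zero_add] at ht0
    rw [← neg_one_pow_smul_smul (R := R) p (d.rTensor M' _), ht0, smul_zero]
  obtain ⟨a, ha'⟩ := tensorSub_mono (infBoundaries_le d D h.left.sq p) le_rfl ha
  obtain ⟨b, hb'⟩ := tensorSub_mono le_rfl (infBoundaries_le d' D' h.right.sq q) hb
  have hab : t = a + (-1 : R) ^ p • b := mapIncl_injective (by
    rw [ht, map_add, map_smul, ha', hb'])
  have ha0 := h.rTensor_mkQ_eq_zero (ha' ▸ ha)
  have hb0 := h.lTensor_mkQ_eq_zero (hb' ▸ hb)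
  have e1 : tensorClass d D d' D' p q a = 0 := by
    have := congrArg ((infCycleBoundaries d' D' q).mkQ.lTensor _) ha0
    rw [map_zero, ← LinearMap.comp_apply, LinearMap.lTensor_comp_rTensor] at this
    exact this
  have e2 : tensorClass d D d' D' p q b = 0 := by
    have := congrArg ((infCycleBoundaries d D p).mkQ.rTensor _) hb0
    rw [map_zero, ← LinearMap.comp_apply, LinearMap.rTensor_comp_lTensor] at this
    exact this
  rw [hab, map_add, map_smul, e1, e2, smul_zero, add_zero]

theorem crossSum_injective (n : ℕ) : Function.Injective (h.crossSum n).hom := by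
  rw [injective_iff_map_eq_zero]
  intro z hz
  obtain ⟨w, rfl⟩ := tensorClassSum_surjective d D d' D' n z
  rw [h.crossSum_tensorClassSum] at hz
  obtain ⟨y, hy, hyw⟩ := (Submodule.Quotient.mk_eq_zero _).1 hz
  refine DFinsupp.ext fun pq => ?_
  refine h.tensorClass_eq_zero pq.2 hy ?_
  rw [← h.comp_sumCycles w pq, hyw]
  rfl

theorem crossSum_torMap (n : ℕ) : h.crossSum n ≫ h.torMap n = 0 := by
  refine ModuleCat.hom_ext (LinearMap.ext fun z => ?_)
  obtain ⟨w, rfl⟩ := tensorClassSum_surjective d D d' D' n z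
  change (h.torMap n).hom ((h.crossSum n).hom _) = 0
  rw [h.crossSum_tensorClassSum, h.torMap_mk]
  refine h.torCycleMap_eq n _ 0 fun pq => h.torPart_eq_zero pq.2 _ ?_
  -- The Tor term at `(p, q)` reads the component at `(p, q + 1)`. For a sum of tensors of cycles
  -- this component lies in `Z_p ⊗ Z'_{q+1}` and is killed by `1 ⊗ d'`.
  rw [h.comp_sumCycles w ⟨(pq.1.1, pq.1.2 + 1), by have := pq.2; omega⟩]
  generalize w _ = t
  refine tensorSub_le (S := LinearMap.ker (d'.lTensor M)) (fun x _ y hy => ?_)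
    (⟨t, rfl⟩ : TensorProduct.mapIncl _ _ t ∈ tensorSub _ _)
  rw [LinearMap.mem_ker, LinearMap.lTensor_tmul, LinearMap.mem_ker.1 hy.2, tmul_zero]

end IsInfTensor

end Infimum

/-! ### Exactness in the middle and surjectivity onto the Tor terms -/

section Infimum

variable {R : Type u} [CommRing R] {M M' M'' : Type u} [AddCommGroup M] [Module R M]
  [AddCommGroup M'] [Module R M'] [AddCommGroup M''] [Module R M'']

namespace IsInfTensor

variable {d : M →ₗ[R] M} {D : ℕ → Submodule R M} {d' : M' →ₗ[R] M'} {D' : ℕ → Submodule R M'}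
  {d'' : M'' →ₗ[R] M''} {D'' : ℕ → Submodule R M''} {m : M →ₗ[R] M' →ₗ[R] M''}
  {c : ℕ → ℕ → M'' →ₗ[R] M ⊗[R] M'} (h : IsInfTensor d D d' D' d'' D'' m c)

variable [Module.Free R M] [Module.Free R M']
  [∀ N : Submodule R M, Module.Free R N] [∀ N : Submodule R M', Module.Free R N]

include h

theorem rTensor_eq_zero_of_zero {B : Submodule R M'} {t : M ⊗[R] M'}
    (ht : t ∈ tensorSub (infChains d D 0) B) : d.rTensor M' t = 0 :=
  tensorSub_le (S := LinearMap.ker (d.rTensor M')) (fun x hx y _ => by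
    rw [LinearMap.mem_ker, LinearMap.rTensor_tmul, LinearMap.mem_ker.1 hx.2, zero_tmul]) ht

theorem lTensor_eq_zero_of_zero {A : Submodule R M} {t : M ⊗[R] M'}
    (ht : t ∈ tensorSub A (infChains d' D' 0)) : d'.lTensor M t = 0 :=
  tensorSub_le (S := LinearMap.ker (d'.lTensor M)) (fun x _ y hy => by
    rw [LinearMap.mem_ker, LinearMap.lTensor_tmul, LinearMap.mem_ker.1 hy.2, tmul_zero]) ht

/-- A cycle all of whose components are cycles in the second variable is a sum of tensors of
cycles. -/
theorem exists_sumCycles_eq {n : ℕ} (x : infCycles d'' D'' n)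
    (hx : ∀ p q, p + q + 1 = n → d'.lTensor M (c p (q + 1) x) = 0) :
    ∃ w : ⨁ pq, tensorCycles d D d' D' n pq,
      DirectSum.toModule R _ _ (fun pq => h.prodCycles pq.2) w = x := by
  classical
  have key : ∀ p q, p + q = n → c p q x ∈ tensorSub (infCycles d D p) (infCycles d' D' q) := by
    intro p q hpq
    have h0 := h.comp_mem_infChains hpq x.2.1
    refine mem_tensorSub_ker_inf d (mem_tensorSub_inf_ker d' h0 ?_) ?_
    · cases q with
      | zero => exact h.lTensor_eq_zero_of_zero h0
      | succ q => exact hx p q hpq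
    -- For `p + 1` the cycle condition expresses `d ⊗ 1` of the component through `1 ⊗ d'` of its
    -- neighbour, which vanishes by hypothesis.
    · cases p with
      | zero => exact h.rTensor_eq_zero_of_zero h0
      | succ p =>
        rw [eq_neg_of_add_eq_zero_left (h.rTensor_comp_add x.2 p q), hx p q (by omega), smul_zero,
          neg_zero]
  choose w hw using fun pq : {pq : ℕ × ℕ // pq.1 + pq.2 = n} => key _ _ pq.2
  let _ := Fintype.ofFinite {pq : ℕ × ℕ // pq.1 + pq.2 = n}
  refine ⟨(DirectSum.linearEquivFunOnFintype R _ (tensorCycles d D d' D' n)).symm w, ?_⟩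
  have hD : ∀ z : infCycles d'' D'' n, (z : M'') ∈ D'' n := fun z => infChains_le _ _ _ z.2.1
  refine Subtype.ext (h.ext_comp (hD _) (hD _) fun p q hpq => ?_)
  exact (h.comp_sumCycles _ ⟨(p, q), hpq⟩).trans (hw ⟨(p, q), hpq⟩)

/-- A cycle without Tor components is changed by a boundary so that `1 ⊗ d'` kills all its
components; it is then a sum of tensors of cycles. -/
theorem crossSum_torMap_exact (n : ℕ) (z : infHomologyModule d'' D'' n)
    (hz : (h.torMap n).hom z = 0) : ∃ y, (h.crossSum n).hom y = z := by
  obtain ⟨x, rfl⟩ := Submodule.Quotient.mk_surjective _ z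
  rw [h.torMap_mk] at hz
  have h0 : ∀ p q (hpq : p + q + 1 = n), h.torComp hpq x = 0 := by
    intro p q hpq
    rw [← h.torι_torPart hpq, ← h.torCycleMap_apply n x ⟨(p, q), hpq⟩, hz]
    exact map_zero _
  have h1 : ∀ pq : {pq : ℕ × ℕ // pq.1 + pq.2 + 1 = n},
      ∃ y ∈ tensorSub (infChains d D (pq.1.1 + 1)) (infChains d' D' (pq.1.2 + 1)),
        d'.lTensor M (c pq.1.1 (pq.1.2 + 1) x) = d'.lTensor M (d.rTensor M' y) := fun pq =>
    h.comp_eq_of_torComp_eq_zero pq.2 x (h0 _ _ pq.2)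
  choose y hy hyx using h1
  let _ := Fintype.ofFinite {pq : ℕ × ℕ // pq.1 + pq.2 + 1 = n}
  -- The `y pq` have the pairwise different bidegrees `(p + 1, q + 1)`, so each is a component of
  -- `Y`. By `comp_boundary`, `d'' Y` then has the same images under `1 ⊗ d'` as `x`.
  let Y : M'' := ∑ pq, TensorProduct.lift m (y pq)
  have hY : Y ∈ infChains d'' D'' (n + 1) :=
    Submodule.sum_mem _ fun pq _ => h.lift_mem_infChains (by have := pq.2; omega) (hy pq)
  have hYc : ∀ pq : {pq : ℕ × ℕ // pq.1 + pq.2 + 1 = n}, c (pq.1.1 + 1) (pq.1.2 + 1) Y = y pq := by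
    intro pq
    have hyD : ∀ pq, y pq ∈ tensorSub (D (pq.1.1 + 1)) (D' (pq.1.2 + 1)) := fun pq =>
      tensorSub_mono (infChains_le _ _ _) (infChains_le _ _ _) (hy pq)
    rw [map_sum, Finset.sum_eq_single_of_mem pq (Finset.mem_univ _)]
    · exact h.comp_lift (hyD pq)
    · intro pq' _ hne
      refine h.comp_lift_of_ne (fun e => hne (Subtype.ext (Prod.ext ?_ ?_))) (hyD pq')
      · simpa using congrArg Prod.fst e
      · simpa using congrArg Prod.snd e
  have hB : d'' Y ∈ infBoundaries d'' D'' n := ⟨Y, hY, rfl⟩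
  let b : infCycles d'' D'' n := ⟨d'' Y, infBoundaries_le d'' D'' h.sq n hB⟩
  obtain ⟨w, hw⟩ := h.exists_sumCycles_eq (x - b) fun p q hpq => by
    change d'.lTensor M (c p (q + 1) (x - d'' Y)) = 0
    rw [map_sub, map_sub, h.comp_boundary hY, hYc ⟨(p, q), hpq⟩, hyx ⟨(p, q), hpq⟩, sub_self]
  refine ⟨tensorClassSum d D d' D' n w, ?_⟩
  rw [h.crossSum_tensorClassSum, hw]
  refine (Submodule.Quotient.eq _).2 ?_
  rw [sub_sub_cancel_left]
  exact neg_mem hB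

/-- An element of Tor is represented by some `β` lying in both `Z_p ⊗ B'_q` and `B_p ⊗ Z'_q`.
Writing `β = (1 ⊗ d') u = (d ⊗ 1) v`, the chain `u - (-1)^p v` is a cycle with the prescribed Tor
component and no other. -/
theorem torMap_surjective (n : ℕ) : Function.Surjective (h.torMap n).hom := by
  classical
  have key : ∀ pq : {pq : ℕ × ℕ // pq.1 + pq.2 + 1 = n}, ∀ t : torTerm d D d' D' n pq,
      ∃ x, h.torCycleMap n x = DirectSum.lof R _ (fun pq => torTerm d D d' D' n pq) pq t := by
    rintro ⟨⟨p, q⟩, hpq⟩ t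
    simp only at hpq
    obtain ⟨w, hw⟩ := LinearMap.rTensor_surjective (infCycleBoundaries d' D' q)
      (infCycleBoundaries d D p).mkQ_surjective
      ((torι (infCycleBoundaries d' D' q) (infHomologyModule d D p)).hom t)
    set β := TensorProduct.map (infCycles d D p).subtype (infBoundaryι d' D' q) w with hβ
    have hβ1 : β ∈ tensorSub (infCycles d D p) ((infChains d' D' (q + 1)).map d') := by
      have : β ∈ LinearMap.range _ := ⟨w, rfl⟩
      rwa [h.range_map_boundaryι] at this
    -- The image of `torι` is the kernel of `H_p ⊗ B'_q → H_p ⊗ Z'_q`, so `w` becomes zero in `H_p ⊗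
    -- Z'_q` and its image in `Z_p ⊗ Z'_q` comes from `B_p ⊗ Z'_q`.
    have hβ2 : β ∈ tensorSub ((infChains d D (p + 1)).map d) (infCycles d' D' q) := by
      have h1 : (infCycleBoundaries d D p).mkQ.rTensor _
          ((infCycleBoundaries d' D' q).subtype.lTensor _ w) = 0 := by
        rw [rTensor_lTensor_comm, hw]
        exact (range_torι (infCycleBoundaries d' D' q) (infHomologyModule d D p)).le ⟨t, rfl⟩
      obtain ⟨s, hs⟩ := (rTensor_exact (infCycles d' D' q)
        (LinearMap.exact_subtype_mkQ (infCycleBoundaries d D p))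
        (infCycleBoundaries d D p).mkQ_surjective _).1 h1
      have h2 : β = TensorProduct.map (infBoundaryι d D p) (infCycles d' D' q).subtype s := by
        have e1 : β = TensorProduct.mapIncl _ _
            ((infCycleBoundaries d' D' q).subtype.lTensor _ w) := by
          rw [hβ, TensorProduct.mapIncl, ← LinearMap.comp_apply, LinearMap.map_comp_lTensor]
        rw [e1, ← hs, TensorProduct.mapIncl, ← LinearMap.comp_apply, LinearMap.map_comp_rTensor]
      have h3 : β ∈ LinearMap.range (TensorProduct.map (infBoundaryι d D p)
          (infCycles d' D' q).subtype) := ⟨s, h2.symm⟩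
      rwa [TensorProduct.range_map, h.left.range_boundaryι, Submodule.range_subtype,
        ← TensorProduct.range_mapIncl] at h3
    obtain ⟨u, hu, hud⟩ := exists_lTensor_eq d' hβ1
    obtain ⟨v, hv, hvd⟩ := exists_rTensor_eq d hβ2
    have hu0 : d.rTensor M' u = 0 :=
      tensorSub_le (S := LinearMap.ker (d.rTensor M')) (fun x hx y _ => by
        rw [LinearMap.mem_ker, LinearMap.rTensor_tmul, LinearMap.mem_ker.1 hx.2, zero_tmul]) hu
    have hv0 : d'.lTensor M v = 0 :=
      tensorSub_le (S := LinearMap.ker (d'.lTensor M)) (fun x _ y hy => by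
        rw [LinearMap.mem_ker, LinearMap.lTensor_tmul, LinearMap.mem_ker.1 hy.2, tmul_zero]) hv
    have huC : u ∈ tensorSub (infChains d D p) (infChains d' D' (q + 1)) :=
      tensorSub_mono inf_le_left le_rfl hu
    have hvC : v ∈ tensorSub (infChains d D (p + 1)) (infChains d' D' q) :=
      tensorSub_mono le_rfl inf_le_left hv
    have huD : u ∈ tensorSub (D p) (D' (q + 1)) :=
      tensorSub_mono (infChains_le _ _ _) (infChains_le _ _ _) huC
    have hvD : v ∈ tensorSub (D (p + 1)) (D' q) :=
      tensorSub_mono (infChains_le _ _ _) (infChains_le _ _ _) hvC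
    -- The sign makes the two contributions `(-1)^p β` to `d'' X` cancel; `(d ⊗ 1) u` and `(1 ⊗ d')
    -- v` vanish.
    let X : M'' := TensorProduct.lift m u - (-1 : R) ^ p • TensorProduct.lift m v
    have hX : X ∈ infCycles d'' D'' n := by
      refine ⟨sub_mem (h.lift_mem_infChains (p := p) (q := q + 1) hpq huC)
        (Submodule.smul_mem _ _ (h.lift_mem_infChains (by omega) hvC)), ?_⟩
      change d'' X = 0
      rw [map_sub, map_smul, h.d_lift (tensorSub_mono le_rfl le_top huD),
        h.d_lift (tensorSub_mono le_rfl le_top hvD), hu0, hv0, hud, hvd]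
      simp
    refine ⟨⟨X, hX⟩, h.torCycleMap_eq n _ _ ?_⟩
    rintro ⟨⟨p', q'⟩, hpq'⟩
    simp only at hpq'
    by_cases he : p = p'
    · obtain rfl := he
      obtain rfl : q = q' := by omega
      refine Eq.trans (h.torPart_eq hpq _ (w := w) (t := t) ?_ hw.symm)
        (DirectSum.of_eq_same (β := fun pq => torTerm d D d' D' n pq) ⟨(p, q), hpq⟩ t).symm
      rw [← hβ, map_sub, map_smul, h.comp_lift huD, h.comp_lift_of_ne (by simp) hvD, smul_zero,
        sub_zero, hud]
    · refine Eq.trans (h.torPart_eq_zero hpq' _ ?_)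
        (DirectSum.of_eq_of_ne (β := fun pq => torTerm d D d' D' n pq) ⟨(p, q), hpq⟩
          ⟨(p', q'), hpq'⟩ t (fun e => he ?_)).symm
      · rw [map_sub, map_smul, h.comp_lift_of_ne (by simp [he]) huD, zero_sub, map_neg, map_smul]
        -- `v` has bidegree `(p + 1, q)`, which the Tor term at `(p + 1, q - 1)` does read when `q >
        -- 0`; there `1 ⊗ d'` kills it.
        by_cases he' : (p + 1, q) = (p', q' + 1)
        · obtain ⟨rfl, rfl⟩ := Prod.mk.inj he'
          rw [h.comp_lift hvD, hv0, smul_zero, neg_zero]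
        · rw [h.comp_lift_of_ne he' hvD, map_zero, smul_zero, neg_zero]
      · simpa using (congrArg (fun pq => pq.1.1) e).symm
  have hr : LinearMap.range (h.torCycleMap n) = ⊤ := by
    refine eq_top_iff.2 fun z _ => ?_
    induction z using DirectSum.induction_on with
    | zero => exact zero_mem _
    | of pq t => exact key pq t
    | add s t hs ht => exact add_mem (hs trivial) (ht trivial)
  intro z
  obtain ⟨x, hx⟩ := LinearMap.range_eq_top.1 hr z
  exact ⟨Submodule.Quotient.mk x, hx⟩

/-- The Künneth sequence is short exact. -/
theorem isShortExact (n : ℕ) : (Row.mk (h.crossSum n) (h.torMap n)).IsShortExact :=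
  ⟨h.crossSum_torMap n,
    { exact := (ShortComplex.moduleCat_exact_iff _).2 (h.crossSum_torMap_exact n)
      mono_f := (ModuleCat.mono_iff_injective _).2 (h.crossSum_injective n)
      epi_g := (ModuleCat.epi_iff_surjective _).2 (h.torMap_surjective n) }⟩

end IsInfTensor

end Infimum

/-! ### Naturality of the Künneth sequence -/

section Infimum

variable {R : Type u} [CommRing R] {M M' M'' N N' N'' : Type u} [AddCommGroup M] [Module R M]
  [AddCommGroup M'] [Module R M'] [AddCommGroup M''] [Module R M'']
  [AddCommGroup N] [Module R N] [AddCommGroup N'] [Module R N'] [AddCommGroup N''] [Module R N'']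

/-- The map induced in homology, as a morphism of modules. -/
noncomputable abbrev infHomologyMap {d : M →ₗ[R] M} {D : ℕ → Submodule R M} {e : N →ₗ[R] N}
    {E : ℕ → Submodule R N} {f : M →ₗ[R] N} (hd : ∀ x, e (f x) = f (d x))
    (hD : ∀ k, ∀ x ∈ D k, f x ∈ E k) (k : ℕ) : infHomologyModule d D k ⟶ infHomologyModule e E k :=
  ModuleCat.ofHom (InfHomology.map f hd hD k)

namespace IsInfTensor

variable {d : M →ₗ[R] M} {D : ℕ → Submodule R M} {d' : M' →ₗ[R] M'} {D' : ℕ → Submodule R M'}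
  {d'' : M'' →ₗ[R] M''} {D'' : ℕ → Submodule R M''} {m : M →ₗ[R] M' →ₗ[R] M''}
  {c : ℕ → ℕ → M'' →ₗ[R] M ⊗[R] M'} (h : IsInfTensor d D d' D' d'' D'' m c)
  {e : N →ₗ[R] N} {E : ℕ → Submodule R N} {e' : N' →ₗ[R] N'} {E' : ℕ → Submodule R N'}
  {e'' : N'' →ₗ[R] N''} {E'' : ℕ → Submodule R N''} {m₁ : N →ₗ[R] N' →ₗ[R] N''}
  {c₁ : ℕ → ℕ → N'' →ₗ[R] N ⊗[R] N'} (h₁ : IsInfTensor e E e' E' e'' E'' m₁ c₁)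
  {f : M →ₗ[R] N} (hd : ∀ x, e (f x) = f (d x)) (hD : ∀ k, ∀ x ∈ D k, f x ∈ E k)
  {f' : M' →ₗ[R] N'} (hd' : ∀ x, e' (f' x) = f' (d' x)) (hD' : ∀ k, ∀ x ∈ D' k, f' x ∈ E' k)
  {f'' : M'' →ₗ[R] N''} (hd'' : ∀ x, e'' (f'' x) = f'' (d'' x))
  (hD'' : ∀ k, ∀ x ∈ D'' k, f'' x ∈ E'' k) (hm : ∀ x y, f'' (m x y) = m₁ (f x) (f' y))

-- Multiplicativity determines `f''` on products, and these generate `D'' n`.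
include h h₁ hD hD' hm in
theorem comp_map {n p q : ℕ} {x : M''} (hx : x ∈ D'' n) :
    c₁ p q (f'' x) = TensorProduct.map f f' (c p q x) := by
  refine h.le_of n (LinearMap.eqLocus (c₁ p q ∘ₗ f'') (TensorProduct.map f f' ∘ₗ c p q))
    (fun p' q' _ x hx y hy => ?_) hx
  rw [LinearMap.mem_eqLocus, LinearMap.comp_apply, LinearMap.comp_apply, hm]
  by_cases hpq : (p', q') = (p, q)
  · cases hpq
    rw [h₁.comp_mul p q _ (hD _ _ hx) _ (hD' _ _ hy), h.comp_mul p q x hx y hy,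
      TensorProduct.map_tmul]
  · rw [h₁.comp_mul_of_ne p' q' p q hpq _ (hD _ _ hx) _ (hD' _ _ hy),
      h.comp_mul_of_ne p' q' p q hpq x hx y hy, map_zero]

variable [Module.Free R M] [Module.Free R M']
  [∀ N : Submodule R M, Module.Free R N] [∀ N : Submodule R M', Module.Free R N]
  [Module.Free R N] [Module.Free R N']
  [∀ L : Submodule R N, Module.Free R L] [∀ L : Submodule R N', Module.Free R L]

theorem infBoundaries_map {k : ℕ} (x : infCycles d' D' k) (hx : x ∈ infCycleBoundaries d' D' k) :
    f'.restrict (infCycles_map f' hd' hD' k) x ∈ infCycleBoundaries e' E' k := by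
  obtain ⟨y, hy, hyx⟩ := hx
  exact ⟨f' y, infChains_map f' hd' hD' _ y hy, by rw [hd', hyx]; rfl⟩

-- The image under `f ⊗ f'` of the tensor representing a component of `x` represents the component
-- of `f'' x`, since no choices were made. Naturality of `torι` carries this over to Tor.
include hm in
theorem torPart_map {n p q : ℕ} (hpq : p + q + 1 = n) (x : infCycles d'' D'' n) :
    h₁.torPart hpq (f''.restrict (infCycles_map f'' hd'' hD'' n) x) =
      (((Tor (ModuleCat.{u} R) 1).map (infHomologyMap hd hD p)).app (infHomologyModule d' D' q) ≫
        ((Tor (ModuleCat.{u} R) 1).obj (infHomologyModule e E p)).map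
          (infHomologyMap hd' hD' q)).hom (h.torPart hpq x) := by
  refine h₁.torPart_eq hpq _ (w := TensorProduct.map (f.restrict (infCycles_map f hd hD p))
    ((f'.restrict (infCycles_map f' hd' hD' q)).restrict (infBoundaries_map hd' hD'))
      (h.boundaryComp hpq x)) ?_ ?_
  · change _ = e'.lTensor N (c₁ p (q + 1) (f'' x))
    rw [h.comp_map h₁ hD hD' hm (infChains_le _ _ _ x.2.1)]
    have e1 : e'.lTensor N ∘ₗ TensorProduct.map f f' = TensorProduct.map f f' ∘ₗ d'.lTensor M :=
      TensorProduct.ext' fun x y => by simp [hd']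
    refine Eq.trans ?_ (LinearMap.congr_fun e1 (c p (q + 1) x)).symm
    rw [LinearMap.comp_apply, ← h.map_boundaryComp hpq]
    generalize h.boundaryComp hpq x = t
    have e3 : TensorProduct.map (infCycles e E p).subtype (infBoundaryι e' E' q) ∘ₗ
        TensorProduct.map (f.restrict (infCycles_map f hd hD p))
          ((f'.restrict (infCycles_map f' hd' hD' q)).restrict (infBoundaries_map hd' hD')) =
        TensorProduct.map f f' ∘ₗ
          TensorProduct.map (infCycles d D p).subtype (infBoundaryι d' D' q) :=
      TensorProduct.ext' fun _ _ => rfl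
    exact LinearMap.congr_fun e3 t
  · have e2 := torι_naturality (infCycleBoundaries e' E' q) (infHomologyMap hd hD p)
      (f'.restrict (infCycles_map f' hd' hD' q)) (infBoundaries_map hd' hD')
    refine (LinearMap.congr_fun (congrArg ModuleCat.Hom.hom e2) (h.torPart hpq x)).trans ?_
    change TensorProduct.map (InfHomology.map f hd hD p) _ ((torι _ _).hom (h.torPart hpq x)) = _
    rw [h.torι_torPart, torComp, LinearMap.comp_apply]
    generalize h.boundaryComp hpq x = t
    have e3 : TensorProduct.map (InfHomology.map f hd hD p)
          ((f'.restrict (infCycles_map f' hd' hD' q)).restrict (infBoundaries_map hd' hD')) ∘ₗ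
        (infCycleBoundaries d D p).mkQ.rTensor _ =
        (infCycleBoundaries e E p).mkQ.rTensor _ ∘ₗ
          TensorProduct.map (f.restrict (infCycles_map f hd hD p))
            ((f'.restrict (infCycles_map f' hd' hD' q)).restrict (infBoundaries_map hd' hD')) :=
      TensorProduct.ext' fun _ _ => rfl
    exact LinearMap.congr_fun e3 t

include hm in
theorem torMap_naturality (n : ℕ) :
    h.torMap n ≫ torSumMap (infHomologyMap hd hD) (infHomologyMap hd' hD') n =
      infHomologyMap hd'' hD'' n ≫ h₁.torMap n := by
  refine ModuleCat.hom_ext (LinearMap.ext fun z => ?_)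
  obtain ⟨x, rfl⟩ := Submodule.Quotient.mk_surjective _ z
  refine (h₁.torCycleMap_eq n (f''.restrict (infCycles_map f'' hd'' hD'' n) x)
    ((torSumMap (infHomologyMap hd hD) (infHomologyMap hd' hD') n).hom (h.torCycleMap n x))
    fun pq => ?_).symm
  refine (h.torPart_map h₁ hd hD hd' hD' hd'' hD'' hm pq.2 x).trans ?_
  rw [← h.torCycleMap_apply n x pq]
  exact (DirectSum.lmap_apply (fun pq : {pq : ℕ × ℕ // pq.1 + pq.2 + 1 = n} =>
    (((Tor (ModuleCat.{u} R) 1).map (infHomologyMap hd hD pq.1.1)).app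
      (infHomologyModule d' D' pq.1.2) ≫ ((Tor (ModuleCat.{u} R) 1).obj
        (infHomologyModule e E pq.1.1)).map (infHomologyMap hd' hD' pq.1.2)).hom)
          (h.torCycleMap n x) pq).symm

include hm in
theorem crossSum_naturality (n : ℕ) :
    h.crossSum n ≫ infHomologyMap hd'' hD'' n =
      tensorSumMap (infHomologyMap hd hD) (infHomologyMap hd' hD') n ≫ h₁.crossSum n := by
  refine ModuleCat.hom_ext (DirectSum.linearMap_ext R fun pq => LinearMap.ext fun t => ?_)
  obtain ⟨t, rfl⟩ := TensorProduct.map_surjective (Submodule.mkQ_surjective _)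
    (Submodule.mkQ_surjective _) t
  refine (congrArg _ (h.crossSum_lof pq t)).trans (Eq.trans ?_ ((congrArg (h₁.crossSum n).hom
    (DirectSum.lmap_lof (fun pq : {pq : ℕ × ℕ // pq.1 + pq.2 = n} => TensorProduct.map
      (InfHomology.map f hd hD pq.1.1) (InfHomology.map f' hd' hD' pq.1.2)) pq
        (tensorClass d D d' D' pq.1.1 pq.1.2 t))).symm))
  have e1 : TensorProduct.map (InfHomology.map f hd hD pq.1.1)
      (InfHomology.map f' hd' hD' pq.1.2) ∘ₗ
      tensorClass d D d' D' pq.1.1 pq.1.2 =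
      tensorClass e E e' E' pq.1.1 pq.1.2 ∘ₗ
        TensorProduct.map (f.restrict (infCycles_map f hd hD _))
          (f'.restrict (infCycles_map f' hd' hD' _)) := TensorProduct.ext' fun _ _ => rfl
  have e2 : f''.restrict (infCycles_map f'' hd'' hD'' n) ∘ₗ h.prodCycles pq.2 =
      h₁.prodCycles pq.2 ∘ₗ TensorProduct.map (f.restrict (infCycles_map f hd hD _))
          (f'.restrict (infCycles_map f' hd' hD' _)) :=
    TensorProduct.ext' fun x y => Subtype.ext (hm x y)
  refine Eq.trans ?_ ((congrArg (fun t => (h₁.crossSum n).hom (DirectSum.lof R _ _ pq t))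
    (LinearMap.congr_fun e1 t)).trans (h₁.crossSum_lof pq _)).symm
  exact congrArg Submodule.Quotient.mk (LinearMap.congr_fun e2 t)

end IsInfTensor

end Infimum

/-! ### Free modules on graded bases and joins of basis elements -/

section Graded

variable {R : Type u} [CommRing R] {A A' A'' : Type u}

/-- The quotient is free on the complement of `s`. -/
instance flat_quotient_supported (s : Set A) :
    Module.Flat R ((A →₀ R) ⧸ Finsupp.supported R R s) := by
  have h1 : LinearMap.ker (Finsupp.lsubtypeDomain (sᶜ) : (A →₀ R) →ₗ[R] (sᶜ : Set A) →₀ R) =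
      Finsupp.supported R R s := by
    ext x
    rw [LinearMap.mem_ker, Finsupp.mem_supported', Finsupp.ext_iff]
    exact ⟨fun h a ha => h ⟨a, ha⟩, fun h a => h a a.2⟩
  have h2 : Function.Surjective
      (Finsupp.lsubtypeDomain (sᶜ) : (A →₀ R) →ₗ[R] (sᶜ : Set A) →₀ R) := by
    classical
    exact fun y => ⟨y.extendDomain, Finsupp.subtypeDomain_extendDomain y⟩
  rw [← h1]
  exact Module.Flat.of_linearEquiv (LinearMap.quotKerEquivOfSurjective _ h2)

open Classical in
/-- The part of degree `p` of a chain, for a grading `g` of the basis. -/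
noncomputable def degreePart (R : Type u) [CommRing R] (g : A → ℕ) (p : ℕ) :
    (A →₀ R) →ₗ[R] (A →₀ R) :=
  Finsupp.linearCombination R fun a => if g a = p then Finsupp.single a 1 else 0

theorem degreePart_single (g : A → ℕ) (a : A) :
    degreePart R g (g a) (Finsupp.single a 1) = Finsupp.single a 1 := by
  simp [degreePart]

theorem degreePart_single_of_ne (g : A → ℕ) {p : ℕ} {a : A} (h : g a ≠ p) :
    degreePart R g p (Finsupp.single a 1) = 0 := by
  simp [degreePart, h]

theorem degreePart_eq_self (g : A → ℕ) {p : ℕ} {x : A →₀ R}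
    (hx : x ∈ Finsupp.supported R R {a | g a = p}) : degreePart R g p x = x :=
  supported_map_mem (degreePart R g p - LinearMap.id) _ ⊥
    (fun a ha => by
      cases ha
      rw [Submodule.mem_bot, LinearMap.sub_apply, degreePart_single, LinearMap.id_apply, sub_self])
    x hx |> sub_eq_zero.1

theorem degreePart_eq_zero (g : A → ℕ) {p p' : ℕ} (hne : p' ≠ p) {x : A →₀ R}
    (hx : x ∈ Finsupp.supported R R {a | g a = p'}) : degreePart R g p x = 0 :=
  supported_map_mem (degreePart R g p) _ ⊥
    (fun a ha => degreePart_single_of_ne g (by rintro rfl; exact hne ha.symm)) x hx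

/-- The differential lowers the degree by one. -/
structure IsGradedBoundary (g : A → ℕ) (d : (A →₀ R) →ₗ[R] (A →₀ R)) : Prop where
  sq : ∀ x, d (d x) = 0
  zero : ∀ a, g a = 0 → d (Finsupp.single a 1) = 0
  succ : ∀ k a, g a = k + 1 → d (Finsupp.single a 1) ∈ Finsupp.supported R R {a | g a = k}

namespace IsGradedBoundary

variable {g : A → ℕ} {d : (A →₀ R) →ₗ[R] (A →₀ R)} (h : IsGradedBoundary g d)

include h

theorem degreePart_comm (p : ℕ) (x : A →₀ R) :
    degreePart R g p (d x) = d (degreePart R g (p + 1) x) := by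
  have : degreePart R g p ∘ₗ d = d ∘ₗ degreePart R g (p + 1) := by
    refine Finsupp.lhom_ext' fun a => LinearMap.ext_ring ?_
    change degreePart R g p (d (Finsupp.single a 1)) =
      d (degreePart R g (p + 1) (Finsupp.single a 1))
    rcases hk : g a with _ | k
    · rw [h.zero a hk, degreePart_single_of_ne g (by omega), map_zero, map_zero]
    · by_cases hp : k = p
      · rw [degreePart_eq_self g (hp ▸ h.succ k a hk), ← hp, ← hk, degreePart_single]
      · rw [degreePart_eq_zero g hp (h.succ k a hk), degreePart_single_of_ne g (by omega), map_zero]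
  exact LinearMap.congr_fun this x

theorem isFlatGraded {s : ℕ → Set A} (hs : ∀ k, ∀ a ∈ s k, g a = k) :
    IsFlatGraded d fun k => Finsupp.supported R R (s k) where
  sq := h.sq
  zero x hx := supported_map_mem d _ ⊥ (fun a ha => h.zero a (hs 0 a ha)) x hx
  flat _ := inferInstance

end IsGradedBoundary

/-- The `(p, q)`-component of a chain on joins `j a b`, as a tensor of chains. -/
noncomputable def joinComp (R : Type u) [CommRing R] (g : A → ℕ) (g' : A' → ℕ) (j : A → A' → A'')
    (p q : ℕ) : (A'' →₀ R) →ₗ[R] (A →₀ R) ⊗[R] (A' →₀ R) :=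
  -- Basis elements of `A''` that are not joins get the default value `0`; they do not occur in the
  -- modules considered.
  Finsupp.linearCombination R (Function.extend (fun x : A × A' => j x.1 x.2) (fun x =>
    degreePart R g p (Finsupp.single x.1 1) ⊗ₜ degreePart R g' q (Finsupp.single x.2 1)) 0)

variable {g : A → ℕ} {g' : A' → ℕ} {j : A → A' → A''}
  {m : (A →₀ R) →ₗ[R] (A' →₀ R) →ₗ[R] (A'' →₀ R)}

theorem joinComp_mul (hj : Function.Injective fun x : A × A' => j x.1 x.2)
    (hm : ∀ a b, m (Finsupp.single a 1) (Finsupp.single b 1) = Finsupp.single (j a b) 1)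
    (p q : ℕ) (x : A →₀ R) (y : A' →₀ R) :
    joinComp R g g' j p q (m x y) = degreePart R g p x ⊗ₜ degreePart R g' q y := by
  have : m.compr₂ (joinComp R g g' j p q) =
      (TensorProduct.mk R _ _).compl₁₂ (degreePart R g p) (degreePart R g' q) := by
    refine Finsupp.lhom_ext' fun a => LinearMap.ext_ring ?_
    refine Finsupp.lhom_ext' fun b => LinearMap.ext_ring ?_
    change joinComp R g g' j p q (m (Finsupp.single a 1) (Finsupp.single b 1)) =
      degreePart R g p (Finsupp.single a 1) ⊗ₜ degreePart R g' q (Finsupp.single b 1)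
    rw [hm, joinComp, Finsupp.linearCombination_single, one_smul]
    exact hj.extend_apply _ _ (a, b)
  exact LinearMap.congr_fun (LinearMap.congr_fun this x) y

/-- Two combinatorial facts suffice: a join determines its two factors (`hj`), and each generator in
index `n` is a join of generators whose indices add up to `n` (`hs''`). -/
theorem isInfTensor_join {d : (A →₀ R) →ₗ[R] (A →₀ R)} {d' : (A' →₀ R) →ₗ[R] (A' →₀ R)}
    {d'' : (A'' →₀ R) →ₗ[R] (A'' →₀ R)} {s : ℕ → Set A} {s' : ℕ → Set A'} {s'' : ℕ → Set A''}
    (hd : IsGradedBoundary g d) (hd' : IsGradedBoundary g' d') (hd'' : ∀ x, d'' (d'' x) = 0)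
    (hs : ∀ k, ∀ a ∈ s k, g a = k) (hs' : ∀ k, ∀ a ∈ s' k, g' a = k)
    (hj : Function.Injective fun x : A × A' => j x.1 x.2)
    (hm : ∀ a b, m (Finsupp.single a 1) (Finsupp.single b 1) = Finsupp.single (j a b) 1)
    (hs'' : ∀ n, ∀ a ∈ s'' n, ∃ p q, p + q = n ∧ ∃ b ∈ s p, ∃ c ∈ s' q, a = j b c)
    (h : IsInfProduct d (fun k => Finsupp.supported R R (s k))
      d' (fun k => Finsupp.supported R R (s' k)) d'' (fun k => Finsupp.supported R R (s'' k)) m) :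
    IsInfTensor d (fun k => Finsupp.supported R R (s k))
      d' (fun k => Finsupp.supported R R (s' k)) d'' (fun k => Finsupp.supported R R (s'' k)) m
      (joinComp R g g' j) := by
  have hl : ∀ (n : ℕ) (S : Submodule R (A'' →₀ R)), (∀ p q, p + q = n →
      ∀ x ∈ Finsupp.supported R R (s p), ∀ y ∈ Finsupp.supported R R (s' q), m x y ∈ S) →
        Finsupp.supported R R (s'' n) ≤ S := by
    intro n S hS x hx
    refine supported_map_mem LinearMap.id _ S (fun a ha => ?_) x hx
    obtain ⟨p, q, hpq, b, hb, c, hc, rfl⟩ := hs'' n a ha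
    rw [LinearMap.id_apply, ← hm]
    exact hS p q hpq _ (Finsupp.single_mem_supported R _ hb) _ (Finsupp.single_mem_supported R _ hc)
  have hg : ∀ p, Finsupp.supported R R (s p) ≤ Finsupp.supported R R {a | g a = p} := fun p =>
    Finsupp.supported_mono (hs p)
  have hg' : ∀ p, Finsupp.supported R R (s' p) ≤ Finsupp.supported R R {a | g' a = p} := fun p =>
    Finsupp.supported_mono (hs' p)
  refine { h with
    left := hd.isFlatGraded hs
    right := hd'.isFlatGraded hs'
    sq := hd''
    le_of := hl
    comp_mul := fun p q x hx y hy => ?_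
    comp_mul_of_ne := fun p q p' q' hne x hx y hy => ?_
    comp_d := fun n x hx p q => ?_ }
  · rw [joinComp_mul hj hm, degreePart_eq_self g (hg p hx), degreePart_eq_self g' (hg' q hy)]
  · rw [joinComp_mul hj hm]
    by_cases hp : p = p'
    · have hq : q ≠ q' := fun hq => hne (by rw [hp, hq])
      rw [degreePart_eq_zero g' hq (hg' q hy), TensorProduct.tmul_zero]
    · rw [degreePart_eq_zero g hp (hg p hx), TensorProduct.zero_tmul]
  · refine hl n (LinearMap.eqLocus (joinComp R g g' j p q ∘ₗ d'')
      (d.rTensor _ ∘ₗ joinComp R g g' j (p + 1) q +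
        (-1 : R) ^ p • d'.lTensor _ ∘ₗ joinComp R g g' j p (q + 1))) (fun p' q' _ x hx y _ => ?_) hx
    rw [LinearMap.mem_eqLocus]
    change joinComp R g g' j p q (d'' (m x y)) = d.rTensor _ (joinComp R g g' j (p + 1) q (m x y)) +
      (-1 : R) ^ p • d'.lTensor _ (joinComp R g g' j p (q + 1) (m x y))
    rw [h.leibniz p' x hx y, map_add, map_smul, joinComp_mul hj hm, joinComp_mul hj hm,
      joinComp_mul hj hm, joinComp_mul hj hm, hd.degreePart_comm, hd'.degreePart_comm,
      LinearMap.rTensor_tmul, LinearMap.lTensor_tmul]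
    -- The two sides now differ only in the signs `(-1)^p'` and `(-1)^p`, and for `p' ≠ p` the part
    -- of `x` in index `p` is zero.
    by_cases hp : p' = p
    · rw [hp]
    · rw [degreePart_eq_zero g hp (hg p' hx), TensorProduct.zero_tmul, smul_zero,
        smul_zero]

end Graded

/-! ### Chains on joins of hyperdigraphs and hypergraphs as tensor products -/

section Chains

variable (R : Type u) [CommRing R] {V V' W X : Type u}

theorem isGradedBoundary_seqBoundary : IsGradedBoundary List.length (seqBoundary R (V := V)) where
  sq := seqBoundary_seqBoundary R
  zero l hl := by
    rw [List.length_eq_zero_iff.1 hl]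
    exact seqBoundary_nil R
  succ k l hl := by
    simp only [seqBoundary, Finsupp.linearCombination_single, one_smul]
    refine Submodule.sum_mem _ fun i hi => Finsupp.single_mem_supported R _ ?_
    change (l.eraseIdx i).length = k
    rw [List.length_eraseIdx_of_lt (Finset.mem_range.1 hi), hl]
    rfl

theorem isGradedBoundary_setBoundary [LinearOrder V] :
    IsGradedBoundary Finset.card (setBoundary R (V := V)) where
  sq := setBoundary_setBoundary R
  zero s hs := by
    rw [Finset.card_eq_zero.1 hs]
    exact setBoundary_empty R
  succ k s hs := by
    rw [setBoundary_single]
    refine Submodule.sum_mem _ fun v hv => Finsupp.single_mem_supported R _ ?_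
    change (s.erase v).card = k
    rw [Finset.card_erase_of_mem hv, hs]
    rfl

/-- The two factors are recovered by selecting the entries from `V` and from `V'`. -/
theorem seqJoin_index_injective : Function.Injective fun x : List V × List V' =>
    (x.1.map Sum.inlₗ ++ x.2.map Sum.inrₗ : List (V ⊕ₗ V')) := by
  rintro ⟨l, l'⟩ ⟨t, t'⟩ h
  have h1 : ∀ (l : List V) (l' : List V'), (l.map Sum.inlₗ ++ l'.map Sum.inrₗ).filterMap
      (fun v : V ⊕ₗ V' => (ofLex v).getLeft?) = l := fun l l' => by
    simp [List.filterMap_append, List.filterMap_map, Function.comp_def]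
  have h2 : ∀ (l : List V) (l' : List V'), (l.map Sum.inlₗ ++ l'.map Sum.inrₗ).filterMap
      (fun v : V ⊕ₗ V' => (ofLex v).getRight?) = l' := fun l l' => by
    simp [List.filterMap_append, List.filterMap_map, Function.comp_def]
  refine Prod.ext ?_ ?_
  · exact (h1 l l').symm.trans ((congrArg _ h).trans (h1 t t'))
  · exact (h2 l l').symm.trans ((congrArg _ h).trans (h2 t t'))

theorem joinSet_injective : Function.Injective fun x : Finset V × Finset V' =>
    FinHypergraph.joinSet x.1 x.2 := by
  rintro ⟨s, s'⟩ ⟨t, t'⟩ h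
  have h' : FinHypergraph.joinSet s s' = FinHypergraph.joinSet t t' := h
  refine Prod.ext (Finset.ext fun v => ?_) (Finset.ext fun v => ?_)
  · change v ∈ s ↔ v ∈ t
    rw [← FinHypergraph.inl_mem_joinSet (s' := s'), h', FinHypergraph.inl_mem_joinSet]
  · change v ∈ s' ↔ v ∈ t'
    rw [← FinHypergraph.inr_mem_joinSet (s := s), h', FinHypergraph.inr_mem_joinSet]

/-- The augmentation is essential: joining with the empty sequence produces the hyperedges of a
single factor, so all generators of the join become concatenations. -/
theorem Hyperdigraph.isInfTensor (H : Hyperdigraph V) (H' : Hyperdigraph V') :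
    IsInfTensor (seqBoundary R) (H.chains R) (seqBoundary R) (H'.chains R) (seqBoundary R)
      ((H.join H').chains R) (seqJoin R) (joinComp R List.length List.length
        fun (l : List V) (l' : List V') =>
          (l.map Sum.inlₗ ++ l'.map Sum.inrₗ : List (V ⊕ₗ V'))) := by
  refine isInfTensor_join (isGradedBoundary_seqBoundary R) (isGradedBoundary_seqBoundary R)
    (seqBoundary_seqBoundary R) (fun _ _ h => h.1) (fun _ _ h => h.1) seqJoin_index_injective
    (seqJoin_single R) (fun n m hm => ?_) (isInfProduct_join R H H')
  obtain ⟨rfl, rfl | ⟨l, hl, rfl⟩ | ⟨l', hl', rfl⟩ | ⟨l, hl, l', hl', rfl⟩⟩ := hm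
  · exact ⟨0, 0, rfl, [], ⟨rfl, Or.inl rfl⟩, [], ⟨rfl, Or.inl rfl⟩, rfl⟩
  · exact ⟨l.length, 0, by simp, l, ⟨rfl, Or.inr hl⟩, [], ⟨rfl, Or.inl rfl⟩, by simp⟩
  · exact ⟨0, l'.length, by simp, [], ⟨rfl, Or.inl rfl⟩, l', ⟨rfl, Or.inr hl'⟩, by simp⟩
  · exact ⟨l.length, l'.length, by simp, l, ⟨rfl, Or.inr hl⟩, l', ⟨rfl, Or.inr hl'⟩, rfl⟩

theorem FinHypergraph.isInfTensor [LinearOrder V] [LinearOrder V'] (H : FinHypergraph V)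
    (H' : FinHypergraph V') :
    IsInfTensor (setBoundary R) (H.chains R) (setBoundary R) (H'.chains R) (setBoundary R)
      ((H.join H').chains R) (setJoin R) (joinComp R Finset.card Finset.card
        (FinHypergraph.joinSet (V := V) (V' := V'))) := by
  refine isInfTensor_join (isGradedBoundary_setBoundary R) (isGradedBoundary_setBoundary R)
    (setBoundary_setBoundary R) (fun _ _ h => h.1) (fun _ _ h => h.1) joinSet_injective
    (setJoin_single R) (fun n m hm => ?_) (isInfProduct_join R H H')
  obtain ⟨rfl, rfl | ⟨s, hs, rfl⟩ | ⟨s', hs', rfl⟩ | ⟨s, hs, s', hs', rfl⟩⟩ := hm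
  · exact ⟨0, 0, rfl, ∅, ⟨rfl, Or.inl rfl⟩, ∅, ⟨rfl, Or.inl rfl⟩, by simp [joinSet]⟩
  · exact ⟨s.card, 0, by simp, s, ⟨rfl, Or.inr hs⟩, ∅, ⟨rfl, Or.inl rfl⟩, rfl⟩
  · exact ⟨0, s'.card, by simp, ∅, ⟨rfl, Or.inl rfl⟩, s', ⟨rfl, Or.inr hs'⟩, rfl⟩
  · exact ⟨s.card, s'.card, by simp, s, ⟨rfl, Or.inr hs⟩, s', ⟨rfl, Or.inr hs'⟩, rfl⟩

end Chains

/-! ### Compatibility of vertex maps, joins and projection on chains -/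

section Directed

variable (R : Type u) [CommRing R] {V V' W W' X : Type u}

theorem seqMap_id (x : List V →₀ R) : seqMap R id x = x := by
  simp [seqMap]

theorem seqMap_seqMap (f : V → W) (g : W → X) (x : List V →₀ R) :
    seqMap R g (seqMap R f x) = seqMap R (g ∘ f) x := by
  have : seqMap R g ∘ₗ seqMap R f = seqMap R (g ∘ f) := by
    refine Finsupp.lhom_ext' fun l => LinearMap.ext_ring ?_
    simp
  exact LinearMap.congr_fun this x

theorem seqMap_seqJoin (f : V → W) (f' : V' → W') (x : List V →₀ R) (y : List V' →₀ R) :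
    seqMap R (fun v : V ⊕ₗ V' => toLex (Sum.map f f' (ofLex v))) (seqJoin R x y) =
      seqJoin R (seqMap R f x) (seqMap R f' y) := by
  have : (seqJoin R).compr₂ (seqMap R (fun v : V ⊕ₗ V' => toLex (Sum.map f f' (ofLex v)))) =
      (seqJoin R).compl₁₂ (seqMap R f) (seqMap R f') := by
    refine Finsupp.lhom_ext' fun l => LinearMap.ext_ring ?_
    refine Finsupp.lhom_ext' fun l' => LinearMap.ext_ring ?_
    simp [Function.comp_def]
  exact LinearMap.congr_fun (LinearMap.congr_fun this x) y

end Directed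

section Undirected

variable (R : Type u) [CommRing R] {V V' W W' X : Type u} [LinearOrder V] [LinearOrder V']
  [LinearOrder W] [LinearOrder W'] [LinearOrder X]

/-- Prepending becomes exterior multiplication under `seqProj`, and `setMap` commutes with the
latter for any vertex map, monotone or not. -/
theorem setMap_seqProj (f : V → W) (x : List V →₀ R) :
    setMap R f (seqProj R x) = seqProj R (seqMap R f x) := by
  have : setMap R f ∘ₗ seqProj R = seqProj R ∘ₗ seqMap R f := by
    refine Finsupp.lhom_ext' fun l => LinearMap.ext_ring ?_
    change setMap R f (seqProj R (Finsupp.single l 1)) = seqProj R (seqMap R f (Finsupp.single l 1))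
    induction l with
    | nil => rw [seqProj_nil, setMap_empty, seqMap_single, List.map_nil, seqProj_nil]
    | cons a l ih =>
      rw [← seqCons_single, seqProj_cons, setMap_insert, ih, seqMap_single, seqCons_single,
        seqMap_single, List.map_cons, ← seqCons_single, seqProj_cons]
  exact LinearMap.congr_fun this x

theorem setMap_id (x : Finset V →₀ R) : setMap R id x = x := by
  have : setMap R id = LinearMap.id (M := Finset V →₀ R) := by
    refine Finsupp.lhom_ext' fun s => LinearMap.ext_ring ?_
    change setMap R id (Finsupp.single s 1) = Finsupp.single s 1
    induction s using finset_induction_min with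
    | h0 => rw [setMap_empty]
    | h a s h ih => rw [setMap_insert_min R id h, ih, id, setInsert_min R h]
  exact LinearMap.congr_fun this x

/-- `setMap` is `seqProj` of the mapped sorted sequence, so the sorting signs compose by
`setMap_seqProj`. -/
theorem setMap_setMap (f : V → W) (g : W → X) (x : Finset V →₀ R) :
    setMap R g (setMap R f x) = setMap R (g ∘ f) x := by
  have : setMap R g ∘ₗ setMap R f = setMap R (g ∘ f) := by
    refine Finsupp.lhom_ext' fun s => LinearMap.ext_ring ?_
    change setMap R g (setMap R f (Finsupp.single s 1)) = setMap R (g ∘ f) (Finsupp.single s 1)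
    rw [setMap_single, setMap_seqProj, setMap_single, seqMap_single, List.map_map]
  exact LinearMap.congr_fun this x

theorem joinSet_empty_empty : FinHypergraph.joinSet (∅ : Finset V) (∅ : Finset V') = ∅ := by
  simp [FinHypergraph.joinSet]

/-- Vertices are peeled off in increasing order, those of `V` first: inserting a vertex of `V'`
commutes with the join without a sign once the left set is empty. -/
theorem setMap_setJoin (f : V → W) (f' : V' → W') (x : Finset V →₀ R) (y : Finset V' →₀ R) :
    setMap R (fun v : V ⊕ₗ V' => toLex (Sum.map f f' (ofLex v))) (setJoin R x y) =
      setJoin R (setMap R f x) (setMap R f' y) := by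
  have : (setJoin R).compr₂ (setMap R (fun v : V ⊕ₗ V' => toLex (Sum.map f f' (ofLex v)))) =
      (setJoin R).compl₁₂ (setMap R f) (setMap R f') := by
    refine Finsupp.lhom_ext' fun s => LinearMap.ext_ring ?_
    refine Finsupp.lhom_ext' fun s' => LinearMap.ext_ring ?_
    change setMap R _ (setJoin R (Finsupp.single s 1) (Finsupp.single s' 1)) =
      setJoin R (setMap R f (Finsupp.single s 1)) (setMap R f' (Finsupp.single s' 1))
    induction s using finset_induction_min with
    | h0 =>
      rw [setMap_empty]
      induction s' using finset_induction_min with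
      | h0 => rw [setMap_empty, setJoin_single, setJoin_single, joinSet_empty_empty,
          joinSet_empty_empty, setMap_empty]
      | h b s' h ih => rw [← setInsert_min R h, setJoin_insert_right, setMap_insert, ih,
          setMap_insert, setJoin_insert_right]; rfl
    | h a s h ih => rw [← setInsert_min R h, setJoin_insert_left, setMap_insert, ih,
        setMap_insert, setJoin_insert_left]; rfl
  exact LinearMap.congr_fun (LinearMap.congr_fun this x) y

theorem seqProj_seqJoin (x : List V →₀ R) (y : List V' →₀ R) :
    seqProj R (seqJoin R x y) = setJoin R (seqProj R x) (seqProj R y) := by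
  have : (seqJoin R).compr₂ (seqProj R) =
      (setJoin R).compl₁₂ (seqProj R (V := V)) (seqProj R (V := V')) := by
    refine Finsupp.lhom_ext' fun l => LinearMap.ext_ring ?_
    refine Finsupp.lhom_ext' fun l' => LinearMap.ext_ring ?_
    change seqProj R (seqJoin R (Finsupp.single l 1) (Finsupp.single l' 1)) =
      setJoin R (seqProj R (Finsupp.single l 1)) (seqProj R (Finsupp.single l' 1))
    induction l with
    | nil =>
      rw [seqProj_nil, seqJoin_nil]
      induction l' with
      | nil => rw [seqProj_nil, setJoin_single, joinSet_empty_empty, seqMap_single, List.map_nil,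
          seqProj_nil]
      | cons b l' ih => rw [← seqCons_single, seqProj_cons, setJoin_insert_right, ← ih,
          seqMap_single, seqCons_single, seqMap_single, List.map_cons, ← seqCons_single,
          seqProj_cons]
    | cons a l ih => rw [← seqCons_single, seqJoin_cons, seqProj_cons, ih, seqProj_cons,
        setJoin_insert_left]
  exact LinearMap.congr_fun (LinearMap.congr_fun this x) y

end Undirected

/-! ### Functoriality of the tensor and Tor terms and of homology -/

section Sums

variable {R : Type u} [CommRing R] {A B A' B' A'' B'' : ℕ → ModuleCat.{u} R}

theorem tensorSumMap_id (A B : ℕ → ModuleCat.{u} R) (n : ℕ) :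
    tensorSumMap (fun k => 𝟙 (A k)) (fun k => 𝟙 (B k)) n = 𝟙 _ := by
  refine ModuleCat.hom_ext ?_
  refine Eq.trans ?_ (DirectSum.lmap_id (R := R)
    (M := fun pq : {pq : ℕ × ℕ // pq.1 + pq.2 = n} => A pq.1.1 ⊗[R] B pq.1.2))
  exact congrArg DirectSum.lmap (funext fun pq => TensorProduct.map_id)

theorem tensorSumMap_comp (f : ∀ k, A k ⟶ A' k) (g : ∀ k, B k ⟶ B' k) (f' : ∀ k, A' k ⟶ A'' k)
    (g' : ∀ k, B' k ⟶ B'' k) (n : ℕ) : tensorSumMap f g n ≫ tensorSumMap f' g' n =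
      tensorSumMap (fun k => f k ≫ f' k) (fun k => g k ≫ g' k) n := by
  refine ModuleCat.hom_ext ((DirectSum.lmap_comp _ _).symm.trans ?_)
  exact congrArg DirectSum.lmap (funext fun pq => (TensorProduct.map_comp _ _ _ _).symm)

theorem torSumMap_id (A B : ℕ → ModuleCat.{u} R) (n : ℕ) :
    torSumMap (fun k => 𝟙 (A k)) (fun k => 𝟙 (B k)) n = 𝟙 _ := by
  refine ModuleCat.hom_ext ?_
  refine Eq.trans ?_ (DirectSum.lmap_id (R := R)
    (M := fun pq : {pq : ℕ × ℕ // pq.1 + pq.2 + 1 = n} =>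
      ((Tor (ModuleCat.{u} R) 1).obj (A pq.1.1)).obj (B pq.1.2)))
  refine congrArg DirectSum.lmap (funext fun pq => ?_)
  beta_reduce
  rw [CategoryTheory.Functor.map_id, CategoryTheory.Functor.map_id, NatTrans.id_app,
    Category.comp_id]
  rfl

theorem torSumMap_comp (f : ∀ k, A k ⟶ A' k) (g : ∀ k, B k ⟶ B' k) (f' : ∀ k, A' k ⟶ A'' k)
    (g' : ∀ k, B' k ⟶ B'' k) (n : ℕ) : torSumMap f g n ≫ torSumMap f' g' n =
      torSumMap (fun k => f k ≫ f' k) (fun k => g k ≫ g' k) n := by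
  refine ModuleCat.hom_ext ((DirectSum.lmap_comp _ _).symm.trans ?_)
  refine congrArg DirectSum.lmap (funext fun pq => ?_)
  rw [← ModuleCat.hom_comp]
  refine congrArg ModuleCat.Hom.hom ?_
  rw [Functor.map_comp, Functor.map_comp, NatTrans.comp_app, Category.assoc, Category.assoc,
    NatTrans.naturality_assoc]

end Sums

section Functoriality

variable {R : Type u} [CommRing R]

theorem tensorSumMap_square {A B A₁ B₁ A₂ B₂ A₃ B₃ : ℕ → ModuleCat.{u} R}
    {f : ∀ k, A k ⟶ A₁ k} {g : ∀ k, B k ⟶ B₁ k} {f₁ : ∀ k, A₁ k ⟶ A₃ k} {g₁ : ∀ k, B₁ k ⟶ B₃ k}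
    {f₂ : ∀ k, A k ⟶ A₂ k} {g₂ : ∀ k, B k ⟶ B₂ k} {f₃ : ∀ k, A₂ k ⟶ A₃ k} {g₃ : ∀ k, B₂ k ⟶ B₃ k}
    (hf : ∀ k, f k ≫ f₁ k = f₂ k ≫ f₃ k) (hg : ∀ k, g k ≫ g₁ k = g₂ k ≫ g₃ k) (n : ℕ) :
    tensorSumMap f g n ≫ tensorSumMap f₁ g₁ n = tensorSumMap f₂ g₂ n ≫ tensorSumMap f₃ g₃ n := by
  rw [tensorSumMap_comp, tensorSumMap_comp, funext hf, funext hg]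

theorem torSumMap_square {A B A₁ B₁ A₂ B₂ A₃ B₃ : ℕ → ModuleCat.{u} R}
    {f : ∀ k, A k ⟶ A₁ k} {g : ∀ k, B k ⟶ B₁ k} {f₁ : ∀ k, A₁ k ⟶ A₃ k} {g₁ : ∀ k, B₁ k ⟶ B₃ k}
    {f₂ : ∀ k, A k ⟶ A₂ k} {g₂ : ∀ k, B k ⟶ B₂ k} {f₃ : ∀ k, A₂ k ⟶ A₃ k} {g₃ : ∀ k, B₂ k ⟶ B₃ k}
    (hf : ∀ k, f k ≫ f₁ k = f₂ k ≫ f₃ k) (hg : ∀ k, g k ≫ g₁ k = g₂ k ≫ g₃ k) (n : ℕ) :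
    torSumMap f g n ≫ torSumMap f₁ g₁ n = torSumMap f₂ g₂ n ≫ torSumMap f₃ g₃ n := by
  rw [torSumMap_comp, torSumMap_comp, funext hf, funext hg]

section

variable {M M₁ M₂ M₃ : Type u} [AddCommGroup M] [Module R M] [AddCommGroup M₁] [Module R M₁]
  [AddCommGroup M₂] [Module R M₂] [AddCommGroup M₃] [Module R M₃]
  {d : M →ₗ[R] M} {D : ℕ → Submodule R M} {d₁ : M₁ →ₗ[R] M₁} {D₁ : ℕ → Submodule R M₁}
  {d₂ : M₂ →ₗ[R] M₂} {D₂ : ℕ → Submodule R M₂} {d₃ : M₃ →ₗ[R] M₃} {D₃ : ℕ → Submodule R M₃}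

theorem infHomologyMap_id {f : M →ₗ[R] M} (hd : ∀ x, d (f x) = f (d x))
    (hD : ∀ k, ∀ x ∈ D k, f x ∈ D k) (h : ∀ x, f x = x) (k : ℕ) :
    infHomologyMap hd hD k = 𝟙 _ := by
  obtain rfl : f = LinearMap.id := LinearMap.ext h
  exact ModuleCat.hom_ext (Submodule.linearMap_qext _ (LinearMap.ext fun _ => rfl))

theorem infHomologyMap_comp {f : M →ₗ[R] M₁} {g : M₁ →ₗ[R] M₂} {e : M →ₗ[R] M₂}
    (hd : ∀ x, d₁ (f x) = f (d x)) (hD : ∀ k, ∀ x ∈ D k, f x ∈ D₁ k)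
    (hd₁ : ∀ x, d₂ (g x) = g (d₁ x)) (hD₁ : ∀ k, ∀ x ∈ D₁ k, g x ∈ D₂ k)
    (hd₂ : ∀ x, d₂ (e x) = e (d x)) (hD₂ : ∀ k, ∀ x ∈ D k, e x ∈ D₂ k)
    (h : ∀ x, g (f x) = e x) (k : ℕ) :
    infHomologyMap hd hD k ≫ infHomologyMap hd₁ hD₁ k = infHomologyMap hd₂ hD₂ k := by
  obtain rfl : g ∘ₗ f = e := LinearMap.ext h
  exact ModuleCat.hom_ext (Submodule.linearMap_qext _ (LinearMap.ext fun _ => rfl))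

theorem infHomologyMap_square {f : M →ₗ[R] M₁} {f₁ : M₁ →ₗ[R] M₃} {f₂ : M →ₗ[R] M₂}
    {f₃ : M₂ →ₗ[R] M₃}
    (hd : ∀ x, d₁ (f x) = f (d x)) (hD : ∀ k, ∀ x ∈ D k, f x ∈ D₁ k)
    (hd₁ : ∀ x, d₃ (f₁ x) = f₁ (d₁ x)) (hD₁ : ∀ k, ∀ x ∈ D₁ k, f₁ x ∈ D₃ k)
    (hd₂ : ∀ x, d₂ (f₂ x) = f₂ (d x)) (hD₂ : ∀ k, ∀ x ∈ D k, f₂ x ∈ D₂ k)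
    (hd₃ : ∀ x, d₃ (f₃ x) = f₃ (d₂ x)) (hD₃ : ∀ k, ∀ x ∈ D₂ k, f₃ x ∈ D₃ k)
    (h : ∀ x, f₁ (f x) = f₃ (f₂ x)) (k : ℕ) :
    infHomologyMap hd hD k ≫ infHomologyMap hd₁ hD₁ k =
      infHomologyMap hd₂ hD₂ k ≫ infHomologyMap hd₃ hD₃ k :=
  ModuleCat.hom_ext (Submodule.linearMap_qext _ (LinearMap.ext fun x =>
    congrArg Submodule.Quotient.mk (Subtype.ext (h x))))

end

theorem joinMap_id {V V' : Type u} (v : V ⊕ₗ V') :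
    toLex (Sum.map id id (ofLex v)) = v := by
  rcases v with v | v <;> rfl

theorem joinMap_comp {V V' W W' X X' : Type u} (f : V → W) (f' : V' → W') (g : W → X)
    (g' : W' → X') (v : V ⊕ₗ V') :
    toLex (Sum.map g g' (ofLex (toLex (Sum.map f f' (ofLex v))))) =
      toLex (Sum.map (g ∘ f) (g' ∘ f') (ofLex v)) := by
  rcases v with v | v <;> rfl

end Functoriality

/-! ### The Künneth rows and the arrows of the diagram -/

section Rows

/-- Supplies the freeness assumed in the abstract Künneth argument; this is how the principal ideal
domain hypothesis enters it. -/
instance free_submodule_finsupp {R A : Type u} [CommRing R] [IsDomain R] [IsPrincipalIdealRing R]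
    (N : Submodule R (A →₀ R)) : Module.Free R N :=
  Finsupp.free_submodule N

variable (R : Type u) [CommRing R] [IsDomain R] [IsPrincipalIdealRing R]

/-- The maps to the `Tor` terms for hyperdigraphs. -/
noncomputable def directedTorMaps : DirectedTorMaps R :=
  fun _ _ H H' n => (H.isInfTensor R H').torMap n

/-- The maps to the `Tor` terms for hypergraphs. -/
noncomputable def undirectedTorMaps : UndirectedTorMaps R :=
  fun _ _ _ _ H H' n => (H.isInfTensor R H').torMap n

variable {V V' W W' X X' : Type u}

namespace Hyperdigraph

variable {H : Hyperdigraph V} {H' : Hyperdigraph V'} {G : Hyperdigraph W} {G' : Hyperdigraph W'}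
  {F : Hyperdigraph X} {F' : Hyperdigraph X'}

theorem KU_isShortExact (H : Hyperdigraph V) (H' : Hyperdigraph V') (n : ℕ) :
    (H.KU (directedTorMaps R) H' n).IsShortExact :=
  (H.isInfTensor R H').isShortExact n

theorem KUMap_isMorphism (φ : H.Hom G) (φ' : H'.Hom G') (n : ℕ) :
    (KUMap (directedTorMaps R) φ φ' n).IsMorphism :=
  ⟨(H.isInfTensor R H').crossSum_naturality (G.isInfTensor R G') (seqBoundary_seqMap R φ.toFun)
    (seqMap_mem R φ) (seqBoundary_seqMap R φ'.toFun) (seqMap_mem R φ')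
    (seqBoundary_seqMap R (φ.join φ').toFun) (seqMap_mem R (φ.join φ'))
    (seqMap_seqJoin R φ.toFun φ'.toFun) n,
  (H.isInfTensor R H').torMap_naturality (G.isInfTensor R G') (seqBoundary_seqMap R φ.toFun)
    (seqMap_mem R φ) (seqBoundary_seqMap R φ'.toFun) (seqMap_mem R φ')
    (seqBoundary_seqMap R (φ.join φ').toFun) (seqMap_mem R (φ.join φ'))
    (seqMap_seqJoin R φ.toFun φ'.toFun) n⟩

theorem homologyMap_eq_id (φ : H.Hom H) (h : ∀ v, φ.toFun v = v) (k : ℕ) :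
    φ.homologyMap R k = 𝟙 _ :=
  infHomologyMap_id _ _ (by rw [show φ.toFun = id from funext h]; exact seqMap_id R) k

theorem homologyMap_comp (φ : H.Hom G) (ψ : G.Hom F) (χ : H.Hom F)
    (h : ∀ v, ψ.toFun (φ.toFun v) = χ.toFun v) (k : ℕ) :
    φ.homologyMap R k ≫ ψ.homologyMap R k = χ.homologyMap R k :=
  infHomologyMap_comp _ _ _ _ _ _ (by
    rw [← show ψ.toFun ∘ φ.toFun = χ.toFun from funext h]
    exact seqMap_seqMap R _ _) k

theorem KUMap_eq_id (τ : DirectedTorMaps R) (φ : H.Hom H) (φ' : H'.Hom H')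
    (h : ∀ v, φ.toFun v = v) (h' : ∀ v, φ'.toFun v = v) (n : ℕ) :
    KUMap τ φ φ' n = RowMaps.id _ := by
  refine RowMaps.ext ?_ (homologyMap_eq_id R (φ.join φ') (fun v => ?_) n) ?_
  · refine Eq.trans ?_ (tensorSumMap_id (H.homology R) (H'.homology R) n)
    exact congrArg₂ (fun f g => tensorSumMap f g n) (funext (homologyMap_eq_id R φ h))
      (funext (homologyMap_eq_id R φ' h'))
  · change toLex (Sum.map φ.toFun φ'.toFun (ofLex v)) = v
    rw [show φ.toFun = id from funext h, show φ'.toFun = id from funext h', joinMap_id]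
  · refine Eq.trans ?_ (torSumMap_id (H.homology R) (H'.homology R) n)
    exact congrArg₂ (fun f g => torSumMap f g n) (funext (homologyMap_eq_id R φ h))
      (funext (homologyMap_eq_id R φ' h'))

/-- The induced maps depend only on vertex maps, so `χ` may be any morphism with the composite
vertex map. Functoriality and the squares of inclusions are both instances. -/
theorem KUMap_comp (τ : DirectedTorMaps R) (φ : H.Hom G) (φ' : H'.Hom G') (ψ : G.Hom F)
    (ψ' : G'.Hom F') (χ : H.Hom F) (χ' : H'.Hom F') (h : ∀ v, ψ.toFun (φ.toFun v) = χ.toFun v)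
    (h' : ∀ v, ψ'.toFun (φ'.toFun v) = χ'.toFun v) (n : ℕ) :
    (KUMap τ φ φ' n).comp (KUMap τ ψ ψ' n) = KUMap τ χ χ' n := by
  refine RowMaps.ext ?_
    (homologyMap_comp R (φ.join φ') (ψ.join ψ') (χ.join χ') (fun v => ?_) n) ?_
  · refine (tensorSumMap_comp (φ.homologyMap R) (φ'.homologyMap R) (ψ.homologyMap R)
      (ψ'.homologyMap R) n).trans ?_
    exact congrArg₂ (fun f g => tensorSumMap f g n) (funext (homologyMap_comp R φ ψ χ h))
      (funext (homologyMap_comp R φ' ψ' χ' h'))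
  · refine (joinMap_comp φ.toFun φ'.toFun ψ.toFun ψ'.toFun v).trans ?_
    rw [show ψ.toFun ∘ φ.toFun = χ.toFun from funext h,
      show ψ'.toFun ∘ φ'.toFun = χ'.toFun from funext h']
    rfl
  · refine (torSumMap_comp (φ.homologyMap R) (φ'.homologyMap R) (ψ.homologyMap R)
      (ψ'.homologyMap R) n).trans ?_
    exact congrArg₂ (fun f g => torSumMap f g n) (funext (homologyMap_comp R φ ψ χ h))
      (funext (homologyMap_comp R φ' ψ' χ' h'))

end Hyperdigraph

variable [LinearOrder V] [LinearOrder V'] [LinearOrder W] [LinearOrder W'] [LinearOrder X]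
  [LinearOrder X']

namespace FinHypergraph

variable {H : FinHypergraph V} {H' : FinHypergraph V'} {G : FinHypergraph W}
  {G' : FinHypergraph W'} {F : FinHypergraph X} {F' : FinHypergraph X'}

theorem KU_isShortExact (H : FinHypergraph V) (H' : FinHypergraph V') (n : ℕ) :
    (H.KU (undirectedTorMaps R) H' n).IsShortExact :=
  (H.isInfTensor R H').isShortExact n

theorem KUMap_isMorphism (φ : H.Hom G) (φ' : H'.Hom G') (n : ℕ) :
    (KUMap (undirectedTorMaps R) φ φ' n).IsMorphism :=
  ⟨(H.isInfTensor R H').crossSum_naturality (G.isInfTensor R G') (setBoundary_setMap R φ.toFun)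
    (setMap_mem R φ) (setBoundary_setMap R φ'.toFun) (setMap_mem R φ')
    (setBoundary_setMap R (φ.join φ').toFun) (setMap_mem R (φ.join φ'))
    (setMap_setJoin R φ.toFun φ'.toFun) n,
  (H.isInfTensor R H').torMap_naturality (G.isInfTensor R G') (setBoundary_setMap R φ.toFun)
    (setMap_mem R φ) (setBoundary_setMap R φ'.toFun) (setMap_mem R φ')
    (setBoundary_setMap R (φ.join φ').toFun) (setMap_mem R (φ.join φ'))
    (setMap_setJoin R φ.toFun φ'.toFun) n⟩

theorem homologyMap_eq_id (φ : H.Hom H) (h : ∀ v, φ.toFun v = v) (k : ℕ) :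
    φ.homologyMap R k = 𝟙 _ :=
  infHomologyMap_id _ _ (by rw [show φ.toFun = id from funext h]; exact setMap_id R) k

theorem homologyMap_comp (φ : H.Hom G) (ψ : G.Hom F) (χ : H.Hom F)
    (h : ∀ v, ψ.toFun (φ.toFun v) = χ.toFun v) (k : ℕ) :
    φ.homologyMap R k ≫ ψ.homologyMap R k = χ.homologyMap R k :=
  infHomologyMap_comp _ _ _ _ _ _ (by
    rw [← show ψ.toFun ∘ φ.toFun = χ.toFun from funext h]
    exact setMap_setMap R _ _) k

theorem KUMap_eq_id (τ : UndirectedTorMaps R) (φ : H.Hom H) (φ' : H'.Hom H')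
    (h : ∀ v, φ.toFun v = v) (h' : ∀ v, φ'.toFun v = v) (n : ℕ) :
    KUMap τ φ φ' n = RowMaps.id _ := by
  refine RowMaps.ext ?_ (homologyMap_eq_id R (φ.join φ') (fun v => ?_) n) ?_
  · refine Eq.trans ?_ (tensorSumMap_id (H.homology R) (H'.homology R) n)
    exact congrArg₂ (fun f g => tensorSumMap f g n) (funext (homologyMap_eq_id R φ h))
      (funext (homologyMap_eq_id R φ' h'))
  · change toLex (Sum.map φ.toFun φ'.toFun (ofLex v)) = v
    rw [show φ.toFun = id from funext h, show φ'.toFun = id from funext h', joinMap_id]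
  · refine Eq.trans ?_ (torSumMap_id (H.homology R) (H'.homology R) n)
    exact congrArg₂ (fun f g => torSumMap f g n) (funext (homologyMap_eq_id R φ h))
      (funext (homologyMap_eq_id R φ' h'))

theorem KUMap_comp (τ : UndirectedTorMaps R) (φ : H.Hom G) (φ' : H'.Hom G') (ψ : G.Hom F)
    (ψ' : G'.Hom F') (χ : H.Hom F) (χ' : H'.Hom F') (h : ∀ v, ψ.toFun (φ.toFun v) = χ.toFun v)
    (h' : ∀ v, ψ'.toFun (φ'.toFun v) = χ'.toFun v) (n : ℕ) :
    (KUMap τ φ φ' n).comp (KUMap τ ψ ψ' n) = KUMap τ χ χ' n := by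
  refine RowMaps.ext ?_
    (homologyMap_comp R (φ.join φ') (ψ.join ψ') (χ.join χ') (fun v => ?_) n) ?_
  · refine (tensorSumMap_comp (φ.homologyMap R) (φ'.homologyMap R) (ψ.homologyMap R)
      (ψ'.homologyMap R) n).trans ?_
    exact congrArg₂ (fun f g => tensorSumMap f g n) (funext (homologyMap_comp R φ ψ χ h))
      (funext (homologyMap_comp R φ' ψ' χ' h'))
  · refine (joinMap_comp φ.toFun φ'.toFun ψ.toFun ψ'.toFun v).trans ?_
    rw [show ψ.toFun ∘ φ.toFun = χ.toFun from funext h,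
      show ψ'.toFun ∘ φ'.toFun = χ'.toFun from funext h']
    rfl
  · refine (torSumMap_comp (φ.homologyMap R) (φ'.homologyMap R) (ψ.homologyMap R)
      (ψ'.homologyMap R) n).trans ?_
    exact congrArg₂ (fun f g => torSumMap f g n) (funext (homologyMap_comp R φ ψ χ h))
      (funext (homologyMap_comp R φ' ψ' χ' h'))

end FinHypergraph

theorem Hyperdigraph.KUProj_isMorphism {H : Hyperdigraph V} {H' : Hyperdigraph V'}
    {G : FinHypergraph V} {G' : FinHypergraph V'} (h : H.underlying.edges ⊆ G.edges)
    (h' : H'.underlying.edges ⊆ G'.edges) (n : ℕ) :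
    (KUProj (directedTorMaps R) (undirectedTorMaps R) h h' n).IsMorphism :=
  ⟨(H.isInfTensor R H').crossSum_naturality (G.isInfTensor R G') (setBoundary_seqProj R)
    (seqProj_mem R h) (setBoundary_seqProj R) (seqProj_mem R h') (setBoundary_seqProj R)
    (seqProj_mem R ((H.underlying_join H').trans (FinHypergraph.join_mono h h')))
    (seqProj_seqJoin R) n,
  (H.isInfTensor R H').torMap_naturality (G.isInfTensor R G') (setBoundary_seqProj R)
    (seqProj_mem R h) (setBoundary_seqProj R) (seqProj_mem R h') (setBoundary_seqProj R)
    (seqProj_mem R ((H.underlying_join H').trans (FinHypergraph.join_mono h h')))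
    (seqProj_seqJoin R) n⟩

theorem homologyProj_homologyMap {H : Hyperdigraph V} {G : Hyperdigraph W} {K : FinHypergraph V}
    {L : FinHypergraph W} (φ : H.Hom G) (ψ : K.Hom L) (hφ : ψ.toFun = φ.toFun)
    (h : H.underlying.edges ⊆ K.edges) (h' : G.underlying.edges ⊆ L.edges) (k : ℕ) :
    homologyProj R h k ≫ ψ.homologyMap R k = φ.homologyMap R k ≫ homologyProj R h' k :=
  infHomologyMap_square _ _ _ _ _ _ _ _ (by rw [hφ]; exact setMap_seqProj R φ.toFun) k

/-- Taking inclusions for the morphisms gives the squares of the diagram; taking `φ.level i` and its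
underlying morphism gives the functoriality of the vertical arrows. -/
theorem Hyperdigraph.KUProj_comp_KUMap (τ : DirectedTorMaps R) (τ' : UndirectedTorMaps R)
    {H : Hyperdigraph V} {H' : Hyperdigraph V'} {G : Hyperdigraph W} {G' : Hyperdigraph W'}
    {K : FinHypergraph V} {K' : FinHypergraph V'} {L : FinHypergraph W} {L' : FinHypergraph W'}
    (φ : H.Hom G) (φ' : H'.Hom G') (ψ : K.Hom L) (ψ' : K'.Hom L') (hφ : ψ.toFun = φ.toFun)
    (hφ' : ψ'.toFun = φ'.toFun) (hK : H.underlying.edges ⊆ K.edges)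
    (hK' : H'.underlying.edges ⊆ K'.edges) (hL : G.underlying.edges ⊆ L.edges)
    (hL' : G'.underlying.edges ⊆ L'.edges) (n : ℕ) :
    (KUProj τ τ' hK hK' n).comp (FinHypergraph.KUMap τ' ψ ψ' n) =
      (KUMap τ φ φ' n).comp (KUProj τ τ' hL hL' n) :=
  RowMaps.ext
    (tensorSumMap_square (homologyProj_homologyMap R φ ψ hφ hK hL)
      (homologyProj_homologyMap R φ' ψ' hφ' hK' hL') n)
    (homologyProj_homologyMap R (φ.join φ') (ψ.join ψ')
      (congrArg₂ (fun (f : V → W) (f' : V' → W') (v : V ⊕ₗ V') =>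
        toLex (Sum.map f f' (ofLex v))) hφ hφ')
      ((H.underlying_join H').trans (FinHypergraph.join_mono hK hK'))
      ((G.underlying_join G').trans (FinHypergraph.join_mono hL hL')) n)
    (torSumMap_square (homologyProj_homologyMap R φ ψ hφ hK hL)
      (homologyProj_homologyMap R φ' ψ' hφ' hK' hL') n)

end Rows

theorem theorem5p3 (R : Type u) [CommRing R] [IsDomain R] [IsPrincipalIdealRing R] :
    ∃ (τ : DirectedTorMaps R) (τ' : UndirectedTorMaps R),
      -- the diagram of a pair of hyperdigraphs on disjoint vertex sets
      (∀ (V V' : Type u) [LinearOrder V] [LinearOrder V'] (H : Hyperdigraph V)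
        (H' : Hyperdigraph V') (n : ℕ),
        -- the rows of all six sequences are short exact
        (∀ i : Fin 3, ((H.level i).KU τ (H'.level i) n).IsShortExact ∧
          ((H.underlying.level i).KU τ' (H'.underlying.level i) n).IsShortExact) ∧
        -- all arrows are morphisms of short exact sequences
        (∀ (i j : Fin 3) (hij : i ≤ j), (H.KUIncl τ H' hij n).IsMorphism ∧
          (H.underlying.KUIncl τ' H'.underlying hij n).IsMorphism) ∧
        (∀ i : Fin 3, (H.KUProjLevel τ τ' H' i n).IsMorphism) ∧
        -- the squares commute
        (∀ (i j : Fin 3) (hij : i ≤ j),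
          (H.KUIncl τ H' hij n).comp (H.KUProjLevel τ τ' H' j n) =
            (H.KUProjLevel τ τ' H' i n).comp (H.underlying.KUIncl τ' H'.underlying hij n))) ∧
      -- morphisms of hyperdigraphs induce morphisms of the diagrams
      (∀ (V V' W W' : Type u) [LinearOrder V] [LinearOrder V'] [LinearOrder W] [LinearOrder W']
        (H : Hyperdigraph V) (H' : Hyperdigraph V') (G : Hyperdigraph W) (G' : Hyperdigraph W')
        (φ : H.Hom G) (φ' : H'.Hom G') (n : ℕ),
        (∀ i : Fin 3, (Hyperdigraph.KUMap τ (φ.level i) (φ'.level i) n).IsMorphism ∧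
          (FinHypergraph.KUMap τ' (φ.underlying.level i) (φ'.underlying.level i) n).IsMorphism) ∧
        (∀ (i j : Fin 3) (hij : i ≤ j),
          (H.KUIncl τ H' hij n).comp (Hyperdigraph.KUMap τ (φ.level j) (φ'.level j) n) =
            (Hyperdigraph.KUMap τ (φ.level i) (φ'.level i) n).comp (G.KUIncl τ G' hij n)) ∧
        (∀ (i j : Fin 3) (hij : i ≤ j),
          (H.underlying.KUIncl τ' H'.underlying hij n).comp
              (FinHypergraph.KUMap τ' (φ.underlying.level j) (φ'.underlying.level j) n) =
            (FinHypergraph.KUMap τ' (φ.underlying.level i) (φ'.underlying.level i) n).comp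
              (G.underlying.KUIncl τ' G'.underlying hij n)) ∧
        (∀ i : Fin 3,
          (H.KUProjLevel τ τ' H' i n).comp
              (FinHypergraph.KUMap τ' (φ.underlying.level i) (φ'.underlying.level i) n) =
            (Hyperdigraph.KUMap τ (φ.level i) (φ'.level i) n).comp
              (G.KUProjLevel τ τ' G' i n))) ∧
      -- compatibly with identities and composition
      (∀ (V V' : Type u) [LinearOrder V] [LinearOrder V'] (H : Hyperdigraph V)
        (H' : Hyperdigraph V') (n : ℕ) (i : Fin 3),
        Hyperdigraph.KUMap τ ((Hyperdigraph.Hom.id H).level i) ((Hyperdigraph.Hom.id H').level i) n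
            = RowMaps.id _ ∧
          FinHypergraph.KUMap τ' ((Hyperdigraph.Hom.id H).underlying.level i)
            ((Hyperdigraph.Hom.id H').underlying.level i) n = RowMaps.id _) ∧
      (∀ (V V' W W' X X' : Type u) [LinearOrder V] [LinearOrder V'] [LinearOrder W]
        [LinearOrder W'] [LinearOrder X] [LinearOrder X'] (H : Hyperdigraph V)
        (H' : Hyperdigraph V') (G : Hyperdigraph W) (G' : Hyperdigraph W') (F : Hyperdigraph X)
        (F' : Hyperdigraph X') (φ : H.Hom G) (φ' : H'.Hom G') (ψ : G.Hom F) (ψ' : G'.Hom F')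
        (n : ℕ) (i : Fin 3),
        Hyperdigraph.KUMap τ ((φ.comp ψ).level i) ((φ'.comp ψ').level i) n =
            (Hyperdigraph.KUMap τ (φ.level i) (φ'.level i) n).comp
              (Hyperdigraph.KUMap τ (ψ.level i) (ψ'.level i) n) ∧
          FinHypergraph.KUMap τ' ((φ.comp ψ).underlying.level i) ((φ'.comp ψ').underlying.level i) n
            = (FinHypergraph.KUMap τ' (φ.underlying.level i) (φ'.underlying.level i) n).comp
                (FinHypergraph.KUMap τ' (ψ.underlying.level i) (ψ'.underlying.level i) n)) := by
  refine ⟨directedTorMaps R, undirectedTorMaps R, fun V V' _ _ H H' n => ⟨fun i => ⟨?_, ?_⟩,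
    fun i j hij => ⟨?_, ?_⟩, fun i => ?_, fun i j hij => ?_⟩,
    fun V V' W W' _ _ _ _ H H' G G' φ φ' n => ⟨fun i => ⟨?_, ?_⟩, fun i j hij => ?_,
      fun i j hij => ?_, fun i => ?_⟩,
    fun V V' _ _ H H' n i => ⟨?_, ?_⟩,
    fun V V' W W' X X' _ _ _ _ _ _ H H' G G' F F' φ φ' ψ ψ' n i => ⟨?_, ?_⟩⟩
  · exact Hyperdigraph.KU_isShortExact R _ _ n
  · exact FinHypergraph.KU_isShortExact R _ _ n
  · exact Hyperdigraph.KUMap_isMorphism R _ _ n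
  · exact FinHypergraph.KUMap_isMorphism R _ _ n
  · exact Hyperdigraph.KUProj_isMorphism R _ _ n
  -- Inclusions are morphisms with identity vertex map, upstairs and downstairs, so this square is
  -- an instance of the compatibility of `π` with morphisms.
  · exact (Hyperdigraph.KUProj_comp_KUMap R _ _ (Hyperdigraph.Hom.incl (H.level_mono hij))
      (Hyperdigraph.Hom.incl (H'.level_mono hij)) (FinHypergraph.Hom.incl _)
      (FinHypergraph.Hom.incl _) rfl rfl _ _ _ _ n).symm
  · exact Hyperdigraph.KUMap_isMorphism R _ _ n
  · exact FinHypergraph.KUMap_isMorphism R _ _ n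
  -- Both composites are induced by one morphism from level `i` of the source to level `j` of the
  -- target, with the vertex maps of `φ` and `φ'`.
  · exact (Hyperdigraph.KUMap_comp R _ _ _ _ _
      ((Hyperdigraph.Hom.incl (H.level_mono hij)).comp (φ.level j))
      ((Hyperdigraph.Hom.incl (H'.level_mono hij)).comp (φ'.level j))
      (fun _ => rfl) (fun _ => rfl) n).trans
      (Hyperdigraph.KUMap_comp R _ _ _ _ _ _ _ (fun _ => rfl) (fun _ => rfl) n).symm
  · exact (FinHypergraph.KUMap_comp R _ _ _ _ _
      ((FinHypergraph.Hom.incl (H.underlying.level_mono hij)).comp (φ.underlying.level j))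
      ((FinHypergraph.Hom.incl (H'.underlying.level_mono hij)).comp (φ'.underlying.level j))
      (fun _ => rfl) (fun _ => rfl) n).trans
      (FinHypergraph.KUMap_comp R _ _ _ _ _ _ _ (fun _ => rfl) (fun _ => rfl) n).symm
  · exact Hyperdigraph.KUProj_comp_KUMap R _ _ (φ.level i) (φ'.level i) _ _ rfl rfl _ _ _ _ n
  · exact Hyperdigraph.KUMap_eq_id R _ _ _ (fun _ => rfl) (fun _ => rfl) n
  · exact FinHypergraph.KUMap_eq_id R _ _ _ (fun _ => rfl) (fun _ => rfl) n
  · exact (Hyperdigraph.KUMap_comp R _ _ _ _ _ _ _ (fun _ => rfl) (fun _ => rfl) n).symm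
  · exact (FinHypergraph.KUMap_comp R _ _ _ _ _ _ _ (fun _ => rfl) (fun _ => rfl) n).symm
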